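/- Let $d\ge1$, $\hbar>0$, and let $\Phi:\mathbf R^d\to\mathbf R$ be even, with integrable Fourier transform $\widehat\Phi$, i.e. $\Phi(x)=\int_{\mathbf R^d}\widehat\Phi(h)e^{ih\cdot x}\,dh$ for all $x$. \textbf{Norms.} For a trace-class operator $A$ on $L^2((\mathbf R^d)^j)$ with integral kernel $A(x,y)$ let $W_\hbar[A](x,v)=(2\pi)^{-jd}\int A(x+\frac12\hbar y,x-\frac12\hbar y)e^{-iv\cdot y}dy$ be its Wigner function and $$\widetilde W_\hbar[A](\xi,\eta)=\int\!\!\int e^{i(x\cdot\xi-v\cdot\eta)}W_\hbar[A](x,v)\,dx\,dv=\operatorname{trace}\big(A\,e^{i(\xi\cdot x+i\hbar\eta\cdot\nabla)}\big)$$ its symplectic Fourier transform (defined by the trace when $W_\hbar[A]$ is not integrable). For $\rho>0$ set $\|A\|_\rho=\sup_{\xi,\eta}|\widetilde W_\hbar[A](\xi,\eta)|\,e^{\rho(|\xi|+|\eta|)}\in[0,\infty]$, where $|\xi|=\sum_{k=1}^j|\xi_k|$ for $\xi=(\xi_1,\dots,\xi_j)\in(\mathbf R^d)^j$, with $|\xi_k|$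 the Euclidean norm on $\mathbf R^d$. \textbf{Dynamics.} Let $F^{in}$ be a density operator (nonnegative, trace one) on $L^2(\mathbf R^d)$. Let $F(t)$ be the density-operator-valued solution of the Hartree equation $i\hbar\partial_tF=[-\frac12\hbar^2\Delta+\Phi\star\rho(t),F]$, $F(0)=F^{in}$, where $\rho(t,x)=F(t,x,x)$. For $N\ge1$ let $F^N(t)$ be the density-operator-valued solution of $i\hbar\partial_tF^N=[-\frac12\hbar^2\Delta+\frac1{2N}\sum_{k,l=1}^N\Phi(x_k-x_l),F^N]$ on $L^2((\mathbf R^d)^N)$ with $F^N(0)=(F^{in})^{\otimes N}$, and let $F^N_j(t)$ be its $j$-particle marginal. (Both equations are understood weakly, i.e. for matrix elements between Schwartz functions.) \textbf{Assumptions.} Let $0<\beta<\beta'$ be such that $$\|F^{in}\|_{\beta'}<\infty\quad\text{and}\quad\int|h||\widehat\Phi(h)|e^{\beta'|h|}\,dh<\infty .$$ Put $\alpha=\log\|F^{in}\|_{\beta'}+\log2$ and $C_\Phi^{\beta'}(s)=\int|h||\widehat\Phi(h)|e^{2\beta'|h|(1+|s|)}dh\in[0,\infty]$. \textbf{(0)}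 If $\Phi\neq0$ and $C_\Phi^{\beta'}\big(\frac{\beta'-\beta}{\beta'}\big)<\infty$, there is a unique $\beta_0\in(\beta,\beta')$ such that $$2(1+s)\,s\,C_\Phi^{\beta'}(s)\,e^{\alpha}=\beta'-\beta_0,\qquad s=\frac{\beta_0-\beta}{\beta_0}.\qquad(*)$$ Suppose now that $\beta_0\in(\beta,\beta')$ satisfies $(*)$ (in particular $C_\Phi^{\beta'}(s)<\infty$) and let $T=(\beta_0-\beta)/\beta_0>0$. \textbf{(1)} For all $|t|<T$ and all $N\ge j\ge1$, $$\|F^N_j(t)-F(t)^{\otimes j}\|_\beta\le\frac{C(j,|t|/T)}N\,\frac{|t|}T\,\|F^{in}\|_{\beta'}^j ,$$ where, with $a=(j+1)\log(1/\tau)$ and $x(a)=1+\frac12(\sqrt{a^2+4}-a)$, $$C(j,\tau)=2^j\left[(1+\gamma(j,\tau))\left(\frac{j+1}{(1-\tau)^2}+\frac{2\tau}{(1-\tau)^3}\right)+\frac4{1-\tau}\right],\qquad\gamma(j,\tau)=\exp\left(\frac{a\,x(a)+x(a)^2}{e^{x(a)}(\log\tau)^2}\right),\quad\gamma(j,0)=1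 .$$ \textbf{(2)} $\|F^N_j(t)-F(t)^{\otimes j}\|_\beta\to0$ as $N\to\infty$, uniformly as $t/T$ runs through any given compact subset of $(-1,1)$ and for $1\le j\le N$ satisfying $$j\le\frac{\log N+\log(T/|t|)}{\log\|F^{in}\|_{\beta'}+2\log2+1/(e\log(T/|t|))}$$ (no restriction on $j\le N$ if $t=0$). \textbf{(3)} For every $\tau\in[0,1)$, $C(j,\tau)>0$ for all $j$, and, as $j\to\infty$, $$C(j,\tau)\sim\frac{j2^j}{(1-\tau)^2}\left(1+\exp\frac{(j+1)\log(1/\tau)+1}{e(\log\tau)^2}\right),$$ where for $\tau=0$ the exponential is read as its limit $1$. -/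

import Mathlib

open MeasureTheory Filter Topology Asymptotics
open scoped ENNReal SchwartzMap Laplacian

noncomputable section

namespace MeanField

/-! ### Hilbert spaces, density operators and the trace -/

/-- The Hilbert space `L²(ℝ^ι; ℂ)`. One-particle space: `ι = Fin d`.
`N`-particle space: `ι = Fin N × Fin d`. -/
abbrev L2 (ι : Type) [Fintype ι] : Type :=
  Lp ℂ 2 (volume : Measure (EuclideanSpace ℝ ι))

/-- The class in `L²` of a square integrable function (and `0` for all other functions). -/
def toL2 {ι : Type} [Fintype ι] (f : EuclideanSpace ℝ ι → ℂ) : L2 ι :=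
  open Classical in if h : MemLp f 2 volume then h.toLp f else 0

/-- Index set of a fixed orthonormal (Hilbert) basis of `H`. -/
def basisIndex (H : Type) [NormedAddCommGroup H] [InnerProductSpace ℂ H] [CompleteSpace H] :
    Set H :=
  (exists_hilbertBasis ℂ H).choose

/-- A fixed orthonormal (Hilbert) basis of `H`. The notions below do not depend on it. -/
def basis (H : Type) [NormedAddCommGroup H] [InnerProductSpace ℂ H] [CompleteSpace H] :
    HilbertBasis (basisIndex H) ℂ H :=
  (exists_hilbertBasis ℂ H).choose_spec.choose

/-- The trace `∑ₖ ⟨eₖ, A eₖ⟩`. It is applied below only to trace-class operators. -/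
def trace {H : Type} [NormedAddCommGroup H] [InnerProductSpace ℂ H] [CompleteSpace H]
    (A : H → H) : ℂ :=
  ∑' k, inner ℂ (basis H k) (A (basis H k))

/-- Density operators: bounded, nonnegative, self-adjoint, of trace one. (For a nonnegative
operator, convergence of the series in one basis means that the operator is trace class.) -/
def IsDensityOperator {H : Type} [NormedAddCommGroup H] [InnerProductSpace ℂ H]
    [CompleteSpace H] (D : H →L[ℂ] H) : Prop :=
  D.IsPositive ∧ HasSum (fun k => inner ℂ (basis H k) (D (basis H k))) 1

/-! ### Tensor products and marginals -/

/-- The position `x_k ∈ ℝ^d` of the `k`-th particle. -/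
def particle {N d : ℕ} (x : EuclideanSpace ℝ (Fin N × Fin d)) (k : Fin N) :
    EuclideanSpace ℝ (Fin d) :=
  WithLp.toLp 2 fun i => x (k, i)

/-- The product function `u_1 ⊗ ⋯ ⊗ u_N`, i.e. `x ↦ ∏ₖ u_k(x_k)`. -/
def tensorVec {N d : ℕ} (u : Fin N → L2 (Fin d)) : L2 (Fin N × Fin d) :=
  toL2 fun x => ∏ k, (u k) (particle x k)

/-- The operator `A_1 ⊗ ⋯ ⊗ A_N` on the `N`-particle space, for bounded `A_k` on the one-particle
space, expanded on the orthonormal basis `e_K = e_{K 1} ⊗ ⋯ ⊗ e_{K N}`: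
`(A_1 ⊗ ⋯ ⊗ A_N) Ψ = ∑_K ⟨e_K, Ψ⟩ (A_1 e_{K 1} ⊗ ⋯ ⊗ A_N e_{K N})`. -/
def tensorOp {N d : ℕ} (A : Fin N → (L2 (Fin d) →L[ℂ] L2 (Fin d))) (Ψ : L2 (Fin N × Fin d)) :
    L2 (Fin N × Fin d) :=
  ∑' K : Fin N → basisIndex (L2 (Fin d)),
    inner ℂ (tensorVec fun k => basis (L2 (Fin d)) (K k)) Ψ •
      tensorVec fun k => A k (basis (L2 (Fin d)) (K k))

/-- The tensor power `A^{⊗ N}`. -/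
def tensorPow {d : ℕ} (N : ℕ) (A : L2 (Fin d) →L[ℂ] L2 (Fin d)) :
    L2 (Fin N × Fin d) → L2 (Fin N × Fin d) :=
  tensorOp fun _ : Fin N => A

/-- `Dj` is the `j`-particle marginal of the `N`-particle density operator `D`:
`trace (D (A_1 ⊗ ⋯ ⊗ A_j ⊗ I ⊗ ⋯ ⊗ I)) = trace (Dj (A_1 ⊗ ⋯ ⊗ A_j))` for all bounded
`A_1, …, A_j`. -/
def IsMarginal {N d j : ℕ} (D : L2 (Fin N × Fin d) →L[ℂ] L2 (Fin N × Fin d))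
    (Dj : L2 (Fin j × Fin d) →L[ℂ] L2 (Fin j × Fin d)) : Prop :=
  IsDensityOperator Dj ∧
  ∀ A : Fin j → (L2 (Fin d) →L[ℂ] L2 (Fin d)),
    trace (fun Ψ => D (tensorOp (fun k : Fin N =>
        if h : (k : ℕ) < j then A ⟨k, h⟩ else ContinuousLinearMap.id ℂ _) Ψ)) =
      trace (fun Ψ => Dj (tensorOp A Ψ))

/-! ### The von Neumann and Hartree equations -/

/-- `(-½ ħ² Δ + V) φ` for a test function `φ` and a bounded continuous potential `V`. -/
def hamiltonian {ι : Type} [Fintype ι] (hbar : ℝ) (V : EuclideanSpace ℝ ι → ℝ)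
    (φ : 𝓢(EuclideanSpace ℝ ι, ℂ)) : L2 ι :=
  toL2 fun x => -((hbar : ℂ) ^ 2 / 2) * (Δ (φ : EuclideanSpace ℝ ι → ℂ)) x + (V x : ℂ) * φ x

/-- `t ↦ D t` is a solution, with values in the density operators, of the von Neumann equation
`i ħ ∂_t D = [-½ ħ² Δ + V(t), D]`: the equation holds after taking matrix elements between
arbitrary Schwartz functions. -/
structure IsVonNeumannSolution {ι : Type} [Fintype ι] (hbar : ℝ)
    (V : ℝ → EuclideanSpace ℝ ι → ℝ) (D : ℝ → (L2 ι →L[ℂ] L2 ι)) : Prop where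
  density : ∀ t, IsDensityOperator (D t)
  equation : ∀ (φ ψ : 𝓢(EuclideanSpace ℝ ι, ℂ)) (t : ℝ),
    HasDerivAt (fun s => inner ℂ (toL2 φ) (D s (toL2 ψ)))
      ((inner ℂ (hamiltonian hbar (V t) φ) (D t (toL2 ψ)) -
        inner ℂ (toL2 φ) (D t (hamiltonian hbar (V t) ψ))) / (Complex.I * (hbar : ℂ))) t

/-- The mean-field `N`-body potential `V_N(x) = (1 / 2N) ∑_{k,l} Φ(x_k - x_l)`. -/
def nBodyPotential {d : ℕ} (N : ℕ) (Φ : EuclideanSpace ℝ (Fin d) → ℝ)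
    (x : EuclideanSpace ℝ (Fin N × Fin d)) : ℝ :=
  1 / (2 * (N : ℝ)) * ∑ k : Fin N, ∑ l : Fin N, Φ (particle x k - particle x l)

/-- `t ↦ D t` solves the `N`-body von Neumann equation `i ħ ∂_t D = [-½ ħ² Δ + V_N, D]`. -/
def IsNBodySolution {d : ℕ} (hbar : ℝ) (Φ : EuclideanSpace ℝ (Fin d) → ℝ) (N : ℕ)
    (D : ℝ → (L2 (Fin N × Fin d) →L[ℂ] L2 (Fin N × Fin d))) : Prop :=
  IsVonNeumannSolution hbar (fun _ => nBodyPotential N Φ) D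

/-- `ρ(x) = D(x, x)`, the diagonal of the integral kernel of the density operator `D`, as an
integrable function: `trace (a D) = ∫ a ρ` for every bounded measurable multiplier `a`. -/
def IsPositionDensity {ι : Type} [Fintype ι] (D : L2 ι →L[ℂ] L2 ι)
    (ρ : EuclideanSpace ℝ ι → ℝ) : Prop :=
  Integrable ρ ∧
  ∀ a : EuclideanSpace ℝ ι → ℂ, Measurable a → (∃ M : ℝ, ∀ x, ‖a x‖ ≤ M) →
    trace (fun u : L2 ι => toL2 fun x => a x * (D u) x) = ∫ x, a x * (ρ x : ℂ)

/-- `t ↦ F t` solves the Hartree equation `i ħ ∂_t F = [-½ ħ² Δ + Φ ⋆ ρ(t), F]`, where `ρ(t)` is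
the diagonal of the integral kernel of `F t`. -/
def IsHartreeSolution {d : ℕ} (hbar : ℝ) (Φ : EuclideanSpace ℝ (Fin d) → ℝ)
    (F : ℝ → (L2 (Fin d) →L[ℂ] L2 (Fin d))) : Prop :=
  ∃ ρ : ℝ → EuclideanSpace ℝ (Fin d) → ℝ, (∀ t, IsPositionDensity (F t) (ρ t)) ∧
    IsVonNeumannSolution hbar (fun t x => ∫ y, Φ (x - y) * ρ t y) F

/-! ### The analytic norms -/

/-- The unitary operator `u ↦ e^{i ξ·(y - ħη/2)} u(y - ħη)`, i.e. `e^{i(ξ·x - η·p)}` with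
`p = -iħ∇`. -/
def weyl {ι : Type} [Fintype ι] (hbar : ℝ) (ξ η : EuclideanSpace ℝ ι) (u : L2 ι) : L2 ι :=
  toL2 fun y => Complex.exp (Complex.I * (inner ℝ ξ (y - (hbar / 2) • η) : ℝ)) * u (y - hbar • η)

/-- The symplectic Fourier transform `∫∫ e^{i(x·ξ - v·η)} W(x, v) dx dv` of the Wigner function
`W(x, v) = (2π)^{-n} ∫ A(x + ħy/2, x - ħy/2) e^{-i v·y} dy` of a trace-class operator `A` with
integral kernel `A(x, y)`. By Fourier inversion in `v` it is
`∫ e^{i x·ξ} A(x - ħη/2, x + ħη/2) dx = trace (A e^{i(ξ·x - η·p)})`;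
this last expression makes sense for all trace-class operators, whether or not the Wigner function
is integrable. -/
def wignerFourier {ι : Type} [Fintype ι] (hbar : ℝ) (A : L2 ι → L2 ι)
    (ξ η : EuclideanSpace ℝ ι) : ℂ :=
  trace fun u => A (weyl hbar ξ η u)

/-- `‖A‖_β = sup_{ξ,η} |W̃_ħ[A](ξ, η)| e^{β(|ξ| + |η|)}`, where `size` is the function `|·|`. -/
def wignerNorm {ι : Type} [Fintype ι] (hbar β : ℝ) (size : EuclideanSpace ℝ ι → ℝ)
    (A : L2 ι → L2 ι) : ℝ≥0∞ :=
  ⨆ (ξ : EuclideanSpace ℝ ι) (η : EuclideanSpace ℝ ι),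
    ‖wignerFourier hbar A ξ η‖ₑ * ENNReal.ofReal (Real.exp (β * (size ξ + size η)))

/-- The norm `‖·‖_β` for one-particle operators. -/
def oneNorm {d : ℕ} (hbar β : ℝ) (A : L2 (Fin d) → L2 (Fin d)) : ℝ≥0∞ :=
  wignerNorm hbar β (fun ξ => ‖ξ‖) A

/-- The norm `‖·‖_β` for `j`-particle operators, with `|ξ| = ∑ₖ |ξ_k|` for
`ξ = (ξ_1, …, ξ_j) ∈ (ℝ^d)^j` (Euclidean norms `|ξ_k|` in `ℝ^d`). -/
def manyNorm {d j : ℕ} (hbar β : ℝ) (A : L2 (Fin j × Fin d) → L2 (Fin j × Fin d)) : ℝ≥0∞ :=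
  wignerNorm hbar β (fun ξ => ∑ k, ‖particle ξ k‖) A

/-! ### The potential, the time `T` and the constant `C(j, τ)` -/

/-- `Φ` is the potential with integrable Fourier transform `Φhat`, in the normalization
`Φhat(h) = (2π)^{-d} ∫ Φ(x) e^{-i h·x} dx`, i.e. `Φ(x) = ∫ Φhat(h) e^{i h·x} dh`. -/
def HasFourierTransform {d : ℕ} (Φ : EuclideanSpace ℝ (Fin d) → ℝ)
    (Φhat : EuclideanSpace ℝ (Fin d) → ℂ) : Prop :=
  Integrable Φhat ∧
  ∀ x, (Φ x : ℂ) = ∫ h, Φhat h * Complex.exp (Complex.I * (inner ℝ h x : ℝ))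

/-- `∫ |h| |Φhat(h)| e^{a |h|} dh ∈ [0, ∞]`. -/
def expMoment {d : ℕ} (Φhat : EuclideanSpace ℝ (Fin d) → ℂ) (a : ℝ) : ℝ≥0∞ :=
  ∫⁻ h, ‖h‖ₑ * ‖Φhat h‖ₑ * ENNReal.ofReal (Real.exp (a * ‖h‖))

/-- `C_Φ^β(t) = ∫ |h| |Φhat(h)| e^{2β|h|(1+|t|)} dh ∈ [0, ∞]`. -/
def CPhi {d : ℕ} (Φhat : EuclideanSpace ℝ (Fin d) → ℂ) (β t : ℝ) : ℝ≥0∞ :=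
  expMoment Φhat (2 * β * (1 + |t|))

/-- `T = (β₀ - β) / β₀`. -/
def timeT (β β₀ : ℝ) : ℝ := (β₀ - β) / β₀

/-- The equation that determines `β₀ = β₀[α, β, β', Φ]`: `β < β₀ < β'` and
`2 (1 + s) s C_Φ^{β'}(s) e^α = β' - β₀` with `s = (β₀ - β) / β₀`
(in particular `C_Φ^{β'}(s)` is finite). -/
def IsBetaZero {d : ℕ} (α β β' : ℝ) (Φhat : EuclideanSpace ℝ (Fin d) → ℂ) (β₀ : ℝ) : Prop :=
  β < β₀ ∧ β₀ < β' ∧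
  ENNReal.ofReal (2 * (1 + timeT β β₀) * timeT β β₀) * CPhi Φhat β' (timeT β β₀) *
      ENNReal.ofReal (Real.exp α) = ENNReal.ofReal (β' - β₀)

/-- `x(a) = 1 + ½ (√(a² + 4) - a)`, the maximum point of `x ↦ x (a + x) e^{-x}` on `[0, ∞)`. -/
def xMax (a : ℝ) : ℝ := 1 + (Real.sqrt (a ^ 2 + 4) - a) / 2

/-- `γ(j, τ) = exp ((a x(a) + x(a)²) / (e^{x(a)} (log (1/τ))²))` with `a = (j + 1) log (1/τ)`.
At `τ = 0` this expression evaluates to `1`, its limit as `τ → 0`. -/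
def gammaConst (j : ℕ) (τ : ℝ) : ℝ :=
  Real.exp
    ((((j : ℝ) + 1) * Real.log (1 / τ) * xMax (((j : ℝ) + 1) * Real.log (1 / τ)) +
        xMax (((j : ℝ) + 1) * Real.log (1 / τ)) ^ 2) /
      (Real.exp (xMax (((j : ℝ) + 1) * Real.log (1 / τ))) * Real.log (1 / τ) ^ 2))

/-- `C(j, τ) = 2^j [(1 + γ(j,τ)) ((j+1)/(1-τ)² + 2τ/(1-τ)³) + 4/(1-τ)]`. -/
def constC (j : ℕ) (τ : ℝ) : ℝ :=
  2 ^ j * ((1 + gammaConst j τ) * (((j : ℝ) + 1) / (1 - τ) ^ 2 + 2 * τ / (1 - τ) ^ 3) +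
    4 / (1 - τ))

end MeanField

end

/-!
The proof works with the functions `(ξ, η) ↦ trace (D W(ξ, η))`, where `W(ξ, η) = e^{i(ξ·x - η·p)}` is
the Weyl operator; these are the symplectic Fourier transforms of the Wigner functions, in terms of
which the norms are defined. In these variables everything becomes scalar:

* The free propagator carries Weyl operators along straight lines (`freeOp_weylOp`), so that for a
  solution of a von Neumann equation `trace (D(t) W(ξ, η + tξ))` changes only through the commutator of
  the Weyl operator with the potential (`expect_weylOp_integral`).
* A plane wave of frequency `h` in the potential shifts `ξ` by `h` and contributes a factor of modulus
  at most `|h| |η|`, uniformly in `ħ` (`abs_sinFactor_le`). This gives integral equations for the Hartree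
  solution (`hartree_integral`), for its tensor powers (`prodExpect_integral`) and for the `N`-body
  solution (`nBody_integral`).
* The transform of the `j`-particle marginal is the `N`-particle transform at points whose components
  outside of the first `j` particles vanish (`IsMarginal.manyExpect_eq`). At points `(Ξ, H)` supported
  in a set `J` of `j` particles, pairs outside of `J` do not contribute. A pair with one member in `J`
  acts on the factorized state exactly as the mean field does (`pairRate_prodExpect`). So the
  difference between the `N`-body and the factorized transforms on `J` is driven by the same difference
  on sets of `j + 1` particles, plus terms of relative size `j / N` (`ChaosData.rate_difference`).

The rates of change lose one power of `|H|`. With the weight `exp((β's - β')|Ξ| + (κs - β')|H|)`, where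
`κ = (β' - β₀)/|t|`, this power is recovered by the time integration, because the weight grows along free
trajectories at a rate at least comparable to `κ|H|` (`norm_integral_flow_le`): as long as `C_Φ M` is at
most `κ / 4`, each use of the integral equation gains a factor `1/2` over the factor `M` paid for the
additional particle. Starting from the trivial bound by a constant, an iteration over all sets of
particles at once converges (`norm_le_of_rate`). This is where working with all points `(Ξ, H)` of the
`N`-particle space, instead of a hierarchy of marginals, saves the summation over `j`. The result is
`2 M^j` for the transforms themselves and `8 (τ / N) (3M/2)^j` for the difference, with `τ = |t| / T`
(`ChaosData.norm_difference_le`). The equation for `β₀` is what makes the smallness condition hold, and at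
the final time the weight is at most `exp(-β(|Ξ| + |H|))`, so that this is an estimate in the norm of
index `β` (`manyNorm_difference_le`).

The convergence estimate follows because `C(j, τ)` is at least `8 * 2^j` (`eight_mul_le_constC`). The
uniform statement follows as well: the restriction on `j` gives `(4M)^j ≤ N / τ`, and `(3M/2)^j` is smaller
than `(4M)^j` by the factor `(3/8)^j`; this settles large `j`, and for bounded `j` the factor `1 / N`
suffices. The number `β₀` exists and is unique because the two sides of its equation are continuous and
monotone in opposite directions (`existsUnique_betaZero`). The asymptotics of `C(j, τ)` reduces to
that of the exponent in `γ(j, τ)`, where `x(a) = 1 + O(1/a)` is close to the maximizer of `x e^{-x}`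
(`isEquivalent_constC`).
-/

noncomputable section

namespace MeanField

/-! ### Hilbert–Schmidt operators and the trace pairing -/

section Trace

set_option linter.unusedSectionVars false

variable {H : Type} [NormedAddCommGroup H] [InnerProductSpace ℂ H] [CompleteSpace H]

lemma tsum_enorm_inner_sq {ι : Type} (b : HilbertBasis ι ℂ H) (x : H) :
    ∑' k, ‖inner ℂ (b k) x‖ₑ ^ 2 = ‖x‖ₑ ^ 2 := by
  have h := b.hasSum_inner_mul_inner x x
  have h2 : HasSum (fun k => ‖inner ℂ (b k) x‖ ^ 2) (‖x‖ ^ 2) := by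
    have h3 := Complex.hasSum_re h
    convert h3 using 1
    · ext k
      rw [← inner_conj_symm x (b k), ← Complex.normSq_eq_conj_mul_self, Complex.normSq_eq_norm_sq,
        Complex.ofReal_re]
    · rw [inner_self_eq_norm_sq_to_K]
      norm_cast
  have h4 : ∀ y : ℂ, ‖y‖ₑ ^ 2 = ENNReal.ofReal (‖y‖ ^ 2) := fun y => by
    rw [ENNReal.ofReal_pow (norm_nonneg _), ofReal_norm]
  rw [← ofReal_norm x, ← ENNReal.ofReal_pow (norm_nonneg _), ← h2.tsum_eq,
    ENNReal.ofReal_tsum_of_nonneg (fun _ => by positivity) h2.summable]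
  simp_rw [h4]

/-- The Hilbert–Schmidt norm of an operator and of its adjoint agree, in any two bases. -/
lemma tsum_enorm_adjoint_sq {ι κ : Type} (e : HilbertBasis ι ℂ H) (b : HilbertBasis κ ℂ H)
    (R : H →L[ℂ] H) :
    ∑' k, ‖R.adjoint (b k)‖ₑ ^ 2 = ∑' l, ‖R (e l)‖ₑ ^ 2 := by
  simp_rw [← tsum_enorm_inner_sq e (R.adjoint _), ← tsum_enorm_inner_sq b (R _)]
  rw [ENNReal.tsum_comm]
  refine tsum_congr fun l => tsum_congr fun k => ?_
  rw [ContinuousLinearMap.adjoint_inner_right, ← ofReal_norm, ← ofReal_norm, norm_inner_symm]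

lemma hasSum_norm_sq_iff {ι : Type} {f : ι → H} {S : ℝ} (hS : 0 ≤ S) :
    HasSum (fun k => ‖f k‖ ^ 2) S ↔ ∑' k, ‖f k‖ₑ ^ 2 = ENNReal.ofReal S := by
  have h4 : ∀ k, ‖f k‖ₑ ^ 2 = ENNReal.ofReal (‖f k‖ ^ 2) := fun k => by
    rw [ENNReal.ofReal_pow (norm_nonneg _), ofReal_norm]
  simp_rw [h4]
  constructor
  · intro h
    rw [← ENNReal.ofReal_tsum_of_nonneg (fun _ => by positivity) h.summable, h.tsum_eq]
  · intro h
    have hs : Summable (fun k => ‖f k‖ ^ 2) := by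
      have := ENNReal.summable_toReal (f := fun k => ENNReal.ofReal (‖f k‖ ^ 2)) (by rw [h]; exact ENNReal.ofReal_ne_top)
      refine this.congr fun k => ENNReal.toReal_ofReal (by positivity)
    have := hs.hasSum
    rw [← ENNReal.ofReal_tsum_of_nonneg (fun _ => by positivity) hs,
      ENNReal.ofReal_eq_ofReal_iff (tsum_nonneg fun _ => by positivity) hS] at h
    rwa [h] at this

lemma hasSum_norm_adjoint_sq {ι κ : Type} (e : HilbertBasis ι ℂ H) (b : HilbertBasis κ ℂ H)
    {R : H →L[ℂ] H} {S : ℝ} (hR : HasSum (fun l => ‖R (e l)‖ ^ 2) S) :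
    HasSum (fun k => ‖R.adjoint (b k)‖ ^ 2) S := by
  have hS : 0 ≤ S := hR.nonneg fun _ => by positivity
  rw [hasSum_norm_sq_iff hS] at hR ⊢
  rw [tsum_enorm_adjoint_sq e b, hR]

lemma hasSum_norm_sq_basis {ι κ : Type} (e : HilbertBasis ι ℂ H) (b : HilbertBasis κ ℂ H)
    {R : H →L[ℂ] H} {S : ℝ} (hR : HasSum (fun l => ‖R (e l)‖ ^ 2) S) :
    HasSum (fun k => ‖R (b k)‖ ^ 2) S := by
  simpa using hasSum_norm_adjoint_sq b b (hasSum_norm_adjoint_sq e b hR)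

/-- Hilbert–Schmidt operators form a right ideal. -/
lemma summable_norm_comp_sq {ι κ : Type} (e : HilbertBasis ι ℂ H) (b : HilbertBasis κ ℂ H)
    {R : H →L[ℂ] H} {S : ℝ} (hR : HasSum (fun l => ‖R (e l)‖ ^ 2) S) (B : H →L[ℂ] H) :
    Summable (fun k => ‖R (B (b k))‖ ^ 2) ∧ ∑' k, ‖R (B (b k))‖ ^ 2 ≤ ‖B‖ ^ 2 * S := by
  have h1 := hasSum_norm_adjoint_sq e e hR
  have h2 : ∀ l, ‖(R ∘L B).adjoint (e l)‖ ^ 2 ≤ ‖B‖ ^ 2 * ‖R.adjoint (e l)‖ ^ 2 := fun l => by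
    rw [ContinuousLinearMap.adjoint_comp, ← mul_pow]
    gcongr
    simpa using (B.adjoint).le_opNorm (R.adjoint (e l))
  have h3 : Summable (fun l => ‖(R ∘L B).adjoint (e l)‖ ^ 2) :=
    Summable.of_nonneg_of_le (fun _ => by positivity) h2 (h1.summable.mul_left _)
  have h4 := hasSum_norm_adjoint_sq e b h3.hasSum
  simp only [ContinuousLinearMap.adjoint_adjoint] at h4
  refine ⟨h4.summable, h4.tsum_eq.trans_le ?_⟩
  rw [← h1.tsum_eq, ← tsum_mul_left]
  exact h3.tsum_le_tsum h2 (h1.summable.mul_left _)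

lemma summable_inner_adjoint_sq {ι κ : Type} (e : HilbertBasis ι ℂ H) (b : HilbertBasis κ ℂ H)
    {R : H →L[ℂ] H} {S : ℝ} (hR : HasSum (fun l => ‖R (e l)‖ ^ 2) S) (A : H →L[ℂ] H) :
    Summable (fun p : κ × ι => ‖inner ℂ (b p.1) (A.adjoint (R.adjoint (e p.2)))‖ ^ 2) := by
  have hR' := hasSum_norm_adjoint_sq e e hR
  have h1 : ∑' l, ‖A.adjoint (R.adjoint (e l))‖ₑ ^ 2 ≠ ∞ := by
    have h0 : Summable (fun l => ‖A.adjoint (R.adjoint (e l))‖ ^ 2) := by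
      refine Summable.of_nonneg_of_le (fun _ => by positivity) (fun l => ?_)
        (hR'.summable.mul_left (‖A.adjoint‖ ^ 2))
      rw [← mul_pow]
      gcongr
      exact A.adjoint.le_opNorm _
    rw [(hasSum_norm_sq_iff (tsum_nonneg fun _ => by positivity)).1 h0.hasSum]
    exact ENNReal.ofReal_ne_top
  have h2 : ∑' p : κ × ι, ‖inner ℂ (b p.1) (A.adjoint (R.adjoint (e p.2)))‖ₑ ^ 2 ≠ ∞ := by
    rw [ENNReal.tsum_prod', ENNReal.tsum_comm]
    simp_rw [tsum_enorm_inner_sq b]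
    exact h1
  refine (ENNReal.summable_toReal h2).congr fun p => ?_
  simp

/-- The trace of `C* R* R B` in an arbitrary basis `b`, rewritten by moving the Hilbert–Schmidt
factors `R` to the outside. -/
lemma hasSum_inner_hilbertSchmidt {ι κ : Type} (e : HilbertBasis ι ℂ H) (b : HilbertBasis κ ℂ H)
    {R : H →L[ℂ] H} {S : ℝ} (hR : HasSum (fun l => ‖R (e l)‖ ^ 2) S) (B C : H →L[ℂ] H) :
    HasSum (fun k => inner ℂ (R (C (b k))) (R (B (b k))))
      (∑' l, inner ℂ (R.adjoint (e l)) (B (C.adjoint (R.adjoint (e l))))) := by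
  set p : κ → ι → ℂ := fun k l => inner ℂ (R (C (b k))) (e l) * inner ℂ (e l) (R (B (b k)))
    with hp
  have hle : ∀ k l, ‖p k l‖ ≤ ‖inner ℂ (b k) (B.adjoint (R.adjoint (e l)))‖ ^ 2 +
      ‖inner ℂ (b k) (C.adjoint (R.adjoint (e l)))‖ ^ 2 := fun k l => by
    have h1 : ‖inner ℂ (R (C (b k))) (e l)‖ = ‖inner ℂ (b k) (C.adjoint (R.adjoint (e l)))‖ := by
      rw [ContinuousLinearMap.adjoint_inner_right, ContinuousLinearMap.adjoint_inner_right]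
    have h2 : ‖inner ℂ (e l) (R (B (b k)))‖ = ‖inner ℂ (b k) (B.adjoint (R.adjoint (e l)))‖ := by
      rw [ContinuousLinearMap.adjoint_inner_right, ContinuousLinearMap.adjoint_inner_right,
        norm_inner_symm]
    rw [hp, norm_mul, h1, h2]
    generalize ‖inner ℂ (b k) (B.adjoint (R.adjoint (e l)))‖ = x
    generalize ‖inner ℂ (b k) (C.adjoint (R.adjoint (e l)))‖ = y
    nlinarith [sq_nonneg (x - y), sq_nonneg x, sq_nonneg y]
  have hsum : Summable (fun q : κ × ι => p q.1 q.2) :=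
    Summable.of_norm_bounded ((summable_inner_adjoint_sq e b hR B).add
      (summable_inner_adjoint_sq e b hR C)) fun q => hle q.1 q.2
  have hrow : ∀ k, HasSum (p k) (inner ℂ (R (C (b k))) (R (B (b k)))) :=
    fun k => e.hasSum_inner_mul_inner _ _
  have hcol : ∀ l, HasSum (fun k => p k l)
      (inner ℂ (R.adjoint (e l)) (B (C.adjoint (R.adjoint (e l))))) := fun l => by
    have := b.hasSum_inner_mul_inner (B.adjoint (R.adjoint (e l))) (C.adjoint (R.adjoint (e l)))
    rw [ContinuousLinearMap.adjoint_inner_left] at this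
    have h0 : ∀ k, p k l = inner ℂ (B.adjoint (R.adjoint (e l))) (b k) *
        inner ℂ (b k) (C.adjoint (R.adjoint (e l))) := fun k => by
      rw [hp, ContinuousLinearMap.adjoint_inner_left, ContinuousLinearMap.adjoint_inner_left,
        ContinuousLinearMap.adjoint_inner_right, ContinuousLinearMap.adjoint_inner_right, mul_comm]
    simpa only [h0] using this
  have h3 := hsum.hasSum.prod_fiberwise (g := fun k => inner ℂ (R (C (b k))) (R (B (b k)))) hrow
  have h4 := HasSum.prod_fiberwise (f := fun q : ι × κ => p q.2 q.1) hsum.prod_symm.hasSum hcol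
  rw [h4.tsum_eq]
  have h5 : ∑' q : ι × κ, p q.swap.1 q.swap.2 = ∑' q : κ × ι, p q.1 q.2 :=
    (Equiv.prodComm ι κ).tsum_eq (fun q : κ × ι => p q.1 q.2)
  rwa [h5]

/-- A density operator has a self-adjoint Hilbert–Schmidt square root. -/
lemma IsDensityOperator.exists_sqrt {D : H →L[ℂ] H} (hD : IsDensityOperator D) :
    ∃ R : H →L[ℂ] H, R.adjoint = R ∧ (∀ x y, inner ℂ x (D y) = inner ℂ (R x) (R y)) ∧
      HasSum (fun l => ‖R (basis H l)‖ ^ 2) 1 := by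
  obtain ⟨hpos, htr⟩ := hD
  have h0 : (0 : H →L[ℂ] H) ≤ D := (ContinuousLinearMap.nonneg_iff_isPositive D).2 hpos
  have hRR : CFC.sqrt D * CFC.sqrt D = D := CFC.sqrt_mul_sqrt_self D h0
  have hRsa : (CFC.sqrt D).adjoint = CFC.sqrt D :=
    ((ContinuousLinearMap.nonneg_iff_isPositive _).1
      (CFC.sqrt_nonneg D)).isSelfAdjoint.adjoint_eq
  have hinner : ∀ x y, inner ℂ x (D y) = inner ℂ (CFC.sqrt D x) (CFC.sqrt D y) := fun x y => by
    nth_rw 1 [← hRR]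
    rw [mul_apply_eq_comp, ← ContinuousLinearMap.adjoint_inner_left, hRsa]
  refine ⟨CFC.sqrt D, hRsa, hinner, ?_⟩
  have := Complex.hasSum_re htr
  rw [Complex.one_re] at this
  convert this using 1
  ext l
  rw [hinner, inner_self_eq_norm_sq_to_K]
  norm_cast

lemma IsDensityOperator.norm_le_one {D : H →L[ℂ] H} (hD : IsDensityOperator D) : ‖D‖ ≤ 1 := by
  obtain ⟨R, hRsa, hinner, hR⟩ := hD.exists_sqrt
  have hR1 : ∀ x, ‖R x‖ ≤ ‖x‖ := fun x => by
    have h1 : ‖R x‖ₑ ^ 2 ≤ ‖x‖ₑ ^ 2 := by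
      rw [← tsum_enorm_inner_sq (basis H) (R x)]
      calc ∑' k, ‖inner ℂ (basis H k) (R x)‖ₑ ^ 2
          ≤ ∑' k, ‖R (basis H k)‖ₑ ^ 2 * ‖x‖ₑ ^ 2 := by
            refine ENNReal.tsum_le_tsum fun k => ?_
            rw [← hRsa, ContinuousLinearMap.adjoint_inner_right, hRsa, ← mul_pow]
            gcongr
            rw [← ofReal_norm, ← ofReal_norm, ← ofReal_norm, ← ENNReal.ofReal_mul (norm_nonneg _)]
            exact ENNReal.ofReal_le_ofReal (norm_inner_le_norm _ _)
        _ = ‖x‖ₑ ^ 2 := by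
            rw [ENNReal.tsum_mul_right, (hasSum_norm_sq_iff zero_le_one).1 hR]
            simp
    have h2 := (ENNReal.pow_le_pow_left_iff two_ne_zero).1 h1
    rwa [← ofReal_norm, ← ofReal_norm, ENNReal.ofReal_le_ofReal_iff (norm_nonneg _)] at h2
  refine ContinuousLinearMap.opNorm_le_bound _ zero_le_one fun x => ?_
  rw [one_mul]
  have h3 : ‖D x‖ ^ 2 ≤ ‖D x‖ * ‖x‖ := by
    have h4 := inner_self_eq_norm_sq_to_K (𝕜 := ℂ) (D x)
    rw [hinner] at h4
    have h5 : ‖D x‖ ^ 2 = ‖inner ℂ (R (D x)) (R x)‖ := by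
      rw [h4]
      simp
    rw [h5]
    exact (norm_inner_le_norm _ _).trans (mul_le_mul (hR1 _) (hR1 _) (norm_nonneg _) (norm_nonneg _))
  rcases (norm_nonneg (D x)).eq_or_lt with h | h
  · rw [← h]
    exact norm_nonneg x
  · exact le_of_mul_le_mul_left (by rwa [sq] at h3) h

/-- A density operator is a mixture of pure states: there are vectors `v l` with
`∑ ‖v l‖² = 1` such that `trace (C* D B) = ∑ ⟨v l, B C* v l⟩`, the left side being computed,
with absolute convergence, in an arbitrary basis. -/
lemma IsDensityOperator.exists_mixture {D : H →L[ℂ] H} (hD : IsDensityOperator D) :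
    ∃ v : basisIndex H → H, HasSum (fun l => ‖v l‖ ^ 2) 1 ∧
      ∀ {κ : Type} (b : HilbertBasis κ ℂ H) (B C : H →L[ℂ] H),
        HasSum (fun k => inner ℂ (C (b k)) (D (B (b k))))
          (∑' l, inner ℂ (v l) (B (C.adjoint (v l)))) ∧
        Summable (fun k => ‖inner ℂ (C (b k)) (D (B (b k)))‖) ∧
        ∑' k, ‖inner ℂ (C (b k)) (D (B (b k)))‖ ≤ ‖B‖ ^ 2 + ‖C‖ ^ 2 := by
  obtain ⟨R, hRsa, hinner, hR⟩ := hD.exists_sqrt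
  refine ⟨fun l => R.adjoint (basis H l), hasSum_norm_adjoint_sq _ _ hR, fun b B C => ?_⟩
  simp_rw [hinner]
  refine ⟨hasSum_inner_hilbertSchmidt (basis H) b hR B C, ?_⟩
  obtain ⟨hB, hB'⟩ := summable_norm_comp_sq (basis H) b hR B
  obtain ⟨hC, hC'⟩ := summable_norm_comp_sq (basis H) b hR C
  have hle : ∀ k, ‖inner ℂ (R (C (b k))) (R (B (b k)))‖ ≤
      ‖R (B (b k))‖ ^ 2 + ‖R (C (b k))‖ ^ 2 := fun k => by
    refine (norm_inner_le_norm _ _).trans ?_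
    nlinarith [sq_nonneg (‖R (B (b k))‖ - ‖R (C (b k))‖), sq_nonneg (‖R (B (b k))‖),
      sq_nonneg (‖R (C (b k))‖)]
  have hs := Summable.of_nonneg_of_le (fun _ => norm_nonneg _) hle (hB.add hC)
  refine ⟨hs, (hs.tsum_le_tsum hle (hB.add hC)).trans ?_⟩
  rw [hB.tsum_add hC]
  linarith

/-- A choice of the vectors in a decomposition of a density operator into pure states
(and `0` for all other operators). -/
def mixture (D : H →L[ℂ] H) : basisIndex H → H :=
  open Classical in if hD : IsDensityOperator D then hD.exists_mixture.choose else 0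

variable {D : H →L[ℂ] H}

lemma hasSum_mixture (hD : IsDensityOperator D) : HasSum (fun l => ‖mixture D l‖ ^ 2) 1 := by
  rw [mixture, dif_pos hD]
  exact hD.exists_mixture.choose_spec.1

/-- The expectation `trace (D B)` of a bounded operator `B` in the state `D`. -/
def expect (D B : H →L[ℂ] H) : ℂ :=
  ∑' l, inner ℂ (mixture D l) (B (mixture D l))

lemma hasSum_expect (hD : IsDensityOperator D) {κ : Type} (b : HilbertBasis κ ℂ H)
    (B C : H →L[ℂ] H) :
    HasSum (fun k => inner ℂ (C (b k)) (D (B (b k)))) (expect D (B ∘L C.adjoint)) := by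
  simp only [expect, mixture, dif_pos hD, ContinuousLinearMap.comp_apply]
  exact (hD.exists_mixture.choose_spec.2 b B C).1

lemma summable_norm_expect (hD : IsDensityOperator D) {κ : Type} (b : HilbertBasis κ ℂ H)
    (B C : H →L[ℂ] H) :
    Summable (fun k => ‖inner ℂ (C (b k)) (D (B (b k)))‖) :=
  (hD.exists_mixture.choose_spec.2 b B C).2.1

lemma tsum_norm_expect_le (hD : IsDensityOperator D) {κ : Type} (b : HilbertBasis κ ℂ H)
    (B C : H →L[ℂ] H) :
    ∑' k, ‖inner ℂ (C (b k)) (D (B (b k)))‖ ≤ ‖B‖ ^ 2 + ‖C‖ ^ 2 :=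
  (hD.exists_mixture.choose_spec.2 b B C).2.2

lemma trace_comp_eq_expect (hD : IsDensityOperator D) (B : H →L[ℂ] H) :
    trace (fun u => D (B u)) = expect D B := by
  have := (hasSum_expect hD (basis H) B (ContinuousLinearMap.id ℂ H)).tsum_eq
  rwa [ContinuousLinearMap.adjoint_id, ContinuousLinearMap.comp_id] at this

lemma trace_comp_eq_expect' (hD : IsDensityOperator D) (B : H →L[ℂ] H) :
    trace (fun u => B (D u)) = expect D B := by
  have := (hasSum_expect hD (basis H) (ContinuousLinearMap.id ℂ H) B.adjoint).tsum_eq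
  rw [ContinuousLinearMap.adjoint_adjoint, ContinuousLinearMap.id_comp] at this
  rw [← this, trace]
  simp [ContinuousLinearMap.adjoint_inner_left]

lemma norm_inner_mixture_le (B : H →L[ℂ] H) (l : basisIndex H) :
    ‖inner ℂ (mixture D l) (B (mixture D l))‖ ≤ ‖B‖ * ‖mixture D l‖ ^ 2 := by
  refine (norm_inner_le_norm _ _).trans ?_
  nlinarith [B.le_opNorm (mixture D l), norm_nonneg (mixture D l)]

lemma summable_inner_mixture (hD : IsDensityOperator D) (B : H →L[ℂ] H) :
    Summable (fun l => inner ℂ (mixture D l) (B (mixture D l))) :=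
  Summable.of_norm_bounded ((hasSum_mixture hD).summable.mul_left _) (norm_inner_mixture_le B)

lemma norm_expect_le (hD : IsDensityOperator D) (B : H →L[ℂ] H) : ‖expect D B‖ ≤ ‖B‖ := by
  have := tsum_of_norm_bounded ((hasSum_mixture hD).mul_left ‖B‖) (norm_inner_mixture_le B)
  rwa [mul_one] at this

lemma expect_sub (hD : IsDensityOperator D) (A B : H →L[ℂ] H) :
    expect D (A - B) = expect D A - expect D B := by
  rw [expect, expect, expect, ← (summable_inner_mixture hD A).tsum_sub (summable_inner_mixture hD B)]
  simp

lemma expect_add (hD : IsDensityOperator D) (A B : H →L[ℂ] H) :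
    expect D (A + B) = expect D A + expect D B := by
  rw [expect, expect, expect, ← (summable_inner_mixture hD A).tsum_add (summable_inner_mixture hD B)]
  simp

lemma expect_smul (c : ℂ) (B : H →L[ℂ] H) :
    expect D (c • B) = c * expect D B := by
  rw [expect, expect, ← tsum_mul_left]
  simp

lemma expect_sum (hD : IsDensityOperator D) {ι : Type*} (s : Finset ι) (B : ι → H →L[ℂ] H) :
    expect D (∑ i ∈ s, B i) = ∑ i ∈ s, expect D (B i) := by
  classical
  induction s using Finset.induction_on with
  | empty => simp [expect]
  | insert i s hi ih => rw [Finset.sum_insert hi, Finset.sum_insert hi, expect_add hD, ih]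

lemma expect_id (hD : IsDensityOperator D) : expect D (ContinuousLinearMap.id ℂ H) = 1 := by
  have := Complex.hasSum_ofReal.2 (hasSum_mixture hD)
  rw [expect, ← Complex.ofReal_one, ← this.tsum_eq]
  refine tsum_congr fun l => ?_
  simp [inner_self_eq_norm_sq_to_K]

/-- Expectations commute with weak integrals of operators. -/
lemma expect_integral (hD : IsDensityOperator D) [Countable (basisIndex H)]
    {X : Type*} [MeasurableSpace X] {μ : Measure X} {B : X → H →L[ℂ] H} {A : H →L[ℂ] H}
    {g : X → ℝ} (hg : Integrable g μ) (hB : ∀ x, ‖B x‖ ≤ g x)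
    (hmeas : ∀ u, AEStronglyMeasurable (fun x => inner ℂ u (B x u)) μ)
    (hA : ∀ u, inner ℂ u (A u) = ∫ x, inner ℂ u (B x u) ∂μ) :
    expect D A = ∫ x, expect D (B x) ∂μ := by
  have hs := (hasSum_mixture hD).summable
  have h := hasSum_integral_of_summable_integral_norm (μ := μ)
    (F := fun l x => inner ℂ (mixture D l) (B x (mixture D l))) ?_ ?_
  · rw [expect, show (fun l => inner ℂ (mixture D l) (A (mixture D l))) =
      fun l => ∫ x, inner ℂ (mixture D l) (B x (mixture D l)) ∂μ from funext fun l => hA _,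
      h.tsum_eq]
    rfl
  · intro l
    refine Integrable.mono' (hg.mul_const (‖mixture D l‖ ^ 2)) (hmeas _) (ae_of_all _ fun x => ?_)
    refine (norm_inner_mixture_le _ _).trans ?_
    gcongr
    exact hB x
  · refine Summable.of_nonneg_of_le (fun l => integral_nonneg fun _ => norm_nonneg _) (fun l => ?_)
      (hs.mul_left (∫ x, g x ∂μ))
    rw [← integral_mul_const]
    refine integral_mono_of_nonneg (ae_of_all _ fun _ => norm_nonneg _)
      (hg.mul_const _) (ae_of_all _ fun x => ?_)
    exact (norm_inner_mixture_le _ _).trans (mul_le_mul_of_nonneg_right (hB x) (sq_nonneg _))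

end Trace

/-! ### Multiplication operators and Weyl operators on `L²` -/

section Operators

set_option linter.unusedSectionVars false

variable {ι : Type} [Fintype ι]

lemma toL2_of_memLp {f : EuclideanSpace ℝ ι → ℂ} (hf : MemLp f 2 volume) :
    toL2 f = hf.toLp f := dif_pos hf

lemma coeFn_toL2 {f : EuclideanSpace ℝ ι → ℂ} (hf : MemLp f 2 volume) : toL2 f =ᵐ[volume] f := by
  rw [toL2_of_memLp hf]
  exact hf.coeFn_toLp

lemma toL2_congr {f g : EuclideanSpace ℝ ι → ℂ} (h : f =ᵐ[volume] g) : toL2 f = toL2 g := by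
  by_cases hf : MemLp f 2 volume
  · have hg : MemLp g 2 volume := (memLp_congr_ae h).1 hf
    rw [toL2_of_memLp hf, toL2_of_memLp hg]
    exact (MemLp.toLp_eq_toLp_iff hf hg).2 h
  · have hg : ¬ MemLp g 2 volume := fun hg => hf ((memLp_congr_ae h).2 hg)
    rw [toL2, toL2, dif_neg hf, dif_neg hg]

lemma toL2_coeFn (u : L2 ι) : toL2 (u : EuclideanSpace ℝ ι → ℂ) = u := by
  rw [toL2_of_memLp (Lp.memLp u)]
  exact Lp.toLp_coeFn u _

lemma toL2_add {f g : EuclideanSpace ℝ ι → ℂ} (hf : MemLp f 2 volume) (hg : MemLp g 2 volume) :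
    toL2 (fun x => f x + g x) = toL2 f + toL2 g := by
  rw [toL2_of_memLp hf, toL2_of_memLp hg, ← MemLp.toLp_add]
  exact toL2_of_memLp (hf.add hg)

lemma toL2_smul {f : EuclideanSpace ℝ ι → ℂ} (hf : MemLp f 2 volume) (c : ℂ) :
    toL2 (fun x => c * f x) = c • toL2 f := by
  rw [toL2_of_memLp hf, ← MemLp.toLp_const_smul]
  exact toL2_of_memLp (hf.const_smul c)

lemma inner_L2 (u w : L2 ι) : inner ℂ u w = ∫ x, starRingEnd ℂ (u x) * w x := by
  rw [L2.inner_def]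
  exact integral_congr_ae (ae_of_all _ fun x => by simp [RCLike.inner_apply, mul_comm])

/-- Bounded measurable functions, the symbols of multiplication operators. -/
def IsBoundedSymbol (a : EuclideanSpace ℝ ι → ℂ) : Prop :=
  Measurable a ∧ ∃ M : ℝ, ∀ x, ‖a x‖ ≤ M

variable {a b : EuclideanSpace ℝ ι → ℂ}

lemma IsBoundedSymbol.memLp_mul (ha : IsBoundedSymbol a) {u : EuclideanSpace ℝ ι → ℂ}
    (hu : MemLp u 2 volume) : MemLp (fun x => a x * u x) 2 volume := by
  obtain ⟨hm, M, hM⟩ := ha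
  refine MemLp.of_le_mul (c := M) hu (hm.aestronglyMeasurable.mul hu.1) (ae_of_all _ fun x => ?_)
  rw [norm_mul]
  gcongr
  exact hM x

lemma norm_toL2_mul_le {M : ℝ} (ha : Measurable a) (hM : ∀ x, ‖a x‖ ≤ M) (u : L2 ι) :
    ‖toL2 (fun x => a x * u x)‖ ≤ M * ‖u‖ := by
  have hmem := IsBoundedSymbol.memLp_mul ⟨ha, M, hM⟩ (Lp.memLp u)
  refine Lp.norm_le_mul_norm_of_ae_le_mul ?_
  filter_upwards [coeFn_toL2 hmem] with x hx
  rw [hx, norm_mul]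
  gcongr
  exact hM x

/-- Multiplication by the bounded measurable function `a`, as an operator on `L²`
(and `0` if `a` is not bounded and measurable). -/
def mulOp (a : EuclideanSpace ℝ ι → ℂ) : L2 ι →L[ℂ] L2 ι :=
  open Classical in
  if h : IsBoundedSymbol a then
    LinearMap.mkContinuousOfExistsBound
      { toFun := fun u => toL2 fun x => a x * u x
        map_add' := fun u w => by
          rw [← toL2_add (h.memLp_mul (Lp.memLp u)) (h.memLp_mul (Lp.memLp w))]
          refine toL2_congr ?_
          filter_upwards [Lp.coeFn_add u w] with x hx
          rw [hx, Pi.add_apply, mul_add]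
        map_smul' := fun c u => by
          rw [RingHom.id_apply, ← toL2_smul (h.memLp_mul (Lp.memLp u))]
          refine toL2_congr ?_
          filter_upwards [Lp.coeFn_smul c u] with x hx
          rw [hx, Pi.smul_apply, smul_eq_mul, mul_left_comm] }
      ⟨h.2.choose, norm_toL2_mul_le h.1 h.2.choose_spec⟩
  else 0

lemma mulOp_apply (ha : IsBoundedSymbol a) (u : L2 ι) :
    mulOp a u = toL2 fun x => a x * u x := by
  rw [mulOp, dif_pos ha]
  rfl

lemma coeFn_mulOp (ha : IsBoundedSymbol a) (u : L2 ι) :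
    mulOp a u =ᵐ[volume] fun x => a x * u x := by
  rw [mulOp_apply ha]
  exact coeFn_toL2 (ha.memLp_mul (Lp.memLp u))

lemma norm_mulOp_apply_le (ha : Measurable a) {M : ℝ} (hM : ∀ x, ‖a x‖ ≤ M) (u : L2 ι) :
    ‖mulOp a u‖ ≤ M * ‖u‖ := by
  rw [mulOp_apply ⟨ha, M, hM⟩]
  exact norm_toL2_mul_le ha hM u

lemma norm_mulOp_le (ha : Measurable a) {M : ℝ} (hM0 : 0 ≤ M) (hM : ∀ x, ‖a x‖ ≤ M) :
    ‖mulOp a‖ ≤ M :=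
  ContinuousLinearMap.opNorm_le_bound _ hM0 (norm_mulOp_apply_le ha hM)

lemma IsBoundedSymbol.mul (ha : IsBoundedSymbol a) (hb : IsBoundedSymbol b) :
    IsBoundedSymbol (fun x => a x * b x) := by
  obtain ⟨ha, M, hM⟩ := ha
  obtain ⟨hb, M', hM'⟩ := hb
  refine ⟨ha.mul hb, M * M', fun x => ?_⟩
  rw [norm_mul]
  exact mul_le_mul (hM x) (hM' x) (norm_nonneg _) ((norm_nonneg _).trans (hM x))

lemma IsBoundedSymbol.sub (ha : IsBoundedSymbol a) (hb : IsBoundedSymbol b) :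
    IsBoundedSymbol (fun x => a x - b x) := by
  obtain ⟨ha, M, hM⟩ := ha
  obtain ⟨hb, M', hM'⟩ := hb
  exact ⟨ha.sub hb, M + M', fun x => (norm_sub_le _ _).trans (add_le_add (hM x) (hM' x))⟩

lemma IsBoundedSymbol.comp_sub (ha : IsBoundedSymbol a) (v : EuclideanSpace ℝ ι) :
    IsBoundedSymbol (fun x => a (x - v)) := by
  obtain ⟨ha, M, hM⟩ := ha
  exact ⟨ha.comp (measurable_id.sub_const v), M, fun x => hM _⟩

lemma mulOp_mulOp (ha : IsBoundedSymbol a) (hb : IsBoundedSymbol b) (u : L2 ι) :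
    mulOp a (mulOp b u) = mulOp (fun x => a x * b x) u := by
  rw [mulOp_apply ha, mulOp_apply (ha.mul hb)]
  refine toL2_congr ?_
  filter_upwards [coeFn_mulOp hb u] with x hx
  rw [hx, mul_assoc]

lemma mulOp_sub (ha : IsBoundedSymbol a) (hb : IsBoundedSymbol b) :
    mulOp (fun x => a x - b x) = mulOp a - mulOp b := by
  ext1 u
  apply Lp.ext
  filter_upwards [coeFn_mulOp (ha.sub hb) u, Lp.coeFn_sub (mulOp a u) (mulOp b u),
    coeFn_mulOp ha u, coeFn_mulOp hb u] with x h1 h2 h3 h4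
  rw [h1, sub_apply, h2, Pi.sub_apply, h3, h4, sub_mul]

lemma inner_mulOp_left (ha : IsBoundedSymbol a) (u w : L2 ι) :
    inner ℂ (mulOp a u) w = ∫ x, starRingEnd ℂ (a x * u x) * w x := by
  rw [inner_L2]
  refine integral_congr_ae ?_
  filter_upwards [coeFn_mulOp ha u] with x hx
  rw [hx]

lemma inner_mulOp_right (ha : IsBoundedSymbol a) (u w : L2 ι) :
    inner ℂ u (mulOp a w) = ∫ x, starRingEnd ℂ (u x) * (a x * w x) := by
  rw [inner_L2]
  refine integral_congr_ae ?_
  filter_upwards [coeFn_mulOp ha w] with x hx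
  rw [hx]

/-- Real potentials act as self-adjoint operators. -/
lemma adjoint_mulOp_ofReal {V : EuclideanSpace ℝ ι → ℝ} (hV : IsBoundedSymbol fun x => (V x : ℂ)) :
    (mulOp fun x => (V x : ℂ)).adjoint = mulOp fun x => (V x : ℂ) := by
  symm
  rw [ContinuousLinearMap.eq_adjoint_iff]
  intro u w
  rw [inner_mulOp_left hV, inner_mulOp_right hV]
  congr 1 with x
  simp only [map_mul, Complex.conj_ofReal]
  ring

/-- Translation by `v`. -/
def shiftOp (v : EuclideanSpace ℝ ι) : L2 ι →L[ℂ] L2 ι :=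
  (Lp.compMeasurePreservingₗᵢ ℂ (fun y => y - v)
    (measurePreserving_sub_right volume v)).toContinuousLinearMap

lemma coeFn_shiftOp (v : EuclideanSpace ℝ ι) (u : L2 ι) :
    shiftOp v u =ᵐ[volume] fun y => u (y - v) :=
  Lp.coeFn_compMeasurePreserving u (measurePreserving_sub_right volume v)

lemma norm_shiftOp_apply (v : EuclideanSpace ℝ ι) (u : L2 ι) : ‖shiftOp v u‖ = ‖u‖ :=
  (Lp.compMeasurePreservingₗᵢ ℂ (fun y => y - v) (measurePreserving_sub_right volume v)).norm_map u

/-- The plane wave `y ↦ e^{i θ·(y - v)}`. -/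
def planeWave (θ v : EuclideanSpace ℝ ι) (y : EuclideanSpace ℝ ι) : ℂ :=
  Complex.exp (Complex.I * (inner ℝ θ (y - v) : ℝ))

lemma continuous_planeWave (θ v : EuclideanSpace ℝ ι) : Continuous (planeWave θ v) := by
  unfold planeWave
  fun_prop

lemma norm_planeWave (θ v y : EuclideanSpace ℝ ι) : ‖planeWave θ v y‖ = 1 := by
  rw [planeWave, mul_comm, Complex.norm_exp_ofReal_mul_I]

lemma isBoundedSymbol_planeWave (θ v : EuclideanSpace ℝ ι) : IsBoundedSymbol (planeWave θ v) :=
  ⟨(continuous_planeWave θ v).measurable, 1, fun y => (norm_planeWave θ v y).le⟩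

/-- The Weyl operator `e^{i(ξ·x - η·p)}` as a bounded operator. -/
def weylOp (hbar : ℝ) (ξ η : EuclideanSpace ℝ ι) : L2 ι →L[ℂ] L2 ι :=
  mulOp (planeWave ξ ((hbar / 2) • η)) ∘L shiftOp (hbar • η)

variable {hbar : ℝ}

lemma coeFn_weylOp (ξ η : EuclideanSpace ℝ ι) (u : L2 ι) :
    weylOp hbar ξ η u =ᵐ[volume] fun y => planeWave ξ ((hbar / 2) • η) y * u (y - hbar • η) := by
  filter_upwards [coeFn_mulOp (isBoundedSymbol_planeWave ξ ((hbar / 2) • η)) (shiftOp (hbar • η) u),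
    coeFn_shiftOp (hbar • η) u] with y h1 h2
  rw [weylOp, ContinuousLinearMap.comp_apply, h1, h2]

lemma weyl_eq_weylOp (ξ η : EuclideanSpace ℝ ι) (u : L2 ι) :
    weyl hbar ξ η u = weylOp hbar ξ η u := by
  rw [← toL2_coeFn (weylOp hbar ξ η u)]
  exact toL2_congr (coeFn_weylOp ξ η u).symm

lemma norm_weylOp_le (ξ η : EuclideanSpace ℝ ι) : ‖weylOp hbar ξ η‖ ≤ 1 := by
  refine ContinuousLinearMap.opNorm_le_bound _ zero_le_one fun u => ?_
  rw [weylOp, ContinuousLinearMap.comp_apply, ← norm_shiftOp_apply (hbar • η) u]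
  exact norm_mulOp_apply_le (continuous_planeWave _ _).measurable
    (fun y => (norm_planeWave _ _ y).le) _

lemma weylOp_zero : weylOp hbar (0 : EuclideanSpace ℝ ι) 0 = ContinuousLinearMap.id ℂ _ := by
  ext1 u
  apply Lp.ext
  filter_upwards [coeFn_weylOp (hbar := hbar) 0 0 u] with y hy
  rw [hy]
  simp [planeWave]

/-- Multiplying a Weyl operator by a plane wave centred at the midpoint shifts its frequency. -/
lemma mulOp_planeWave_comp_weylOp (h ξ η : EuclideanSpace ℝ ι) :
    mulOp (planeWave h ((hbar / 2) • η)) ∘L weylOp hbar ξ η = weylOp hbar (ξ + h) η := by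
  ext1 u
  apply Lp.ext
  filter_upwards [coeFn_mulOp (isBoundedSymbol_planeWave h ((hbar / 2) • η)) (weylOp hbar ξ η u),
    coeFn_weylOp (hbar := hbar) ξ η u, coeFn_weylOp (hbar := hbar) (ξ + h) η u] with y h1 h2 h3
  rw [ContinuousLinearMap.comp_apply, h1, h2, h3, ← mul_assoc]
  congr 1
  simp only [planeWave]
  rw [← Complex.exp_add, inner_add_left]
  push_cast
  congr 1
  ring

/-- The commutator of a Weyl operator with a potential. -/
lemma weylOp_commutator {V : EuclideanSpace ℝ ι → ℂ} (hV : IsBoundedSymbol V)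
    (ξ η : EuclideanSpace ℝ ι) :
    weylOp hbar ξ η ∘L mulOp V - mulOp V ∘L weylOp hbar ξ η =
      mulOp (fun y => V (y - hbar • η) - V y) ∘L weylOp hbar ξ η := by
  rw [mulOp_sub (hV.comp_sub _) hV, ContinuousLinearMap.sub_comp]
  congr 1
  ext1 u
  apply Lp.ext
  have h0 := (measurePreserving_sub_right (volume : Measure (EuclideanSpace ℝ ι))
    (hbar • η)).quasiMeasurePreserving.ae_eq_comp (coeFn_mulOp hV u)
  filter_upwards [coeFn_weylOp (hbar := hbar) ξ η (mulOp V u), coeFn_weylOp (hbar := hbar) ξ η u, h0,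
    coeFn_mulOp (hV.comp_sub (hbar • η)) (weylOp hbar ξ η u)] with y h1 h2 h3 h4
  simp only [Function.comp_apply] at h3
  rw [ContinuousLinearMap.comp_apply, ContinuousLinearMap.comp_apply, h1, h4, h2, h3]
  ring

lemma norm_conj_mul_self_integrable (u w : L2 ι) :
    Integrable (fun y => ‖u y‖ * ‖w y‖) :=
  MemLp.integrable_mul (p := 2) (q := 2) (Lp.memLp u).norm (Lp.memLp w).norm

lemma continuous_inner_weylOp (η : EuclideanSpace ℝ ι) (u w : L2 ι) :
    Continuous fun ξ => inner ℂ u (weylOp hbar ξ η w) := by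
  have h : (fun ξ => inner ℂ u (weylOp hbar ξ η w)) = fun ξ => ∫ y, starRingEnd ℂ (u y) *
      (planeWave ξ ((hbar / 2) • η) y * (shiftOp (hbar • η) w) y) := funext fun ξ => by
    rw [weylOp, ContinuousLinearMap.comp_apply, inner_mulOp_right (isBoundedSymbol_planeWave _ _)]
  rw [h]
  refine continuous_of_dominated (bound := fun y => ‖u y‖ * ‖(shiftOp (hbar • η) w) y‖)
    (fun ξ => ?_) (fun ξ => ae_of_all _ fun y => ?_) (norm_conj_mul_self_integrable _ _)
    (ae_of_all _ fun y => ?_)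
  · exact (Complex.continuous_conj.comp_aestronglyMeasurable (Lp.aestronglyMeasurable u)).mul
      ((continuous_planeWave _ _).aestronglyMeasurable.mul (Lp.aestronglyMeasurable _))
  · rw [norm_mul, norm_mul, norm_planeWave, one_mul, RCLike.norm_conj]
  · unfold planeWave
    fun_prop

/-- A potential which is a superposition of plane waves acts, composed with an operator, as the
weak integral of plane waves. -/
lemma inner_mulOp_integral {X : Type*} [MeasurableSpace X] {μ : Measure X} [SFinite μ]
    {c : X → ℂ} (hc : Integrable c μ) {p : X → EuclideanSpace ℝ ι → ℂ}
    (hp : Measurable (Function.uncurry p)) (hp1 : ∀ x y, ‖p x y‖ ≤ 1)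
    (ha : IsBoundedSymbol a) (hap : ∀ y, a y = ∫ x, c x * p x y ∂μ) (u w : L2 ι) :
    inner ℂ u (mulOp a w) = ∫ x, c x * inner ℂ u (mulOp (p x) w) ∂μ := by
  have hpx : ∀ x, IsBoundedSymbol (p x) := fun x =>
    ⟨hp.comp measurable_prodMk_left, 1, hp1 x⟩
  rw [inner_mulOp_right ha]
  simp_rw [fun x => inner_mulOp_right (hpx x) u w, hap, ← integral_const_mul, ← integral_mul_const,
    ← integral_const_mul]
  rw [integral_integral_swap]
  · refine integral_congr_ae (ae_of_all _ fun x => integral_congr_ae (ae_of_all _ fun y => ?_))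
    simp only
    ring
  · have h1 : Integrable (fun q : EuclideanSpace ℝ ι × X => (‖u q.1‖ * ‖w q.1‖) * ‖c q.2‖)
      (volume.prod μ) := (norm_conj_mul_self_integrable u w).mul_prod hc.norm
    refine h1.mono' ?_ (ae_of_all _ fun q => ?_)
    · have hu := (Lp.aestronglyMeasurable u).comp_fst (ν := μ)
      have hw := (Lp.aestronglyMeasurable w).comp_fst (ν := μ)
      have hcm := hc.1.comp_snd (μ := (volume : Measure (EuclideanSpace ℝ ι)))
      have hpm : AEStronglyMeasurable (fun q : EuclideanSpace ℝ ι × X => p q.2 q.1)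
          (volume.prod μ) := (hp.comp measurable_swap).aestronglyMeasurable
      exact (Complex.continuous_conj.comp_aestronglyMeasurable hu).mul ((hcm.mul hpm).mul hw)
    · simp only [Function.uncurry, norm_mul, RCLike.norm_conj]
      have := hp1 q.2 q.1
      calc ‖u q.1‖ * (‖c q.2‖ * ‖p q.2 q.1‖ * ‖w q.1‖)
          ≤ ‖u q.1‖ * (‖c q.2‖ * 1 * ‖w q.1‖) := by gcongr
        _ = _ := by ring

end Operators

/-! ### The free propagator -/

section Free

set_option linter.unusedSectionVars false

open scoped FourierTransform

lemma hasTemperateGrowth_cexp_ofReal_mul (c : ℂ) (hc : c.re = 0) :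
    Function.HasTemperateGrowth fun x : ℝ => Complex.exp (c * x) := by
  have hs : ContDiff ℝ (⊤ : ℕ∞) fun x : ℝ => Complex.exp (c * x) := by
    have := Complex.ofRealCLM.contDiff (n := (⊤ : ℕ∞))
    exact Complex.contDiff_exp.comp (contDiff_const.mul this)
  have hd : ∀ n : ℕ, iteratedDeriv n (fun x : ℝ => Complex.exp (c * x)) =
      fun x : ℝ => c ^ n * Complex.exp (c * x) := fun n => by
    induction n with
    | zero => simp
    | succ n ih =>
      rw [iteratedDeriv_succ, ih]
      ext x
      have h1 : HasDerivAt (fun x : ℝ => Complex.exp (c * x)) (Complex.exp (c * x) * (c * 1)) x :=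
        ((Complex.ofRealCLM.hasDerivAt (x := x)).const_mul c).cexp
      rw [(h1.const_mul (c ^ n)).deriv]
      ring
  refine ⟨hs, fun n => ⟨0, ‖c‖ ^ n, fun x => ?_⟩⟩
  rw [norm_iteratedFDeriv_eq_norm_iteratedDeriv, hd, norm_mul, norm_pow, Complex.norm_exp]
  simp [hc]

variable {ι : Type} [Fintype ι]

lemma hasTemperateGrowth_planeWave (θ v : EuclideanSpace ℝ ι) :
    Function.HasTemperateGrowth (planeWave θ v) := by
  have h1 : Function.HasTemperateGrowth fun y : EuclideanSpace ℝ ι => inner ℝ θ (y - v) := by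
    fun_prop
  exact (hasTemperateGrowth_cexp_ofReal_mul Complex.I (by simp)).comp h1

lemma toL2_schwartz (φ : 𝓢(EuclideanSpace ℝ ι, ℂ)) :
    toL2 (φ : EuclideanSpace ℝ ι → ℂ) = φ.toLp 2 volume :=
  toL2_of_memLp (φ.memLp 2)

/-- The symbol `e^{-2π²iħs|k|²}` of the free propagator `e^{isħΔ/2}`. -/
def freeSymbol (hbar s : ℝ) (k : EuclideanSpace ℝ ι) : ℂ :=
  Complex.exp (Complex.I * ((-(2 * Real.pi ^ 2 * hbar * s) * ‖k‖ ^ 2 : ℝ) : ℂ))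

variable (hbar : ℝ)

lemma continuous_freeSymbol (s : ℝ) :
    Continuous (freeSymbol hbar s : EuclideanSpace ℝ ι → ℂ) := by
  unfold freeSymbol
  fun_prop

lemma norm_freeSymbol (s : ℝ) (k : EuclideanSpace ℝ ι) : ‖freeSymbol hbar s k‖ = 1 := by
  rw [freeSymbol, mul_comm, Complex.norm_exp_ofReal_mul_I]

lemma isBoundedSymbol_freeSymbol (s : ℝ) :
    IsBoundedSymbol (freeSymbol hbar s : EuclideanSpace ℝ ι → ℂ) :=
  ⟨(continuous_freeSymbol hbar s).measurable, 1, fun k => (norm_freeSymbol hbar s k).le⟩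

lemma freeSymbol_mul (s r : ℝ) (k : EuclideanSpace ℝ ι) :
    freeSymbol hbar s k * freeSymbol hbar r k = freeSymbol hbar (s + r) k := by
  rw [freeSymbol, freeSymbol, freeSymbol, ← Complex.exp_add]
  push_cast
  congr 1
  ring

lemma hasTemperateGrowth_freeSymbol (s : ℝ) :
    Function.HasTemperateGrowth (freeSymbol hbar s : EuclideanSpace ℝ ι → ℂ) := by
  have h1 : Function.HasTemperateGrowth fun k : EuclideanSpace ℝ ι =>
      -(2 * Real.pi ^ 2 * hbar * s) * ‖k‖ ^ 2 := by
    fun_prop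
  exact (hasTemperateGrowth_cexp_ofReal_mul Complex.I (by simp)).comp h1

lemma mulOp_freeSymbol_comp (s r : ℝ) (u : L2 ι) :
    mulOp (freeSymbol hbar s) (mulOp (freeSymbol hbar r) u) = mulOp (freeSymbol hbar (s + r)) u := by
  rw [mulOp_mulOp (isBoundedSymbol_freeSymbol hbar s) (isBoundedSymbol_freeSymbol hbar r)]
  simp_rw [freeSymbol_mul]

lemma mulOp_freeSymbol_zero (u : L2 ι) : mulOp (freeSymbol hbar 0) u = u := by
  apply Lp.ext
  filter_upwards [coeFn_mulOp (isBoundedSymbol_freeSymbol hbar 0) u] with k hk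
  rw [hk]
  simp [freeSymbol]

/-- Multiplication by `e^{-2π²iħs|k|²}` as a unitary operator. -/
def freeMul (s : ℝ) : L2 ι ≃ₗᵢ[ℂ] L2 ι where
  toLinearEquiv := LinearEquiv.ofLinearMap (mulOp (freeSymbol hbar s)).toLinearMap
    (mulOp (freeSymbol hbar (-s))).toLinearMap
    (by
      ext1 u
      simp [mulOp_freeSymbol_comp, mulOp_freeSymbol_zero])
    (by
      ext1 u
      simp [mulOp_freeSymbol_comp, mulOp_freeSymbol_zero])
  norm_map' := fun u => by
    have h1 : ∀ r (w : L2 ι), ‖mulOp (freeSymbol hbar r) w‖ ≤ ‖w‖ := fun r w => by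
      simpa using norm_mulOp_apply_le (continuous_freeSymbol hbar r).measurable
        (fun k => (norm_freeSymbol hbar r k).le) w
    refine le_antisymm (h1 s u) ?_
    have h2 := h1 (-s) (mulOp (freeSymbol hbar s) u)
    rwa [mulOp_freeSymbol_comp, neg_add_cancel, mulOp_freeSymbol_zero] at h2

/-- The Fourier transform on `L²`. -/
abbrev fourierL2 : L2 ι ≃ₗᵢ[ℂ] L2 ι := Lp.fourierTransformₗᵢ (EuclideanSpace ℝ ι) ℂ

/-- The free propagator `e^{isħΔ/2}`. -/
def freeOp (s : ℝ) : L2 ι ≃ₗᵢ[ℂ] L2 ι :=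
  fourierL2.trans ((freeMul hbar s).trans fourierL2.symm)

lemma freeOp_apply (s : ℝ) (u : L2 ι) :
    freeOp hbar s u = fourierL2.symm (mulOp (freeSymbol hbar s) (fourierL2 u)) := rfl

lemma freeOp_zero (u : L2 ι) : freeOp hbar 0 u = u := by
  rw [freeOp_apply, mulOp_freeSymbol_zero, LinearIsometryEquiv.symm_apply_apply]

/-- The free evolution of a Schwartz function. -/
def freeSchwartz (s : ℝ) (φ : 𝓢(EuclideanSpace ℝ ι, ℂ)) : 𝓢(EuclideanSpace ℝ ι, ℂ) :=
  SchwartzMap.fourierMultiplierCLM ℂ (freeSymbol hbar s) φ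

lemma fourierL2_toL2 (φ : 𝓢(EuclideanSpace ℝ ι, ℂ)) :
    fourierL2 (toL2 (φ : EuclideanSpace ℝ ι → ℂ)) =
      toL2 ((𝓕 φ : 𝓢(EuclideanSpace ℝ ι, ℂ)) : EuclideanSpace ℝ ι → ℂ) := by
  rw [toL2_schwartz, toL2_schwartz]
  exact SchwartzMap.toLp_fourier_eq φ

lemma fourierL2_symm_toL2 (φ : 𝓢(EuclideanSpace ℝ ι, ℂ)) :
    fourierL2.symm (toL2 (φ : EuclideanSpace ℝ ι → ℂ)) =
      toL2 ((𝓕⁻ φ : 𝓢(EuclideanSpace ℝ ι, ℂ)) : EuclideanSpace ℝ ι → ℂ) := by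
  rw [toL2_schwartz, toL2_schwartz]
  exact SchwartzMap.toLp_fourierInv_eq φ

lemma mulOp_toL2 {a : EuclideanSpace ℝ ι → ℂ} (ha : IsBoundedSymbol a)
    {f : EuclideanSpace ℝ ι → ℂ} (hf : MemLp f 2 volume) :
    mulOp a (toL2 f) = toL2 fun x => a x * f x := by
  rw [mulOp_apply ha]
  refine toL2_congr ?_
  filter_upwards [coeFn_toL2 hf] with x hx
  rw [hx]

lemma mulOp_toL2_schwartz {a : EuclideanSpace ℝ ι → ℂ} (ha : IsBoundedSymbol a)
    (hg : Function.HasTemperateGrowth a) (φ : 𝓢(EuclideanSpace ℝ ι, ℂ)) :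
    mulOp a (toL2 (φ : EuclideanSpace ℝ ι → ℂ)) =
      toL2 (SchwartzMap.smulLeftCLM ℂ a φ : EuclideanSpace ℝ ι → ℂ) := by
  rw [mulOp_toL2 ha (φ.memLp 2)]
  congr 1 with x
  rw [SchwartzMap.smulLeftCLM_apply_apply hg, smul_eq_mul]

lemma freeOp_toL2 (s : ℝ) (φ : 𝓢(EuclideanSpace ℝ ι, ℂ)) :
    freeOp hbar s (toL2 (φ : EuclideanSpace ℝ ι → ℂ)) =
      toL2 (freeSchwartz hbar s φ : EuclideanSpace ℝ ι → ℂ) := by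
  rw [freeOp_apply, fourierL2_toL2, mulOp_toL2_schwartz (isBoundedSymbol_freeSymbol hbar s)
    (hasTemperateGrowth_freeSymbol hbar s), fourierL2_symm_toL2]
  rfl

/-- Second order Taylor bound for `e^{ix}`, valid for all real `x`. -/
lemma norm_exp_I_sub_le (x : ℝ) :
    ‖Complex.exp (Complex.I * x) - 1 - Complex.I * x‖ ≤ 3 * x ^ 2 := by
  have hn : ‖Complex.I * (x : ℂ)‖ = |x| := by simp
  by_cases hx : |x| ≤ 1
  · have := Complex.norm_exp_sub_one_sub_id_le (x := Complex.I * x) (by rwa [hn])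
    rw [hn, sq_abs] at this
    nlinarith [sq_nonneg x]
  · have h1 := Real.norm_exp_I_mul_ofReal_sub_one_le (x := x)
    have h2 := norm_sub_le (Complex.exp (Complex.I * x) - 1) (Complex.I * x)
    rw [hn] at h2
    rw [Real.norm_eq_abs] at h1
    have h3 : |x| ≤ x ^ 2 := by
      rw [← sq_abs]
      nlinarith
    linarith [sq_nonneg x]

/-- Taylor bound for the free symbol in time. The remainder is quadratic in time and of fourth order
in `k`, which Schwartz functions absorb. -/
lemma freeSymbol_taylor (s r : ℝ) (k : EuclideanSpace ℝ ι) :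
    ‖freeSymbol hbar (s + r) k - freeSymbol hbar s k -
      (r : ℂ) * (freeSymbol hbar s k *
        (-(2 * Real.pi ^ 2 * hbar : ℝ) * Complex.I * ((‖k‖ ^ 2 : ℝ) : ℂ)))‖ ≤
      3 * r ^ 2 * ‖((2 * Real.pi ^ 2 * hbar : ℝ) * ((‖k‖ ^ 2 : ℝ) : ℂ)) ^ 2‖ := by
  rw [← freeSymbol_mul]
  have h := norm_exp_I_sub_le (-(2 * Real.pi ^ 2 * hbar * r) * ‖k‖ ^ 2)
  have h1 : freeSymbol hbar s k * freeSymbol hbar r k - freeSymbol hbar s k -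
      (r : ℂ) * (freeSymbol hbar s k *
        (-(2 * Real.pi ^ 2 * hbar : ℝ) * Complex.I * ((‖k‖ ^ 2 : ℝ) : ℂ))) =
      freeSymbol hbar s k * (Complex.exp (Complex.I *
        ((-(2 * Real.pi ^ 2 * hbar * r) * ‖k‖ ^ 2 : ℝ) : ℂ)) - 1 -
        Complex.I * ((-(2 * Real.pi ^ 2 * hbar * r) * ‖k‖ ^ 2 : ℝ) : ℂ)) := by
    rw [show freeSymbol hbar r k = Complex.exp (Complex.I *
        ((-(2 * Real.pi ^ 2 * hbar * r) * ‖k‖ ^ 2 : ℝ) : ℂ)) from rfl]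
    push_cast
    ring
  rw [h1, norm_mul, norm_freeSymbol, one_mul]
  refine h.trans (le_of_eq ?_)
  rw [norm_pow, norm_mul, Complex.norm_real, Complex.norm_real, Real.norm_eq_abs, Real.norm_eq_abs,
    ← abs_mul, sq_abs]
  ring

lemma hasDerivAt_of_norm_sub_le_sq {H : Type*} [NormedAddCommGroup H] [NormedSpace ℝ H]
    {f : ℝ → H} {f' : H} {s K : ℝ} (h : ∀ r, ‖f (s + r) - f s - r • f'‖ ≤ K * r ^ 2) :
    HasDerivAt f f' s := by
  rw [hasDerivAt_iff_isLittleO_nhds_zero]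
  have h1 : (fun r => f (s + r) - f s - r • f') =O[𝓝 0] fun r : ℝ => r ^ 2 :=
    IsBigO.of_bound K (Eventually.of_forall fun r => by
      rw [Real.norm_of_nonneg (sq_nonneg r)]
      exact h r)
  refine h1.trans_isLittleO ?_
  simpa using isLittleO_pow_pow (𝕜 := ℝ) (m := 1) (n := 2) one_lt_two

lemma freeSymbol_deriv_temperate (c : ℂ) :
    Function.HasTemperateGrowth fun k : EuclideanSpace ℝ ι => c * ((‖k‖ ^ 2 : ℝ) : ℂ) := by
  have h1 : Function.HasTemperateGrowth fun k : EuclideanSpace ℝ ι => ‖k‖ ^ 2 := by fun_prop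
  exact (Function.HasTemperateGrowth.const c).mul (Function.HasTemperateGrowth.comp
    Function.Complex.hasTemperateGrowth_ofReal h1)

/-- On Schwartz functions the free symbol is differentiable in time, as a map into `L²`. -/
lemma hasDerivAt_mulOp_freeSymbol (s : ℝ) (g : 𝓢(EuclideanSpace ℝ ι, ℂ)) :
    HasDerivAt (fun r => mulOp (freeSymbol hbar r) (toL2 (g : EuclideanSpace ℝ ι → ℂ)))
      (mulOp (freeSymbol hbar s) (toL2 (SchwartzMap.smulLeftCLM ℂ
        (fun k => -(2 * Real.pi ^ 2 * hbar : ℝ) * Complex.I * ((‖k‖ ^ 2 : ℝ) : ℂ)) g))) s := by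
  set g1 := SchwartzMap.smulLeftCLM ℂ (fun k : EuclideanSpace ℝ ι =>
    -(2 * Real.pi ^ 2 * hbar : ℝ) * Complex.I * ((‖k‖ ^ 2 : ℝ) : ℂ)) g with hg1
  have hT2 := (freeSymbol_deriv_temperate (ι := ι) ((2 * Real.pi ^ 2 * hbar : ℝ) : ℂ)).pow 2
  set g2 := SchwartzMap.smulLeftCLM ℂ ((fun k : EuclideanSpace ℝ ι =>
    ((2 * Real.pi ^ 2 * hbar : ℝ) : ℂ) * ((‖k‖ ^ 2 : ℝ) : ℂ)) ^ 2) g with hg2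
  refine hasDerivAt_of_norm_sub_le_sq (K := 3 * ‖toL2 (g2 : EuclideanSpace ℝ ι → ℂ)‖) fun r => ?_
  rw [show 3 * ‖toL2 (g2 : EuclideanSpace ℝ ι → ℂ)‖ * r ^ 2 =
    3 * r ^ 2 * ‖toL2 (g2 : EuclideanSpace ℝ ι → ℂ)‖ by ring]
  refine Lp.norm_le_mul_norm_of_ae_le_mul ?_
  have hb := fun r : ℝ => isBoundedSymbol_freeSymbol (ι := ι) hbar r
  filter_upwards [Lp.coeFn_sub (mulOp (freeSymbol hbar (s + r)) (toL2 g) -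
      mulOp (freeSymbol hbar s) (toL2 g)) (r • mulOp (freeSymbol hbar s) (toL2 g1)),
    Lp.coeFn_sub (mulOp (freeSymbol hbar (s + r)) (toL2 g)) (mulOp (freeSymbol hbar s) (toL2 g)),
    Lp.coeFn_smul r (mulOp (freeSymbol hbar s) (toL2 g1)),
    coeFn_mulOp (hb (s + r)) (toL2 g), coeFn_mulOp (hb s) (toL2 g), coeFn_mulOp (hb s) (toL2 g1),
    coeFn_toL2 (g.memLp 2), coeFn_toL2 (g1.memLp 2), coeFn_toL2 (g2.memLp 2)]
    with k h1 h2 h3 h4 h5 h6 h7 h8 h9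
  rw [h1, Pi.sub_apply, h2, Pi.sub_apply, h3, Pi.smul_apply, h4, h5, h6, h7, h8, h9, hg1, hg2,
    SchwartzMap.smulLeftCLM_apply_apply (freeSymbol_deriv_temperate _),
    SchwartzMap.smulLeftCLM_apply_apply hT2, Complex.real_smul, smul_eq_mul, smul_eq_mul,
    Pi.pow_apply, norm_mul]
  have := mul_le_mul_of_nonneg_right (freeSymbol_taylor hbar s r k) (norm_nonneg (g k))
  rw [← norm_mul] at this
  refine le_trans (le_of_eq ?_) (this.trans (le_of_eq (by ring)))
  congr 1
  ring

/-- The free evolution of a Schwartz function solves the free Schrödinger equation in `L²`. -/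
lemma hasDerivAt_freeOp (s : ℝ) (φ : 𝓢(EuclideanSpace ℝ ι, ℂ)) :
    HasDerivAt (fun r => freeOp hbar r (toL2 (φ : EuclideanSpace ℝ ι → ℂ)))
      ((Complex.I * hbar / 2) • toL2 ((Δ (freeSchwartz hbar s φ) : 𝓢(EuclideanSpace ℝ ι, ℂ)) :
        EuclideanSpace ℝ ι → ℂ)) s := by
  have h := (((fourierL2 (ι := ι)).symm.toContinuousLinearEquiv.toContinuousLinearMap).restrictScalars
    ℝ).hasFDerivAt.comp_hasDerivAt s
      (hasDerivAt_mulOp_freeSymbol hbar s (𝓕 φ : 𝓢(EuclideanSpace ℝ ι, ℂ)))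
  have hfun : (fun r => freeOp hbar r (toL2 (φ : EuclideanSpace ℝ ι → ℂ))) =
      fun r => fourierL2.symm (mulOp (freeSymbol hbar r)
        (toL2 ((𝓕 φ : 𝓢(EuclideanSpace ℝ ι, ℂ)) : EuclideanSpace ℝ ι → ℂ))) := by
    ext1 r
    rw [freeOp_apply, fourierL2_toL2]
  rw [hfun]
  have hL : (Δ (freeSchwartz hbar s φ) : 𝓢(EuclideanSpace ℝ ι, ℂ)) = -(2 * Real.pi) ^ 2 •
      SchwartzMap.fourierMultiplierCLM ℂ (fun k : EuclideanSpace ℝ ι => ((‖k‖ ^ 2 : ℝ) : ℂ))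
        (freeSchwartz hbar s φ) := by
    rw [SchwartzMap.laplacian_eq_fourierMultiplierCLM]
    congr 1
    exact (SchwartzMap.fourierMultiplierCLM_ofReal ℂ
      (g := fun k : EuclideanSpace ℝ ι => ‖k‖ ^ 2) (by fun_prop) _).symm
  refine HasDerivAt.congr_deriv h ?_
  change (fourierL2 (ι := ι)).symm (mulOp (freeSymbol hbar s) _) = _
  rw [mulOp_toL2_schwartz (isBoundedSymbol_freeSymbol hbar s) (hasTemperateGrowth_freeSymbol hbar s),
    fourierL2_symm_toL2, ← toL2_smul ((Δ (freeSchwartz hbar s φ) :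
      𝓢(EuclideanSpace ℝ ι, ℂ)).memLp 2 volume), hL]
  congr 1
  have hsq : Function.HasTemperateGrowth fun k : EuclideanSpace ℝ ι => ((‖k‖ ^ 2 : ℝ) : ℂ) := by
    simpa using freeSymbol_deriv_temperate (ι := ι) 1
  rw [SchwartzMap.smulLeftCLM_smulLeftCLM_apply (hasTemperateGrowth_freeSymbol hbar s)
    (freeSymbol_deriv_temperate _), freeSchwartz,
    SchwartzMap.fourierMultiplierCLM_fourierMultiplierCLM_apply hsq
      (hasTemperateGrowth_freeSymbol hbar s)]
  rw [← SchwartzMap.fourierMultiplierCLM_apply]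
  have heq : (freeSymbol hbar s * fun k : EuclideanSpace ℝ ι =>
      -(2 * Real.pi ^ 2 * hbar : ℝ) * Complex.I * ((‖k‖ ^ 2 : ℝ) : ℂ)) =
      (-(2 * Real.pi ^ 2 * hbar : ℝ) * Complex.I : ℂ) •
        ((fun k : EuclideanSpace ℝ ι => ((‖k‖ ^ 2 : ℝ) : ℂ)) * freeSymbol hbar s) := by
    ext k
    simp only [Pi.mul_apply, Pi.smul_apply, smul_eq_mul]
    ring
  rw [heq, SchwartzMap.fourierMultiplierCLM_smul (hsq.mul (hasTemperateGrowth_freeSymbol hbar s))]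
  ext x
  simp only [smul_apply, Complex.real_smul, smul_eq_mul]
  push_cast
  ring

end Free

/-! ### Free transport of Weyl operators -/

section Transport

set_option linter.unusedSectionVars false

open scoped FourierTransform

variable {ι : Type} [Fintype ι] {hbar : ℝ}

/-- The Weyl operator on Schwartz functions. -/
def weylSchwartz (hbar : ℝ) (ξ η : EuclideanSpace ℝ ι) (φ : 𝓢(EuclideanSpace ℝ ι, ℂ)) :
    𝓢(EuclideanSpace ℝ ι, ℂ) :=
  SchwartzMap.smulLeftCLM ℂ (planeWave ξ ((hbar / 2) • η))
    (SchwartzMap.compSubConstCLM ℂ (hbar • η) φ)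

lemma weylSchwartz_apply (ξ η : EuclideanSpace ℝ ι) (φ : 𝓢(EuclideanSpace ℝ ι, ℂ))
    (y : EuclideanSpace ℝ ι) :
    weylSchwartz hbar ξ η φ y = planeWave ξ ((hbar / 2) • η) y * φ (y - hbar • η) := by
  rw [weylSchwartz, SchwartzMap.smulLeftCLM_apply_apply (hasTemperateGrowth_planeWave _ _),
    SchwartzMap.compSubConstCLM_apply, smul_eq_mul]

lemma weylOp_toL2 (ξ η : EuclideanSpace ℝ ι) (φ : 𝓢(EuclideanSpace ℝ ι, ℂ)) :
    weylOp hbar ξ η (toL2 (φ : EuclideanSpace ℝ ι → ℂ)) =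
      toL2 (weylSchwartz hbar ξ η φ : EuclideanSpace ℝ ι → ℂ) := by
  rw [← toL2_coeFn (weylOp hbar ξ η _)]
  refine toL2_congr ?_
  have h0 := (measurePreserving_sub_right (volume : Measure (EuclideanSpace ℝ ι))
    (hbar • η)).quasiMeasurePreserving.ae_eq_comp (coeFn_toL2 (φ.memLp 2 volume))
  filter_upwards [coeFn_weylOp (hbar := hbar) ξ η (toL2 (φ : EuclideanSpace ℝ ι → ℂ)), h0]
    with y h1 h2
  simp only [Function.comp_apply] at h2
  rw [h1, h2, weylSchwartz_apply]

lemma dense_schwartz : DenseRange fun φ : 𝓢(EuclideanSpace ℝ ι, ℂ) =>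
    toL2 (φ : EuclideanSpace ℝ ι → ℂ) := by
  have h := SchwartzMap.denseRange_toLpCLM (E := EuclideanSpace ℝ ι) (F := ℂ) (p := 2)
    (μ := volume) (by simp)
  convert h using 2 with φ
  exact toL2_schwartz φ

/-- The Fourier transform exchanges the translation and the modulation of a Weyl operator; with the
symmetric choice of its phase no further factor appears. The constants `2πħ` come from the
normalization `e^{-2πi x·k}` of the Fourier transform. -/
lemma fourier_weylSchwartz (hb : hbar ≠ 0) (ξ η : EuclideanSpace ℝ ι)
    (φ : 𝓢(EuclideanSpace ℝ ι, ℂ)) :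
    (𝓕 (weylSchwartz hbar ξ η φ) : 𝓢(EuclideanSpace ℝ ι, ℂ)) =
      weylSchwartz hbar (-(2 * Real.pi * hbar) • η) ((1 / (2 * Real.pi * hbar)) • ξ) (𝓕 φ) := by
  ext k
  have hpi := Real.pi_ne_zero
  have e1 : hbar • (1 / (2 * Real.pi * hbar)) • ξ = (1 / (2 * Real.pi)) • ξ := by
    rw [smul_smul]
    congr 1
    field_simp
  have e2 : (hbar / 2) • (1 / (2 * Real.pi * hbar)) • ξ = (1 / (4 * Real.pi)) • ξ := by
    rw [smul_smul]
    congr 1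
    field_simp
    norm_num
  rw [weylSchwartz_apply, e1, e2, SchwartzMap.fourier_coe, SchwartzMap.fourier_coe,
    Real.fourier_eq', Real.fourier_eq', ← integral_const_mul]
  symm
  rw [← integral_sub_right_eq_self _ (hbar • η)]
  refine integral_congr_ae (ae_of_all _ fun y => ?_)
  simp only [weylSchwartz_apply, smul_eq_mul]
  rw [← mul_assoc, ← mul_assoc]
  congr 1
  simp only [planeWave]
  rw [← Complex.exp_add, ← Complex.exp_add]
  congr 1
  simp only [inner_sub_left, inner_sub_right, inner_smul_left, inner_smul_right,
    RCLike.conj_to_real]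
  rw [real_inner_comm ξ y, real_inner_comm ξ η]
  push_cast
  have hpc : (Real.pi : ℂ) ≠ 0 := by exact_mod_cast hpi
  field_simp
  ring

lemma fourierL2_weylOp (hb : hbar ≠ 0) (ξ η : EuclideanSpace ℝ ι) (u : L2 ι) :
    fourierL2 (weylOp hbar ξ η u) = weylOp hbar (-(2 * Real.pi * hbar) • η)
      ((1 / (2 * Real.pi * hbar)) • ξ) (fourierL2 u) := by
  refine DenseRange.induction_on (p := fun u => fourierL2 (weylOp hbar ξ η u) =
    weylOp hbar (-(2 * Real.pi * hbar) • η) ((1 / (2 * Real.pi * hbar)) • ξ) (fourierL2 u))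
    dense_schwartz u ?_ ?_
  · exact isClosed_eq ((fourierL2 (ι := ι)).continuous.comp (weylOp hbar ξ η).continuous)
      ((weylOp hbar _ _).continuous.comp (fourierL2 (ι := ι)).continuous)
  · intro φ
    rw [weylOp_toL2, fourierL2_toL2, fourierL2_toL2, weylOp_toL2, fourier_weylSchwartz hb]

/-- On the Fourier side the free evolution is a quadratic phase, which changes the modulation of a
Weyl operator by a multiple of its translation. -/
lemma mulOp_freeSymbol_weylOp (s : ℝ) (ξ η : EuclideanSpace ℝ ι) (u : L2 ι) :
    mulOp (freeSymbol hbar s) (weylOp hbar ξ η u) =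
      weylOp hbar (ξ - (4 * Real.pi ^ 2 * hbar ^ 2 * s) • η) η (mulOp (freeSymbol hbar s) u) := by
  apply Lp.ext
  have hb := isBoundedSymbol_freeSymbol (ι := ι) hbar s
  have h0 := (measurePreserving_sub_right (volume : Measure (EuclideanSpace ℝ ι))
    (hbar • η)).quasiMeasurePreserving.ae_eq_comp (coeFn_mulOp hb u)
  filter_upwards [coeFn_mulOp hb (weylOp hbar ξ η u), coeFn_weylOp (hbar := hbar) ξ η u, h0,
    coeFn_weylOp (hbar := hbar) (ξ - (4 * Real.pi ^ 2 * hbar ^ 2 * s) • η) η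
      (mulOp (freeSymbol hbar s) u)] with k h1 h2 h3 h4
  simp only [Function.comp_apply] at h3
  rw [h1, h2, h4, h3, ← mul_assoc, ← mul_assoc]
  congr 1
  simp only [planeWave, freeSymbol]
  rw [← Complex.exp_add, ← Complex.exp_add]
  congr 1
  have e : ‖k - hbar • η‖ ^ 2 = ‖k‖ ^ 2 - 2 * (hbar * inner ℝ η k) + hbar ^ 2 * ‖η‖ ^ 2 := by
    rw [norm_sub_sq_real, inner_smul_right, real_inner_comm, norm_smul, mul_pow, Real.norm_eq_abs,
      sq_abs]
  rw [e]
  simp only [inner_sub_left, inner_sub_right, inner_smul_left, inner_smul_right,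
    RCLike.conj_to_real, real_inner_self_eq_norm_sq]
  push_cast
  ring

/-- Free transport: the free propagator moves `η` along `ξ`. -/
lemma freeOp_weylOp (hb : hbar ≠ 0) (s : ℝ) (ξ η : EuclideanSpace ℝ ι) (u : L2 ι) :
    freeOp hbar s (weylOp hbar ξ η u) = weylOp hbar ξ (η + s • ξ) (freeOp hbar s u) := by
  apply (fourierL2 (ι := ι)).injective
  rw [fourierL2_weylOp hb, freeOp_apply, freeOp_apply, LinearIsometryEquiv.apply_symm_apply,
    LinearIsometryEquiv.apply_symm_apply, fourierL2_weylOp hb, mulOp_freeSymbol_weylOp]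
  congr 2
  rw [smul_smul, smul_add, smul_smul, sub_eq_add_neg, ← neg_smul]
  congr 2
  have := Real.pi_ne_zero
  field_simp
  ring

end Transport

/-! ### Duhamel formula for the von Neumann equation -/

section Duhamel

set_option linter.unusedSectionVars false

lemma tendsto_inner_apply {H : Type} [NormedAddCommGroup H] [InnerProductSpace ℂ H]
    {X : Type*} {l : Filter X} {D : X → H →L[ℂ] H} {a b : X → H} {a₀ b₀ : H} {z : ℂ}
    (hD : ∀ x, ‖D x‖ ≤ 1) (ha : Tendsto a l (𝓝 a₀)) (hb : Tendsto b l (𝓝 b₀))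
    (hz : Tendsto (fun x => inner ℂ a₀ (D x b₀)) l (𝓝 z)) :
    Tendsto (fun x => inner ℂ (a x) (D x (b x))) l (𝓝 z) := by
  have h1 : Tendsto (fun x => inner ℂ (a x - a₀) (D x (b x))) l (𝓝 0) := by
    refine squeeze_zero_norm (a := fun x => ‖a x - a₀‖ * ‖b x‖) (fun x => ?_) ?_
    · refine (norm_inner_le_norm _ _).trans ?_
      gcongr
      simpa using (D x).le_of_opNorm_le (hD x) (b x)
    · simpa using (tendsto_iff_norm_sub_tendsto_zero.1 ha).mul hb.norm
  have h2 : Tendsto (fun x => inner ℂ a₀ (D x (b x - b₀))) l (𝓝 0) := by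
    refine squeeze_zero_norm (a := fun x => ‖a₀‖ * ‖b x - b₀‖) (fun x => ?_) ?_
    · refine (norm_inner_le_norm _ _).trans ?_
      gcongr
      simpa using (D x).le_of_opNorm_le (hD x) (b x - b₀)
    · simpa using (tendsto_iff_norm_sub_tendsto_zero.1 hb).const_mul ‖a₀‖
  have h3 := (h1.add h2).add hz
  rw [add_zero, zero_add] at h3
  refine h3.congr fun x => ?_
  rw [inner_sub_left, map_sub, inner_sub_right]
  ring

/-- Product rule for matrix elements of a weakly differentiable family of contractions. -/
lemma hasDerivAt_inner_apply {H : Type} [NormedAddCommGroup H] [InnerProductSpace ℂ H]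
    {D : ℝ → H →L[ℂ] H} {a b : ℝ → H} {a' b' : H} {d : ℂ} {s : ℝ}
    (hD : ∀ r, ‖D r‖ ≤ 1) (ha : HasDerivAt a a' s) (hb : HasDerivAt b b' s)
    (hd : HasDerivAt (fun r => inner ℂ (a s) (D r (b s))) d s)
    (ha' : Tendsto (fun r => inner ℂ a' (D r (b s))) (𝓝 s) (𝓝 (inner ℂ a' (D s (b s)))))
    (hb' : Tendsto (fun r => inner ℂ (a s) (D r b')) (𝓝 s) (𝓝 (inner ℂ (a s) (D s b')))) :
    HasDerivAt (fun r => inner ℂ (a r) (D r (b r)))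
      (inner ℂ a' (D s (b s)) + inner ℂ (a s) (D s b') + d) s := by
  rw [hasDerivAt_iff_tendsto_slope] at ha hb hd ⊢
  have hle : 𝓝[≠] s ≤ 𝓝 s := nhdsWithin_le_nhds
  have hbc : Tendsto b (𝓝[≠] s) (𝓝 (b s)) := by
    have := (hasDerivAt_iff_tendsto_slope.2 hb).continuousAt.tendsto
    exact this.mono_left hle
  have h1 := tendsto_inner_apply hD ha hbc (ha'.mono_left hle)
  have h2 := tendsto_inner_apply hD (tendsto_const_nhds (x := a s)) hb (hb'.mono_left hle)
  refine ((h1.add h2).add hd).congr' ?_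
  filter_upwards with r
  simp only [slope, vsub_eq_sub, RCLike.real_smul_eq_coe_smul (K := ℂ), map_smul, inner_smul_left,
    inner_smul_right, inner_sub_left, inner_sub_right, map_sub, smul_eq_mul]
  simp
  ring

variable {ι : Type} [Fintype ι] {hbar : ℝ}

/-- A family of bounded measurable real potentials with a common bound. -/
structure IsBoundedPotential (V : ℝ → EuclideanSpace ℝ ι → ℝ) (K : ℝ) : Prop where
  nonneg : 0 ≤ K
  measurable : ∀ s, Measurable (V s)
  bound : ∀ s x, |V s x| ≤ K

variable {V : ℝ → EuclideanSpace ℝ ι → ℝ} {K : ℝ}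

/-- Multiplication by a real potential. -/
abbrev potOp (W : EuclideanSpace ℝ ι → ℝ) : L2 ι →L[ℂ] L2 ι := mulOp fun x => (W x : ℂ)

lemma IsBoundedPotential.symbol (hV : IsBoundedPotential V K) (s : ℝ) :
    IsBoundedSymbol fun x => (V s x : ℂ) :=
  ⟨Complex.measurable_ofReal.comp (hV.measurable s), K, fun x => by
    simpa using hV.bound s x⟩

lemma IsBoundedPotential.norm_potOp_le (hV : IsBoundedPotential V K) (s : ℝ) :
    ‖potOp (V s)‖ ≤ K :=
  norm_mulOp_le (hV.symbol s).1 hV.nonneg fun x => by simpa using hV.bound s x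

lemma hamiltonian_eq (hV : IsBoundedPotential V K) (s : ℝ) (φ : 𝓢(EuclideanSpace ℝ ι, ℂ)) :
    hamiltonian hbar (V s) φ = (-((hbar : ℂ) ^ 2 / 2)) •
      toL2 ((Δ φ : 𝓢(EuclideanSpace ℝ ι, ℂ)) : EuclideanSpace ℝ ι → ℂ) +
      potOp (V s) (toL2 (φ : EuclideanSpace ℝ ι → ℂ)) := by
  have h1 : (Δ (φ : EuclideanSpace ℝ ι → ℂ)) =
      ((Δ φ : 𝓢(EuclideanSpace ℝ ι, ℂ)) : EuclideanSpace ℝ ι → ℂ) :=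
    funext fun x => (SchwartzMap.laplacian_apply φ x).symm
  rw [hamiltonian, h1, mulOp_toL2 (hV.symbol s) (φ.memLp 2),
    ← toL2_smul ((Δ φ : 𝓢(EuclideanSpace ℝ ι, ℂ)).memLp 2), ← toL2_add]
  · exact ((Δ φ : 𝓢(EuclideanSpace ℝ ι, ℂ)).memLp 2).const_mul _
  · exact (hV.symbol s).memLp_mul (φ.memLp 2)

variable {D : ℝ → L2 ι →L[ℂ] L2 ι}

/-- The rate of change of the matrix element of `D` between freely evolved vectors. -/
def rate (hbar : ℝ) (V : ℝ → EuclideanSpace ℝ ι → ℝ) (D : ℝ → L2 ι →L[ℂ] L2 ι) (u w : L2 ι)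
    (s : ℝ) : ℂ :=
  (inner ℂ (potOp (V s) (freeOp hbar s u)) (D s (freeOp hbar s w)) -
    inner ℂ (freeOp hbar s u) (D s (potOp (V s) (freeOp hbar s w)))) / (Complex.I * hbar)

/-- In the interaction picture only the potential drives the evolution. -/
lemma hasDerivAt_interaction (hb : hbar ≠ 0) (hV : IsBoundedPotential V K)
    (hD : IsVonNeumannSolution hbar V D) (φ ψ : 𝓢(EuclideanSpace ℝ ι, ℂ)) (s : ℝ) :
    HasDerivAt (fun r => inner ℂ (freeOp hbar r (toL2 (φ : EuclideanSpace ℝ ι → ℂ)))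
      (D r (freeOp hbar r (toL2 (ψ : EuclideanSpace ℝ ι → ℂ)))))
      (rate hbar V D (toL2 (φ : EuclideanSpace ℝ ι → ℂ)) (toL2 (ψ : EuclideanSpace ℝ ι → ℂ)) s)
      s := by
  have hcont : ∀ f g : 𝓢(EuclideanSpace ℝ ι, ℂ), Tendsto (fun r => inner ℂ
      (toL2 (f : EuclideanSpace ℝ ι → ℂ)) (D r (toL2 (g : EuclideanSpace ℝ ι → ℂ)))) (𝓝 s)
      (𝓝 (inner ℂ (toL2 (f : EuclideanSpace ℝ ι → ℂ)) (D s (toL2 (g : EuclideanSpace ℝ ι → ℂ))))) :=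
    fun f g => (hD.equation f g s).continuousAt.tendsto
  have h := hasDerivAt_inner_apply (fun r => (hD.density r).norm_le_one)
    (hasDerivAt_freeOp hbar s φ) (hasDerivAt_freeOp hbar s ψ)
    (d := (inner ℂ (hamiltonian hbar (V s) (freeSchwartz hbar s φ))
        (D s (toL2 (freeSchwartz hbar s ψ : EuclideanSpace ℝ ι → ℂ))) -
      inner ℂ (toL2 (freeSchwartz hbar s φ : EuclideanSpace ℝ ι → ℂ))
        (D s (hamiltonian hbar (V s) (freeSchwartz hbar s ψ)))) / (Complex.I * (hbar : ℂ))) ?_ ?_ ?_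
  · refine h.congr_deriv ?_
    have hbc : (hbar : ℂ) ≠ 0 := by exact_mod_cast hb
    have hI : Complex.I ^ 2 = -1 := Complex.I_sq
    rw [rate, hamiltonian_eq hV, hamiltonian_eq hV, freeOp_toL2, freeOp_toL2]
    simp only [inner_smul_left, inner_add_left, inner_add_right, map_add, map_smul,
      inner_smul_right]
    simp only [map_mul, map_neg, map_div₀, map_pow, Complex.conj_I, Complex.conj_ofReal, map_ofNat]
    field_simp
    rw [hI]
    ring
  · simp only [freeOp_toL2]
    exact hD.equation _ _ s
  · simp only [freeOp_toL2, inner_smul_left]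
    exact (hcont _ _).const_mul _
  · simp only [freeOp_toL2, map_smul, inner_smul_right]
    exact (hcont _ _).const_mul _

lemma norm_rate_le (hV : IsBoundedPotential V K) (hD : ∀ s, ‖D s‖ ≤ 1) (u w : L2 ι) (s : ℝ) :
    ‖rate hbar V D u w s‖ ≤ 2 * K * (‖u‖ * ‖w‖) / |hbar| := by
  have hP : ∀ x : L2 ι, ‖potOp (V s) x‖ ≤ K * ‖x‖ := fun x =>
    (potOp (V s)).le_of_opNorm_le (hV.norm_potOp_le s) x
  have hD' : ∀ x : L2 ι, ‖D s x‖ ≤ ‖x‖ := fun x => by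
    simpa using (D s).le_of_opNorm_le (hD s) x
  rw [rate, norm_div, norm_mul, Complex.norm_I, one_mul, Complex.norm_real, Real.norm_eq_abs]
  gcongr
  refine (norm_sub_le _ _).trans ?_
  have h1 : ‖inner ℂ (potOp (V s) (freeOp hbar s u)) (D s (freeOp hbar s w))‖ ≤
      (K * ‖u‖) * ‖w‖ := by
    refine (norm_inner_le_norm _ _).trans (mul_le_mul ?_ ?_ (norm_nonneg _) ?_)
    · simpa using hP (freeOp hbar s u)
    · simpa using hD' (freeOp hbar s w)
    · exact mul_nonneg hV.nonneg (norm_nonneg _)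
  have h2 : ‖inner ℂ (freeOp hbar s u) (D s (potOp (V s) (freeOp hbar s w)))‖ ≤
      ‖u‖ * (K * ‖w‖) := by
    refine (norm_inner_le_norm _ _).trans (mul_le_mul ?_ ?_ (norm_nonneg _) (norm_nonneg _))
    · simp
    · refine (hD' _).trans ?_
      simpa using hP (freeOp hbar s w)
  linarith

lemma tendsto_rate {X : Type*} {l : Filter X} {a b : X → L2 ι} {u w : L2 ι}
    (ha : Tendsto a l (𝓝 u)) (hb : Tendsto b l (𝓝 w)) (s : ℝ) :
    Tendsto (fun x => rate hbar V D (a x) (b x) s) l (𝓝 (rate hbar V D u w s)) := by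
  have hc : ∀ r, Continuous (freeOp (ι := ι) hbar r) := fun r => (freeOp hbar r).continuous
  have h1 := ((hc s).tendsto u).comp ha
  have h2 := ((hc s).tendsto w).comp hb
  have h3 := ((potOp (V s)).continuous.tendsto _).comp h1
  have h4 := ((potOp (V s)).continuous.tendsto _).comp h2
  have h5 := ((D s).continuous.tendsto _).comp h2
  have h6 := ((D s).continuous.tendsto _).comp h4
  exact ((h3.inner h5).sub (h1.inner h6)).div_const _

/-- Integrated form of the von Neumann equation in the interaction picture. -/
lemma interaction_integral (hb : hbar ≠ 0) (hV : IsBoundedPotential V K)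
    (hD : IsVonNeumannSolution hbar V D) (u w : L2 ι) :
    AEStronglyMeasurable (rate hbar V D u w) volume ∧ ∀ t,
      inner ℂ (freeOp hbar t u) (D t (freeOp hbar t w)) - inner ℂ u (D 0 w) =
        ∫ s in (0 : ℝ)..t, rate hbar V D u w s := by
  have hseq : ∀ x : L2 ι, ∃ φ : ℕ → 𝓢(EuclideanSpace ℝ ι, ℂ),
      Tendsto (fun n => toL2 (φ n : EuclideanSpace ℝ ι → ℂ)) atTop (𝓝 x) := fun x => by
    obtain ⟨y, hy, hlim⟩ := mem_closure_iff_seq_limit.1 (dense_schwartz (ι := ι) x)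
    choose φ hφ using hy
    exact ⟨φ, by simpa only [hφ] using hlim⟩
  obtain ⟨φ, hφ⟩ := hseq u
  obtain ⟨ψ, hψ⟩ := hseq w
  have hder := fun n => hasDerivAt_interaction hb hV hD (φ n) (ψ n)
  have hmeas : ∀ n, Measurable (rate hbar V D (toL2 (φ n : EuclideanSpace ℝ ι → ℂ))
      (toL2 (ψ n : EuclideanSpace ℝ ι → ℂ))) := fun n => by
    have h := measurable_deriv (fun r => inner ℂ (freeOp hbar r (toL2 (φ n)))
      (D r (freeOp hbar r (toL2 (ψ n)))))
    rwa [show deriv _ = _ from funext fun s => (hder n s).deriv] at h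
  have hbd := fun x y => norm_rate_le (hbar := hbar) hV (fun s => (hD.density s).norm_le_one) x y
  have hlim : ∀ s, Tendsto (fun n => rate hbar V D (toL2 (φ n : EuclideanSpace ℝ ι → ℂ))
      (toL2 (ψ n : EuclideanSpace ℝ ι → ℂ)) s) atTop (𝓝 (rate hbar V D u w s)) :=
    tendsto_rate hφ hψ
  refine ⟨aestronglyMeasurable_of_tendsto_ae atTop (fun n => (hmeas n).aestronglyMeasurable)
    (ae_of_all _ hlim), fun t => ?_⟩
  have hint : ∀ n, IntervalIntegrable (rate hbar V D (toL2 (φ n : EuclideanSpace ℝ ι → ℂ))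
      (toL2 (ψ n : EuclideanSpace ℝ ι → ℂ))) volume 0 t := fun n =>
    (intervalIntegrable_const (c := 2 * K * (‖toL2 (φ n : EuclideanSpace ℝ ι → ℂ)‖ *
      ‖toL2 (ψ n : EuclideanSpace ℝ ι → ℂ)‖) / |hbar|)).mono_fun
      (hmeas n).aestronglyMeasurable (ae_of_all _ fun s =>
        (hbd _ _ s).trans (le_abs_self _))
  have hftc := fun n => intervalIntegral.integral_eq_sub_of_hasDerivAt (fun s _ => hder n s) (hint n)
  have hR : Tendsto (fun n => ∫ s in (0 : ℝ)..t, rate hbar V D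
      (toL2 (φ n : EuclideanSpace ℝ ι → ℂ)) (toL2 (ψ n : EuclideanSpace ℝ ι → ℂ)) s) atTop
      (𝓝 (∫ s in (0 : ℝ)..t, rate hbar V D u w s)) := by
    refine intervalIntegral.tendsto_integral_filter_of_dominated_convergence
      (fun _ => 2 * K * (‖u‖ * ‖w‖ + 1) / |hbar|)
      (Eventually.of_forall fun n => (hmeas n).aestronglyMeasurable) ?_
      intervalIntegrable_const (ae_of_all _ fun s _ => hlim s)
    filter_upwards [(hφ.norm.mul hψ.norm).eventually_le_const (lt_add_one (‖u‖ * ‖w‖))] with n hn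
    refine ae_of_all _ fun s _ => (hbd _ _ s).trans ?_
    have := hV.nonneg
    gcongr
  have hL : ∀ r, Tendsto (fun n => inner ℂ (freeOp hbar r (toL2 (φ n : EuclideanSpace ℝ ι → ℂ)))
      (D r (freeOp hbar r (toL2 (ψ n : EuclideanSpace ℝ ι → ℂ))))) atTop
      (𝓝 (inner ℂ (freeOp hbar r u) (D r (freeOp hbar r w)))) := fun r =>
    ((((freeOp hbar r).continuous.tendsto _).comp hφ).inner
      (((D r).continuous.tendsto _).comp (((freeOp hbar r).continuous.tendsto _).comp hψ)))
  have h2 := (hL t).sub (hL 0)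
  simp_rw [← hftc] at h2
  have h3 := tendsto_nhds_unique h2 hR
  rwa [freeOp_zero, freeOp_zero] at h3

/-- The image of a Hilbert basis under a unitary operator. -/
def rotateBasis {H : Type} [NormedAddCommGroup H] [InnerProductSpace ℂ H] {κ : Type}
    (b : HilbertBasis κ ℂ H) (U : H ≃ₗᵢ[ℂ] H) : HilbertBasis κ ℂ H :=
  HilbertBasis.ofRepr (U.symm.trans b.repr)

lemma rotateBasis_apply {H : Type} [NormedAddCommGroup H] [InnerProductSpace ℂ H] {κ : Type}
    (b : HilbertBasis κ ℂ H) (U : H ≃ₗᵢ[ℂ] H) (k : κ) : rotateBasis b U k = U (b k) := rfl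

lemma countable_of_orthonormal {H : Type} [NormedAddCommGroup H] [InnerProductSpace ℂ H]
    [SecondCountableTopology H] {κ : Type} {v : κ → H} (hv : Orthonormal ℂ v) : Countable κ := by
  have hdist : ∀ i j, i ≠ j → 1 < dist (v i) (v j) := fun i j hij => by
    have h := norm_sub_sq (𝕜 := ℂ) (v i) (v j)
    rw [hv.2 hij, hv.1 i, hv.1 j] at h
    rw [dist_eq_norm]
    norm_num at h
    nlinarith [norm_nonneg (v i - v j)]
  rw [← Set.countable_univ_iff]
  refine Set.PairwiseDisjoint.countable_of_isOpen (s := fun i => Metric.ball (v i) (1 / 2))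
    (fun i _ j _ hij => ?_) (fun _ _ => Metric.isOpen_ball) (fun i _ => ⟨v i, by simp⟩)
  exact Metric.ball_disjoint_ball (by linarith [hdist i j hij])

instance countable_basisIndex_L2 : Countable (basisIndex (L2 ι)) := by
  have : Fact ((2 : ℝ≥0∞) ≠ ∞) := ⟨by simp⟩
  have : SecondCountableTopology (L2 ι) := inferInstance
  exact countable_of_orthonormal (basis (L2 ι)).orthonormal

/-- The rate of change of the Wigner transform along the free flow. -/
def weylRate (hbar : ℝ) (W : EuclideanSpace ℝ ι → ℝ) (D : L2 ι →L[ℂ] L2 ι)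
    (ξ η : EuclideanSpace ℝ ι) : ℂ :=
  expect D (mulOp (fun y => (W (y - hbar • η) : ℂ) - (W y : ℂ)) ∘L weylOp hbar ξ η) /
    (Complex.I * hbar)

/-- Duhamel formula: along free trajectories, `trace (D W(ξ, η))` changes only through the
commutator of the Weyl operator with the potential. -/
theorem expect_weylOp_integral (hb : hbar ≠ 0) (hV : IsBoundedPotential V K)
    (hD : IsVonNeumannSolution hbar V D) (ξ η : EuclideanSpace ℝ ι) :
    (∀ t, IntervalIntegrable (fun s => weylRate hbar (V s) (D s) ξ (η + s • ξ)) volume 0 t) ∧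
    ∀ t, expect (D t) (weylOp hbar ξ (η + t • ξ)) = expect (D 0) (weylOp hbar ξ η) +
      ∫ s in (0 : ℝ)..t, weylRate hbar (V s) (D s) ξ (η + s • ξ) := by
  set e := basis (L2 ι)
  set F : basisIndex (L2 ι) → ℝ → ℂ := fun k => rate hbar V D (e k) (weylOp hbar ξ η (e k)) with hF
  have hFm : ∀ k, AEStronglyMeasurable (F k) volume := fun k =>
    (interaction_integral hb hV hD _ _).1
  have hnorm : ∀ s, ‖potOp (V s)‖ ^ 2 ≤ K ^ 2 := fun s =>
    pow_le_pow_left₀ (norm_nonneg _) (hV.norm_potOp_le s) 2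
  have hweyl : ∀ s : ℝ, ‖weylOp hbar ξ (η + s • ξ)‖ ^ 2 ≤ 1 := fun s =>
    pow_le_one₀ (norm_nonneg _) (norm_weylOp_le _ _)
  have hid : ‖ContinuousLinearMap.id ℂ (L2 ι)‖ ^ 2 ≤ 1 :=
    pow_le_one₀ (norm_nonneg _) ContinuousLinearMap.norm_id_le
  have hcomp : ∀ s : ℝ, ‖potOp (V s) ∘L weylOp hbar ξ (η + s • ξ)‖ ^ 2 ≤ K ^ 2 := fun s => by
    refine pow_le_pow_left₀ (norm_nonneg _) ?_ 2
    refine (ContinuousLinearMap.opNorm_comp_le _ _).trans ?_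
    simpa using mul_le_mul (hV.norm_potOp_le s) (norm_weylOp_le (hbar := hbar) ξ (η + s • ξ))
      (norm_nonneg _) hV.nonneg
  have hFs : ∀ k s, F k s = (inner ℂ (potOp (V s) (rotateBasis e (freeOp hbar s) k))
      (D s (weylOp hbar ξ (η + s • ξ) (rotateBasis e (freeOp hbar s) k))) -
      inner ℂ (ContinuousLinearMap.id ℂ (L2 ι) (rotateBasis e (freeOp hbar s) k))
        (D s ((potOp (V s) ∘L weylOp hbar ξ (η + s • ξ)) (rotateBasis e (freeOp hbar s) k)))) /
      (Complex.I * hbar) := fun k s => by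
    rw [hF]
    simp only [rate, freeOp_weylOp hb, rotateBasis_apply, ContinuousLinearMap.comp_apply,
      ContinuousLinearMap.id_apply]
  have hsum : ∀ s, HasSum (fun k => F k s) (weylRate hbar (V s) (D s) ξ (η + s • ξ)) := fun s => by
    simp_rw [hFs]
    have h1 := hasSum_expect (hD.density s) (rotateBasis e (freeOp hbar s))
      (weylOp hbar ξ (η + s • ξ)) (potOp (V s))
    have h2 := hasSum_expect (hD.density s) (rotateBasis e (freeOp hbar s))
      (potOp (V s) ∘L weylOp hbar ξ (η + s • ξ)) (ContinuousLinearMap.id ℂ (L2 ι))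
    rw [adjoint_mulOp_ofReal (hV.symbol s)] at h1
    rw [ContinuousLinearMap.adjoint_id, ContinuousLinearMap.comp_id] at h2
    have h3 := (h1.sub h2).div_const (Complex.I * hbar)
    rwa [← expect_sub (hD.density s), weylOp_commutator (hV.symbol s)] at h3
  set c := (2 * K ^ 2 + 2) / |hbar| with hc
  have hnF : ∀ s (S : Finset (basisIndex (L2 ι))), ∑ k ∈ S, ‖F k s‖ ≤ c := fun s S => by
    have h1 := summable_norm_expect (hD.density s) (rotateBasis e (freeOp hbar s))
      (weylOp hbar ξ (η + s • ξ)) (potOp (V s))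
    have h2 := summable_norm_expect (hD.density s) (rotateBasis e (freeOp hbar s))
      (potOp (V s) ∘L weylOp hbar ξ (η + s • ξ)) (ContinuousLinearMap.id ℂ (L2 ι))
    have h1' := tsum_norm_expect_le (hD.density s) (rotateBasis e (freeOp hbar s))
      (weylOp hbar ξ (η + s • ξ)) (potOp (V s))
    have h2' := tsum_norm_expect_le (hD.density s) (rotateBasis e (freeOp hbar s))
      (potOp (V s) ∘L weylOp hbar ξ (η + s • ξ)) (ContinuousLinearMap.id ℂ (L2 ι))
    have h3 := h1.sum_le_tsum S (fun _ _ => norm_nonneg _)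
    have h4 := h2.sum_le_tsum S (fun _ _ => norm_nonneg _)
    simp_rw [hFs, norm_div, norm_mul, Complex.norm_I, one_mul, Complex.norm_real, Real.norm_eq_abs]
    rw [← Finset.sum_div, hc]
    gcongr
    refine (Finset.sum_le_sum fun k _ => norm_sub_le _ _).trans ?_
    rw [Finset.sum_add_distrib]
    linarith [hnorm s, hweyl s, hcomp s]
  have hc0 : 0 ≤ c := by simpa using hnF 0 ∅
  have hFk : ∀ k s, ‖F k s‖ ≤ c := fun k s => by simpa using hnF s {k}
  have hbound : ∀ s, ‖weylRate hbar (V s) (D s) ξ (η + s • ξ)‖ ≤ c := fun s =>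
    le_of_tendsto (hsum s).norm (Eventually.of_forall fun S => (norm_sum_le _ _).trans (hnF s S))
  have hRm : AEStronglyMeasurable (fun s => weylRate hbar (V s) (D s) ξ (η + s • ξ)) volume :=
    aestronglyMeasurable_of_tendsto_ae atTop
      (fun S => Finset.aestronglyMeasurable_fun_sum S fun k _ => hFm k) (ae_of_all _ hsum)
  have hRi : ∀ t, IntervalIntegrable (fun s => weylRate hbar (V s) (D s) ξ (η + s • ξ)) volume 0 t :=
    fun t => (intervalIntegrable_const (c := c)).mono_fun hRm.restrict
      (ae_of_all _ fun s => (hbound s).trans (le_abs_self c))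
  refine ⟨hRi, fun t => ?_⟩
  have hFi : ∀ k, IntegrableOn (F k) (Set.uIoc 0 t) volume := fun k =>
    intervalIntegrable_iff.1 ((intervalIntegrable_const (c := c)).mono_fun (hFm k).restrict
      (ae_of_all _ fun s => (hFk k s).trans (le_abs_self c)))
  have hint : HasSum (fun k => ∫ s in (0 : ℝ)..t, F k s)
      (∫ s in (0 : ℝ)..t, weylRate hbar (V s) (D s) ξ (η + s • ξ)) := by
    have h := hasSum_integral_of_summable_integral_norm (μ := volume.restrict (Set.uIoc 0 t))
      (F := F) hFi ?_
    · simp_rw [intervalIntegral.intervalIntegral_eq_integral_uIoc]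
      have h2 := h.const_smul (if (0 : ℝ) ≤ t then (1 : ℝ) else -1)
      simp_rw [fun s => (hsum s).tsum_eq] at h2
      exact h2
    · refine summable_of_sum_le (c := ∫ s in Set.uIoc 0 t, c)
        (fun k => integral_nonneg fun _ => norm_nonneg _) fun S => ?_
      rw [← integral_finsetSum _ fun k _ => (hFi k).norm]
      refine integral_mono_of_nonneg (ae_of_all _ fun s => Finset.sum_nonneg fun _ _ => norm_nonneg _)
        ?_ (ae_of_all _ fun s => hnF s S)
      exact integrableOn_const (by simp [Set.uIoc]) 
  have hk : ∀ k, ∫ s in (0 : ℝ)..t, F k s =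
      inner ℂ (ContinuousLinearMap.id ℂ (L2 ι) (rotateBasis e (freeOp hbar t) k))
        (D t (weylOp hbar ξ (η + t • ξ) (rotateBasis e (freeOp hbar t) k))) -
      inner ℂ (ContinuousLinearMap.id ℂ (L2 ι) (e k)) (D 0 (weylOp hbar ξ η (e k))) := fun k => by
    rw [hF, ← (interaction_integral hb hV hD _ _).2 t, freeOp_weylOp hb]
    rfl
  have h1 := hasSum_expect (hD.density t) (rotateBasis e (freeOp hbar t))
    (weylOp hbar ξ (η + t • ξ)) (ContinuousLinearMap.id ℂ (L2 ι))
  have h2 := hasSum_expect (hD.density 0) e (weylOp hbar ξ η) (ContinuousLinearMap.id ℂ (L2 ι))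
  rw [ContinuousLinearMap.adjoint_id, ContinuousLinearMap.comp_id] at h1 h2
  have h3 := h1.sub h2
  simp_rw [← hk] at h3
  rw [← h3.unique hint]
  ring

end Duhamel

/-! ### Product functions on the `N`-particle space -/

section Tensor

set_option linter.unusedSectionVars false

variable {N d : ℕ}

/-- Lebesgue measure on `ℝ^{Nd}` is the product of `N` copies of Lebesgue measure on `ℝ^d`. -/
lemma volume_preserving_curry : MeasurePreserving
    (fun (f : Fin N × Fin d → ℝ) (k : Fin N) (i : Fin d) => f (k, i)) volume volume := by
  have hm : Measurable (fun (f : Fin N × Fin d → ℝ) (k : Fin N) (i : Fin d) => f (k, i)) := by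
    fun_prop
  refine ⟨hm, ?_⟩
  symm
  refine Measure.pi_eq_generateFrom
    (C := fun _ : Fin N => Set.pi Set.univ '' Set.pi Set.univ fun _ : Fin d =>
      {s : Set ℝ | MeasurableSet s})
    (fun _ => generateFrom_pi) (fun _ => isPiSystem_pi)
    (fun _ => Measure.FiniteSpanningSetsIn.pi fun _ => Measure.toFiniteSpanningSetsIn _) ?_
  intro s hs
  choose t ht hts using hs
  have h1 : (fun (f : Fin N × Fin d → ℝ) (k : Fin N) (i : Fin d) => f (k, i)) ⁻¹'
      (Set.pi Set.univ s) = Set.pi Set.univ fun p : Fin N × Fin d => t p.1 p.2 := by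
    ext f
    simp only [Set.mem_preimage, Set.mem_pi, Set.mem_univ, forall_true_left, ← hts, Prod.forall]
  have hsm : MeasurableSet (Set.pi Set.univ s) := by
    refine MeasurableSet.univ_pi fun k => ?_
    rw [← hts k]
    exact MeasurableSet.univ_pi fun i => ht k i (Set.mem_univ i)
  rw [Measure.map_apply hm hsm, h1, volume_pi_pi, Fintype.prod_prod_type]
  refine Finset.prod_congr rfl fun k _ => ?_
  rw [← hts k, Measure.pi_pi]

/-- The positions of the `N` particles, as a measurable equivalence. -/
def particleEquiv : EuclideanSpace ℝ (Fin N × Fin d) ≃ᵐ (Fin N → EuclideanSpace ℝ (Fin d)) where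
  toFun x := particle x
  invFun X := WithLp.toLp 2 fun p => X p.1 p.2
  left_inv _ := rfl
  right_inv _ := rfl
  measurable_toFun := by
    refine measurable_pi_lambda _ fun k => ?_
    exact (PiLp.volume_preserving_toLp (Fin d)).measurable.comp (measurable_pi_lambda _ fun i => by
      fun_prop)
  measurable_invFun := by
    refine (PiLp.volume_preserving_toLp (Fin N × Fin d)).measurable.comp
      (measurable_pi_lambda _ fun p => ?_)
    exact (measurable_pi_apply p.2).comp ((PiLp.volume_preserving_ofLp (Fin d)).measurable.comp
      (measurable_pi_apply p.1))

lemma measurePreserving_particle : MeasurePreserving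
    (particle : EuclideanSpace ℝ (Fin N × Fin d) → Fin N → EuclideanSpace ℝ (Fin d))
    volume volume := by
  have h1 := volume_preserving_pi (fun _ : Fin N => PiLp.volume_preserving_toLp (Fin d))
  exact h1.comp (volume_preserving_curry.comp (PiLp.volume_preserving_ofLp (Fin N × Fin d)))

lemma measurePreserving_particleEquiv : MeasurePreserving
    (particleEquiv (N := N) (d := d)) volume volume := measurePreserving_particle

lemma quasiMeasurePreserving_particle (k : Fin N) : Measure.QuasiMeasurePreserving
    (fun x : EuclideanSpace ℝ (Fin N × Fin d) => particle x k) volume volume :=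
  (Measure.quasiMeasurePreserving_eval (fun _ : Fin N => (volume : Measure
    (EuclideanSpace ℝ (Fin d)))) k).comp measurePreserving_particle.quasiMeasurePreserving

lemma integral_prod_particle (f : Fin N → EuclideanSpace ℝ (Fin d) → ℂ) :
    ∫ x : EuclideanSpace ℝ (Fin N × Fin d), ∏ k, f k (particle x k) = ∏ k, ∫ y, f k y := by
  rw [← integral_fintype_prod_volume_eq_prod]
  exact measurePreserving_particleEquiv.integral_comp' (g := fun X => ∏ k, f k (X k))

lemma memLp_prod_particle {f : Fin N → EuclideanSpace ℝ (Fin d) → ℂ}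
    (hf : ∀ k, MemLp (f k) 2 volume) :
    MemLp (fun x : EuclideanSpace ℝ (Fin N × Fin d) => ∏ k, f k (particle x k)) 2 volume := by
  have hm : AEStronglyMeasurable (fun x : EuclideanSpace ℝ (Fin N × Fin d) =>
      ∏ k, f k (particle x k)) volume :=
    Finset.aestronglyMeasurable_fun_prod _ fun k _ =>
      (hf k).1.comp_quasiMeasurePreserving (quasiMeasurePreserving_particle k)
  rw [memLp_two_iff_integrable_sq_norm hm]
  have h1 : Integrable (fun X : Fin N → EuclideanSpace ℝ (Fin d) => ∏ k, ‖f k (X k)‖ ^ 2)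
      volume :=
    Integrable.fintype_prod (f := fun k y => ‖f k y‖ ^ 2) fun k =>
      (memLp_two_iff_integrable_sq_norm (hf k).1).1 (hf k)
  have h2 := (measurePreserving_particle (N := N) (d := d)).integrable_comp_of_integrable h1
  refine h2.congr (ae_of_all _ fun x => ?_)
  simp [norm_prod, Finset.prod_pow]

lemma coeFn_tensorVec (u : Fin N → L2 (Fin d)) :
    tensorVec u =ᵐ[volume] fun x => ∏ k, (u k) (particle x k) :=
  coeFn_toL2 (memLp_prod_particle fun k => Lp.memLp (u k))

lemma ae_particle {p : Fin N → EuclideanSpace ℝ (Fin d) → Prop} (h : ∀ k, ∀ᵐ y, p k y) :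
    ∀ᵐ x : EuclideanSpace ℝ (Fin N × Fin d), ∀ k, p k (particle x k) :=
  ae_all_iff.2 fun k => (quasiMeasurePreserving_particle k).ae (h k)

lemma tensorVec_eq_toL2 {u : Fin N → L2 (Fin d)} {f : Fin N → EuclideanSpace ℝ (Fin d) → ℂ}
    (h : ∀ k, u k =ᵐ[volume] f k) : tensorVec u = toL2 fun x => ∏ k, f k (particle x k) := by
  refine toL2_congr ?_
  filter_upwards [ae_particle h] with x hx
  exact Finset.prod_congr rfl fun k _ => hx k

lemma inner_tensorVec (u w : Fin N → L2 (Fin d)) :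
    inner ℂ (tensorVec u) (tensorVec w) = ∏ k, inner ℂ (u k) (w k) := by
  simp_rw [inner_L2, ← integral_prod_particle]
  refine integral_congr_ae ?_
  filter_upwards [coeFn_tensorVec u, coeFn_tensorVec w] with x h1 h2
  rw [h1, h2, map_prod, Finset.prod_mul_distrib]

lemma norm_tensorVec (u : Fin N → L2 (Fin d)) : ‖tensorVec u‖ = ∏ k, ‖u k‖ := by
  have h := inner_tensorVec u u
  simp_rw [inner_self_eq_norm_sq_to_K] at h
  have h2 : ‖tensorVec u‖ ^ 2 = (∏ k, ‖u k‖) ^ 2 := by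
    rw [← Finset.prod_pow]
    exact_mod_cast h
  exact (pow_left_inj₀ (norm_nonneg _) (Finset.prod_nonneg fun _ _ => norm_nonneg _)
    two_ne_zero).1 h2

/-- The tensor product as a bounded linear map in its `k`-th factor. -/
def tensorVecCLM (u : Fin N → L2 (Fin d)) (k : Fin N) : L2 (Fin d) →L[ℂ] L2 (Fin N × Fin d) :=
  LinearMap.mkContinuousOfExistsBound
    { toFun := fun w => tensorVec (Function.update u k w)
      map_add' := fun w w' => by
        apply Lp.ext
        filter_upwards [coeFn_tensorVec (Function.update u k (w + w')),
          coeFn_tensorVec (Function.update u k w), coeFn_tensorVec (Function.update u k w'),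
          Lp.coeFn_add (tensorVec (Function.update u k w)) (tensorVec (Function.update u k w')),
          (quasiMeasurePreserving_particle k).ae (Lp.coeFn_add w w')] with x h1 h2 h3 h4 h5
        rw [h1, h4, Pi.add_apply, h2, h3, ← Finset.mul_prod_erase _ _ (Finset.mem_univ k),
          ← Finset.mul_prod_erase _ _ (Finset.mem_univ k),
          ← Finset.mul_prod_erase _ _ (Finset.mem_univ k)]
        simp only [Function.update_self, h5, Pi.add_apply, add_mul]
        congr 2 <;> exact Finset.prod_congr rfl fun l hl => by
          rw [Function.update_of_ne (Finset.ne_of_mem_erase hl),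
            Function.update_of_ne (Finset.ne_of_mem_erase hl)]
      map_smul' := fun c w => by
        apply Lp.ext
        filter_upwards [coeFn_tensorVec (Function.update u k (c • w)),
          coeFn_tensorVec (Function.update u k w),
          Lp.coeFn_smul c (tensorVec (Function.update u k w)),
          (quasiMeasurePreserving_particle k).ae (Lp.coeFn_smul c w)] with x h1 h2 h3 h4
        rw [h1, RingHom.id_apply, h3, Pi.smul_apply, h2,
          ← Finset.mul_prod_erase _ _ (Finset.mem_univ k),
          ← Finset.mul_prod_erase _ _ (Finset.mem_univ k)]
        simp only [Function.update_self, h4, Pi.smul_apply, smul_eq_mul, mul_assoc]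
        congr 2
        exact Finset.prod_congr rfl fun l hl => by
          rw [Function.update_of_ne (Finset.ne_of_mem_erase hl),
            Function.update_of_ne (Finset.ne_of_mem_erase hl)] }
    ⟨∏ l ∈ Finset.univ.erase k, ‖u l‖, fun w => by
      change ‖tensorVec (Function.update u k w)‖ ≤ _
      rw [norm_tensorVec, ← Finset.mul_prod_erase _ _ (Finset.mem_univ k), Function.update_self,
        mul_comm]
      refine le_of_eq ?_
      congr 1
      exact Finset.prod_congr rfl fun l hl => by
        rw [Function.update_of_ne (Finset.ne_of_mem_erase hl)]⟩

lemma tensorVecCLM_apply (u : Fin N → L2 (Fin d)) (k : Fin N) (w : L2 (Fin d)) :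
    tensorVecCLM u k w = tensorVec (Function.update u k w) := rfl

/-- A vector orthogonal to all tensor products of basis vectors is orthogonal to all tensor
products. -/
lemma inner_tensorVec_eq_zero {κ : Type} (e : HilbertBasis κ ℂ (L2 (Fin d)))
    {Ψ : L2 (Fin N × Fin d)} (h : ∀ K : Fin N → κ, inner ℂ Ψ (tensorVec fun k => e (K k)) = 0)
    (u : Fin N → L2 (Fin d)) : inner ℂ Ψ (tensorVec u) = 0 := by
  classical
  -- The factors are replaced one at a time, by density of the span of the basis.
  suffices H : ∀ (s : Finset (Fin N)) (u : Fin N → L2 (Fin d)),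
      (∀ k ∉ s, ∃ i, u k = e i) → inner ℂ Ψ (tensorVec u) = 0 from
    H Finset.univ u fun k hk => absurd (Finset.mem_univ k) hk
  intro s
  induction s using Finset.induction_on with
  | empty =>
    intro u hu
    choose K hK using fun k => hu k (Finset.notMem_empty k)
    rw [funext hK]
    exact h K
  | insert k s hk ih =>
    intro u hu
    have h0 : (innerSL ℂ Ψ) ∘L tensorVecCLM u k = 0 := by
      refine ContinuousLinearMap.ext_on (s := Set.range e) ?_ ?_
      · exact Submodule.dense_iff_topologicalClosure_eq_top.2 e.dense_span
      · rintro _ ⟨i, rfl⟩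
        simp only [ContinuousLinearMap.comp_apply, tensorVecCLM_apply, innerSL_apply_apply,
          zero_apply]
        refine ih _ fun l hl => ?_
        by_cases hlk : l = k
        · subst hlk
          exact ⟨i, by simp⟩
        · rw [Function.update_of_ne hlk]
          exact hu l (by simp [hlk, hl])
    have h1 := congrArg (fun f => f (u k)) h0
    simpa [tensorVecCLM_apply] using h1

lemma integrableOn_L2 {ι : Type} [Fintype ι] (Ψ : L2 ι) {S : Set (EuclideanSpace ℝ ι)}
    (hS : volume S ≠ ∞) : IntegrableOn Ψ S volume := by
  have : IsFiniteMeasure (volume.restrict S) := ⟨by simpa using hS.lt_top⟩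
  exact ((Lp.memLp Ψ).restrict S).integrable one_le_two

/-- Tensor products span a dense subspace. -/
lemma eq_zero_of_inner_tensorVec {Ψ : L2 (Fin N × Fin d)}
    (h : ∀ u : Fin N → L2 (Fin d), inner ℂ Ψ (tensorVec u) = 0) : Ψ = 0 := by
  classical
  set B : ℕ → Set (Fin N → EuclideanSpace ℝ (Fin d)) := fun n =>
    Set.pi Set.univ fun _ => Metric.ball 0 n with hB
  have hBm : ∀ n, MeasurableSet (B n) := fun n => MeasurableSet.univ_pi fun _ => measurableSet_ball
  have hPm : Measurable (particle : EuclideanSpace ℝ (Fin N × Fin d) → _) :=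
    measurePreserving_particle.measurable
  have hBf : ∀ n, volume (particle ⁻¹' B n : Set (EuclideanSpace ℝ (Fin N × Fin d))) ≠ ∞ := fun n => by
    rw [measurePreserving_particle.measure_preimage (hBm n).nullMeasurableSet, hB, volume_pi_pi]
    exact ENNReal.prod_ne_top fun _ _ => measure_ball_lt_top.ne
  -- `Ψ` has vanishing integral over boxes, as their indicator functions are tensor products …
  have hbox : ∀ s : Fin N → Set (EuclideanSpace ℝ (Fin d)), (∀ k, MeasurableSet (s k)) →
      (∀ k, volume (s k) ≠ ∞) → ∫ x in particle ⁻¹' (Set.pi Set.univ s), Ψ x = 0 := by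
    intro s hs hsf
    have h1 := h fun k => indicatorConstLp 2 (hs k) (hsf k) (1 : ℂ)
    rw [tensorVec_eq_toL2 fun k => indicatorConstLp_coeFn] at h1
    have hmem : MemLp (fun x : EuclideanSpace ℝ (Fin N × Fin d) =>
        ∏ k, (s k).indicator (fun _ => (1 : ℂ)) (particle x k)) 2 volume :=
      memLp_prod_particle fun k => memLp_indicator_const 2 (hs k) 1 (Or.inr (hsf k))
    have h2 : inner ℂ Ψ (toL2 fun x : EuclideanSpace ℝ (Fin N × Fin d) =>
        ∏ k, (s k).indicator (fun _ => (1 : ℂ)) (particle x k)) =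
        ∫ x in particle ⁻¹' (Set.pi Set.univ s), starRingEnd ℂ (Ψ x) := by
      rw [inner_L2, ← integral_indicator (hPm (MeasurableSet.univ_pi hs))]
      refine integral_congr_ae ?_
      filter_upwards [coeFn_toL2 hmem] with x hx
      rw [hx]
      by_cases hxs : x ∈ (particle ⁻¹' (Set.pi Set.univ s) : Set (EuclideanSpace ℝ (Fin N × Fin d)))
      · rw [Set.indicator_of_mem hxs, Finset.prod_eq_one, mul_one]
        intro k _
        exact Set.indicator_of_mem (hxs k (Set.mem_univ k)) _
      · rw [Set.indicator_of_notMem hxs]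
        simp only [Set.mem_preimage, Set.mem_pi, Set.mem_univ, forall_true_left, not_forall] at hxs
        obtain ⟨k, hk⟩ := hxs
        rw [Finset.prod_eq_zero (Finset.mem_univ k) (Set.indicator_of_notMem hk _), mul_zero]
    rw [h2, integral_conj] at h1
    simpa using h1
  -- … hence over all measurable subsets of a bounded box, since boxes form a π-system.
  have hall : ∀ n (T : Set (Fin N → EuclideanSpace ℝ (Fin d))), MeasurableSet T →
      ∫ x in particle ⁻¹' (T ∩ B n), Ψ x = 0 := by
    intro n T hT
    have hi : ∀ S : Set (Fin N → EuclideanSpace ℝ (Fin d)),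
        IntegrableOn Ψ (particle ⁻¹' (S ∩ B n)) volume := fun S =>
      (integrableOn_L2 Ψ (hBf n)).mono_set (Set.preimage_mono Set.inter_subset_right)
    induction T, hT using MeasurableSpace.induction_on_inter (generateFrom_pi (α := fun _ : Fin N =>
      EuclideanSpace ℝ (Fin d))).symm isPiSystem_pi with
    | empty => simp
    | basic T hT =>
      obtain ⟨s, hs, rfl⟩ := hT
      rw [hB, ← Set.pi_inter_distrib]
      refine hbox (fun k => s k ∩ Metric.ball 0 n)
        (fun k => MeasurableSet.inter (show MeasurableSet (s k) from hs k (Set.mem_univ k))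
          measurableSet_ball) fun k => ?_
      exact (measure_mono Set.inter_subset_right).trans_lt measure_ball_lt_top |>.ne
    | compl T hT ih =>
      have h1 := hbox (fun _ => Metric.ball 0 n) (fun _ => measurableSet_ball)
        (fun _ => measure_ball_lt_top.ne)
      have h2 : particle ⁻¹' (B n) = (particle ⁻¹' (T ∩ B n) ∪ particle ⁻¹' (Tᶜ ∩ B n) :
          Set (EuclideanSpace ℝ (Fin N × Fin d))) := by
        rw [← Set.preimage_union, ← Set.union_inter_distrib_right, Set.union_compl_self,
          Set.univ_inter]
      have h3 := setIntegral_union (f := Ψ) (μ := volume)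
        (s := particle ⁻¹' (T ∩ B n)) (t := particle ⁻¹' (Tᶜ ∩ B n))
        (by
          refine Disjoint.preimage _ ?_
          exact Disjoint.mono Set.inter_subset_left Set.inter_subset_left disjoint_compl_right)
        (hPm (hT.compl.inter (hBm n))) (hi T) (hi Tᶜ)
      rw [← h2, ih, zero_add] at h3
      rw [← h3]
      exact h1
    | iUnion T hd hT ih =>
      rw [Set.iUnion_inter, Set.preimage_iUnion, integral_iUnion (fun i => hPm ((hT i).inter (hBm n)))]
      · exact (tsum_congr ih).trans tsum_zero
      · intro i j hij
        refine Disjoint.preimage _ ?_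
        exact Disjoint.mono Set.inter_subset_left Set.inter_subset_left (hd hij)
      · rw [← Set.preimage_iUnion, ← Set.iUnion_inter]
        exact hi _
  have hzero : ∀ n : ℕ, ∀ᵐ x ∂(volume.restrict
      (particle ⁻¹' B n : Set (EuclideanSpace ℝ (Fin N × Fin d)))), Ψ x = 0 := fun n => by
    refine (integrableOn_L2 Ψ (hBf n)).ae_eq_zero_of_forall_setIntegral_eq_zero fun S hS _ => ?_
    rw [Measure.restrict_restrict hS]
    have h1 := hall n (particleEquiv.symm ⁻¹' S) (particleEquiv.symm.measurable hS)
    rwa [Set.preimage_inter] at h1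
  have hU : (⋃ n : ℕ, (particle ⁻¹' B n : Set (EuclideanSpace ℝ (Fin N × Fin d)))) = Set.univ := by
    refine Set.eq_univ_of_forall fun x => ?_
    obtain ⟨n, hn⟩ := exists_nat_gt (∑ k, ‖particle x k‖)
    refine Set.mem_iUnion.2 ⟨n, fun k _ => ?_⟩
    rw [mem_ball_zero_iff]
    exact (Finset.single_le_sum (f := fun k => ‖particle x k‖) (fun _ _ => norm_nonneg _)
      (Finset.mem_univ k)).trans_lt hn
  have h1 := (ae_restrict_iUnion_iff _ _).2 hzero
  rw [hU, Measure.restrict_univ] at h1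
  exact (Lp.eq_zero_iff_ae_eq_zero).2 h1

/-- The tensor products of the vectors of a Hilbert basis form a Hilbert basis. -/
def tensorBasis {κ : Type} (e : HilbertBasis κ ℂ (L2 (Fin d))) :
    HilbertBasis (Fin N → κ) ℂ (L2 (Fin N × Fin d)) :=
  HilbertBasis.mkOfOrthogonalEqBot (v := fun K : Fin N → κ => tensorVec fun k => e (K k))
    (by
      classical
      rw [orthonormal_iff_ite]
      intro K L
      rw [inner_tensorVec]
      simp_rw [orthonormal_iff_ite.1 e.orthonormal]
      by_cases hKL : K = L
      · simp [hKL]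
      · rw [if_neg hKL]
        obtain ⟨k, hk⟩ := Function.ne_iff.1 hKL
        exact Finset.prod_eq_zero (Finset.mem_univ k) (if_neg hk))
    (by
      rw [Submodule.eq_bot_iff]
      intro Ψ hΨ
      refine eq_zero_of_inner_tensorVec (inner_tensorVec_eq_zero e fun K => ?_)
      exact (Submodule.mem_orthogonal' _ _).1 hΨ _ (Submodule.subset_span ⟨K, rfl⟩))

lemma tensorBasis_apply {κ : Type} (e : HilbertBasis κ ℂ (L2 (Fin d))) (K : Fin N → κ) :
    tensorBasis e K = tensorVec fun k => e (K k) := by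
  rw [tensorBasis, HilbertBasis.coe_mkOfOrthogonalEqBot]

end Tensor

/-! ### Tensor products of operators, tensor powers of states and marginals -/

section TensorOp

set_option linter.unusedSectionVars false

/-- A sum over multi-indices of products is the product of the sums. -/
lemma hasSum_prod_pi {κ : Type} : ∀ {N : ℕ} {f : Fin N → κ → ℂ},
    (∀ k, Summable fun i => ‖f k i‖) →
    HasSum (fun K : Fin N → κ => ∏ k, f k (K k)) (∏ k, ∑' i, f k i) ∧
      Summable fun K : Fin N → κ => ‖∏ k, f k (K k)‖
  | 0, f, _ => by
    refine ⟨?_, (hasSum_fintype _).summable⟩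
    simp
  | N + 1, f, hf => by
    obtain ⟨h1, h2⟩ := hasSum_prod_pi (f := fun k : Fin N => f k.succ) fun k => hf k.succ
    have h3 := summable_mul_of_summable_norm (hf 0) h2
    have h4 : HasSum (fun q : κ × (Fin N → κ) => f 0 q.1 * ∏ k, f (Fin.succ k) (q.2 k))
        ((∑' i, f 0 i) * ∏ k, ∑' i, f (Fin.succ k) i) := by
      rw [← h1.tsum_eq, tsum_mul_tsum_of_summable_norm (hf 0) h2]
      exact h3.hasSum
    have h5 := (hf 0).mul_norm h2
    have h6 : (fun K : Fin (N + 1) → κ => ∏ k, f k (K k)) ∘ (Fin.consEquiv fun _ => κ) =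
        fun q : κ × (Fin N → κ) => f 0 q.1 * ∏ k, f (Fin.succ k) (q.2 k) := by
      ext q
      simp [Fin.prod_univ_succ, Fin.consEquiv]
    constructor
    · rw [Fin.prod_univ_succ, ← (Fin.consEquiv fun _ => κ).hasSum_iff, h6]
      exact h4
    · rw [← (Fin.consEquiv fun _ => κ).summable_iff]
      refine h5.congr fun q => ?_
      rw [← congrFun h6 q]
      rfl

/-- A square summable family is the family of images of a Hilbert basis under a bounded
operator. -/
lemma exists_clm_of_summable_sq {H : Type} [NormedAddCommGroup H] [InnerProductSpace ℂ H]
    [CompleteSpace H] {κ : Type} (b : HilbertBasis κ ℂ H) {f : κ → H}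
    (hf : Summable fun k => ‖f k‖ ^ 2) : ∃ T : H →L[ℂ] H, ∀ k, T (b k) = f k := by
  have hb : ∀ x : H, HasSum (fun k => ‖inner ℂ (b k) x‖ ^ 2) (‖x‖ ^ 2) := fun x => by
    rw [hasSum_norm_sq_iff (sq_nonneg _), tsum_enorm_inner_sq, ENNReal.ofReal_pow (norm_nonneg _),
      ofReal_norm]
  have hle : ∀ x : H, ∀ k, (2 * ‖x‖) * ‖inner ℂ (b k) x • f k‖ ≤
      ‖inner ℂ (b k) x‖ ^ 2 + ‖x‖ ^ 2 * ‖f k‖ ^ 2 := fun x k => by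
    rw [norm_smul]
    nlinarith [sq_nonneg (‖inner ℂ (b k) x‖ - ‖x‖ * ‖f k‖)]
  have hs : ∀ x : H, Summable fun k => ‖inner ℂ (b k) x • f k‖ := fun x => by
    rcases eq_or_ne x 0 with rfl | hx
    · simp [summable_zero]
    · have hx' : 0 < 2 * ‖x‖ := by positivity
      refine (summable_mul_left_iff hx'.ne').1 (Summable.of_nonneg_of_le (fun _ => by positivity)
        (hle x) ((hb x).summable.add (hf.mul_left _)))
  refine ⟨LinearMap.mkContinuousOfExistsBound
    { toFun := fun x => ∑' k, inner ℂ (b k) x • f k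
      map_add' := fun x y => by
        rw [← (hs x).of_norm.tsum_add (hs y).of_norm]
        simp_rw [inner_add_right, add_smul]
      map_smul' := fun c x => by
        rw [RingHom.id_apply, ← (hs x).of_norm.tsum_const_smul]
        simp_rw [inner_smul_right, mul_smul] }
    ⟨(1 + ∑' k, ‖f k‖ ^ 2) / 2, fun x => ?_⟩, fun k => ?_⟩
  · change ‖∑' k, inner ℂ (b k) x • f k‖ ≤ _
    rcases eq_or_ne x 0 with rfl | hx
    · simp
    · have hx' : 0 < 2 * ‖x‖ := by positivity
      have h1 := ((hs x).mul_left (2 * ‖x‖)).tsum_le_tsum (hle x)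
        ((hb x).summable.add (hf.mul_left _))
      rw [(hb x).summable.tsum_add (hf.mul_left _), (hb x).tsum_eq, tsum_mul_left,
        tsum_mul_left] at h1
      have h2 := norm_tsum_le_tsum_norm (hs x)
      refine le_of_mul_le_mul_left ?_ hx'
      nlinarith
  · change ∑' l, inner ℂ (b l) (b k) • f l = f k
    classical
    rw [tsum_eq_single k]
    · simp [b.orthonormal.1 k]
    · intro l hl
      simp [orthonormal_iff_ite.1 b.orthonormal l k, hl]

variable {N d : ℕ} {hbar : ℝ}

/-- The configuration with given positions of the particles. -/
def join (X : Fin N → EuclideanSpace ℝ (Fin d)) : EuclideanSpace ℝ (Fin N × Fin d) :=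
  WithLp.toLp 2 fun p => X p.1 p.2

@[simp] lemma particle_join (X : Fin N → EuclideanSpace ℝ (Fin d)) (k : Fin N) :
    particle (join X) k = X k := rfl

lemma inner_eq_sum_particle (x y : EuclideanSpace ℝ (Fin N × Fin d)) :
    inner ℝ x y = ∑ k, inner ℝ (particle x k) (particle y k) := by
  simp only [PiLp.inner_apply, particle, Fintype.sum_prod_type]

lemma tensorOp_eq {A : Fin N → (L2 (Fin d) →L[ℂ] L2 (Fin d))}
    {T : L2 (Fin N × Fin d) →L[ℂ] L2 (Fin N × Fin d)}
    (hT : ∀ K : Fin N → basisIndex (L2 (Fin d)), T (tensorVec fun k => basis (L2 (Fin d)) (K k)) =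
      tensorVec fun k => A k (basis (L2 (Fin d)) (K k))) (Ψ : L2 (Fin N × Fin d)) :
    tensorOp A Ψ = T Ψ := by
  have h := ((tensorBasis (basis (L2 (Fin d)))).hasSum_repr Ψ).mapL T
  rw [← h.tsum_eq, tensorOp]
  refine tsum_congr fun K => ?_
  rw [HilbertBasis.repr_apply_apply, tensorBasis_apply, map_smul, hT]

lemma weylOp_tensorVec (Ξ H : Fin N → EuclideanSpace ℝ (Fin d)) (u : Fin N → L2 (Fin d)) :
    weylOp hbar (join Ξ) (join H) (tensorVec u) =
      tensorVec fun k => weylOp hbar (Ξ k) (H k) (u k) := by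
  apply Lp.ext
  have h0 := (measurePreserving_sub_right (volume : Measure (EuclideanSpace ℝ (Fin N × Fin d)))
    (hbar • join H)).quasiMeasurePreserving.ae_eq_comp (coeFn_tensorVec u)
  filter_upwards [coeFn_weylOp (hbar := hbar) (join Ξ) (join H) (tensorVec u), h0,
    coeFn_tensorVec fun k => weylOp hbar (Ξ k) (H k) (u k),
    ae_particle fun k => coeFn_weylOp (hbar := hbar) (Ξ k) (H k) (u k)] with x h1 h2 h3 h4
  simp only [Function.comp_apply] at h2
  rw [h1, h2, h3]
  simp_rw [h4]
  rw [Finset.prod_mul_distrib]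
  congr 1
  simp only [planeWave]
  rw [← Complex.exp_sum, ← Finset.mul_sum, inner_eq_sum_particle]
  push_cast
  rfl

lemma tensorOp_weylOp (Ξ H : Fin N → EuclideanSpace ℝ (Fin d)) (Ψ : L2 (Fin N × Fin d)) :
    tensorOp (fun k => weylOp hbar (Ξ k) (H k)) Ψ = weylOp hbar (join Ξ) (join H) Ψ :=
  tensorOp_eq (fun _ => weylOp_tensorVec Ξ H _) Ψ

/-- The tensor power of a density operator is a density operator, and the expectations of Weyl
operators in it are the products of the one-particle expectations. -/
theorem exists_tensorPow (N : ℕ) {D : L2 (Fin d) →L[ℂ] L2 (Fin d)} (hD : IsDensityOperator D) :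
    ∃ T : L2 (Fin N × Fin d) →L[ℂ] L2 (Fin N × Fin d), IsDensityOperator T ∧
      (∀ Ψ, tensorPow N D Ψ = T Ψ) ∧
      ∀ (hbar : ℝ) (Ξ H : Fin N → EuclideanSpace ℝ (Fin d)),
        expect T (weylOp hbar (join Ξ) (join H)) = ∏ k, expect D (weylOp hbar (Ξ k) (H k)) := by
  -- The tensor power is `S* S`, with `S` the tensor power of the Hilbert–Schmidt square root `R` of `D`;
  -- `S` is determined by its values on the product basis, where it is square summable.
  obtain ⟨R, -, hinner, hR⟩ := hD.exists_sqrt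
  set e := basis (L2 (Fin d)) with he
  have hprod : HasSum (fun K : Fin N → basisIndex (L2 (Fin d)) =>
      ‖tensorVec fun k => R (e (K k))‖ ^ 2) 1 := by
    have hC := Complex.hasSum_ofReal.2 hR
    have h1 := (hasSum_prod_pi (N := N)
      (f := fun _ i => ((‖R (e i)‖ ^ 2 : ℝ) : ℂ)) fun _ => hC.summable.norm).1
    simp only [hC.tsum_eq, Complex.ofReal_one, Finset.prod_const_one] at h1
    rw [← Complex.hasSum_ofReal, Complex.ofReal_one]
    convert h1 using 2 with K
    rw [norm_tensorVec, ← Finset.prod_pow]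
    push_cast
    rfl
  obtain ⟨S, hS⟩ := exists_clm_of_summable_sq (tensorBasis (N := N) e) hprod.summable
  have hS' : ∀ K : Fin N → basisIndex (L2 (Fin d)), S (tensorVec fun k => e (K k)) =
      tensorVec fun k => R (e (K k)) := fun K => by rw [← hS, tensorBasis_apply]
  set T := S.adjoint ∘L S with hTdef
  have hTin : ∀ x y, inner ℂ x (T y) = inner ℂ (S x) (S y) := fun x y => by
    rw [hTdef, ContinuousLinearMap.comp_apply, ContinuousLinearMap.adjoint_inner_right]
  have hT : IsDensityOperator T := by
    refine ⟨ContinuousLinearMap.isPositive_adjoint_comp_self S, ?_⟩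
    have h1 : HasSum (fun K => ‖S (tensorBasis (N := N) e K)‖ ^ 2) 1 := by
      simp_rw [hS]
      exact hprod
    have h2 := Complex.hasSum_ofReal.2 (hasSum_norm_sq_basis _ (basis (L2 (Fin N × Fin d))) h1)
    rw [Complex.ofReal_one] at h2
    refine h2.congr_fun ?_
    intro l
    rw [hTin, inner_self_eq_norm_sq_to_K]
    norm_cast
  have hTe : ∀ K : Fin N → basisIndex (L2 (Fin d)), T (tensorVec fun k => e (K k)) =
      tensorVec fun k => D (e (K k)) := fun K => by
    rw [← sub_eq_zero]
    refine eq_zero_of_inner_tensorVec (inner_tensorVec_eq_zero e fun L => ?_)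
    rw [← inner_conj_symm, inner_sub_right, hTin, hS', hS', inner_tensorVec, inner_tensorVec]
    simp_rw [hinner]
    simp
  refine ⟨T, hT, fun Ψ => tensorOp_eq hTe Ψ, fun hbar Ξ H => ?_⟩
  have h1 := hasSum_expect hT (tensorBasis e) (ContinuousLinearMap.id ℂ _)
    (weylOp hbar (join Ξ) (join H)).adjoint
  have h2 := fun k => hasSum_expect hD e (ContinuousLinearMap.id ℂ _)
    (weylOp hbar (Ξ k) (H k)).adjoint
  simp only [ContinuousLinearMap.adjoint_adjoint, ContinuousLinearMap.id_comp,
    ContinuousLinearMap.id_apply, ContinuousLinearMap.adjoint_inner_left, tensorBasis_apply, hTe,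
    weylOp_tensorVec, inner_tensorVec] at h1 h2
  have h3 := (hasSum_prod_pi fun k => (h2 k).summable.norm).1
  rw [h1.unique h3]
  exact Finset.prod_congr rfl fun k _ => (h2 k).tsum_eq

/-- The expectation of a Weyl operator on the `N`-particle space, in terms of the phase space
variables of the particles. -/
def manyExpect (hbar : ℝ) (D : L2 (Fin N × Fin d) →L[ℂ] L2 (Fin N × Fin d))
    (Ξ H : Fin N → EuclideanSpace ℝ (Fin d)) : ℂ :=
  expect D (weylOp hbar (join Ξ) (join H))

/-- Extension by zero of a family indexed by the first `j` particles. -/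
def extendZero {j : ℕ} (N : ℕ) (X : Fin j → EuclideanSpace ℝ (Fin d)) (k : Fin N) :
    EuclideanSpace ℝ (Fin d) :=
  if h : (k : ℕ) < j then X ⟨k, h⟩ else 0

/-- The transform of a marginal is the `N`-particle transform with the phase space variables of the
other particles set to `0`, since the Weyl operator at the origin is the identity. -/
lemma IsMarginal.manyExpect_eq {j : ℕ} {D : L2 (Fin N × Fin d) →L[ℂ] L2 (Fin N × Fin d)}
    {Dj : L2 (Fin j × Fin d) →L[ℂ] L2 (Fin j × Fin d)} (h : IsMarginal D Dj)
    (hD : IsDensityOperator D) (Ξ H : Fin j → EuclideanSpace ℝ (Fin d)) :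
    manyExpect hbar Dj Ξ H = manyExpect hbar D (extendZero N Ξ) (extendZero N H) := by
  have h1 := h.2 fun k => weylOp hbar (Ξ k) (H k)
  have h2 : (fun k : Fin N => if hk : (k : ℕ) < j then weylOp hbar (Ξ ⟨k, hk⟩) (H ⟨k, hk⟩)
      else ContinuousLinearMap.id ℂ (L2 (Fin d))) =
      fun k : Fin N => weylOp hbar (extendZero N Ξ k) (extendZero N H k) := by
    ext1 k
    by_cases hk : (k : ℕ) < j
    · simp only [extendZero, dif_pos hk]
    · simp only [extendZero, dif_neg hk, weylOp_zero]
  rw [h2] at h1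
  simp_rw [tensorOp_weylOp] at h1
  rw [trace_comp_eq_expect hD, trace_comp_eq_expect h.1] at h1
  exact h1.symm

lemma wignerFourier_eq_expect {ι : Type} [Fintype ι] {D : L2 ι →L[ℂ] L2 ι}
    (hD : IsDensityOperator D) (ξ η : EuclideanSpace ℝ ι) :
    wignerFourier hbar D ξ η = expect D (weylOp hbar ξ η) := by
  simp_rw [wignerFourier, weyl_eq_weylOp]
  exact trace_comp_eq_expect hD _

lemma wignerFourier_sub {ι : Type} [Fintype ι] {D T : L2 ι →L[ℂ] L2 ι}
    (hD : IsDensityOperator D) (hT : IsDensityOperator T) (ξ η : EuclideanSpace ℝ ι) :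
    wignerFourier hbar (fun u => D u - T u) ξ η =
      expect D (weylOp hbar ξ η) - expect T (weylOp hbar ξ η) := by
  simp_rw [wignerFourier, weyl_eq_weylOp, trace, inner_sub_right]
  have h1 := hasSum_expect hD (basis (L2 ι)) (weylOp hbar ξ η) (ContinuousLinearMap.id ℂ _)
  have h2 := hasSum_expect hT (basis (L2 ι)) (weylOp hbar ξ η) (ContinuousLinearMap.id ℂ _)
  rw [ContinuousLinearMap.adjoint_id, ContinuousLinearMap.comp_id] at h1 h2
  exact (h1.sub h2).tsum_eq

end TensorOp

/-! ### The commutator in Fourier variables -/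

section Fourier

set_option linter.unusedSectionVars false

variable {ι : Type} [Fintype ι] {hbar : ℝ} {D : L2 ι →L[ℂ] L2 ι}

/-- The factor `-(2/ħ) sin(ħ θ·η / 2)` produced by commuting a plane wave of frequency `θ` with a
Weyl operator. -/
def sinFactor (hbar : ℝ) (θ η : EuclideanSpace ℝ ι) : ℝ :=
  -(2 / hbar) * Real.sin (hbar * inner ℝ θ η / 2)

lemma abs_sinFactor_le (hb : 0 < hbar) (θ η : EuclideanSpace ℝ ι) :
    |sinFactor hbar θ η| ≤ ‖θ‖ * ‖η‖ := by
  have h1 := Real.abs_sin_le_abs (x := hbar * inner ℝ θ η / 2)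
  have h2 := abs_real_inner_le_norm θ η
  rw [sinFactor, abs_mul, abs_neg, abs_of_pos (by positivity : 0 < 2 / hbar)]
  rw [abs_div, abs_mul, abs_of_pos hb, abs_of_pos (zero_lt_two' ℝ)] at h1
  calc 2 / hbar * |Real.sin (hbar * inner ℝ θ η / 2)|
      ≤ 2 / hbar * (hbar * |inner ℝ θ η| / 2) := by gcongr
    _ = |inner ℝ θ η| := by field_simp
    _ ≤ _ := h2

@[simp] lemma sinFactor_zero (θ : EuclideanSpace ℝ ι) : sinFactor hbar θ 0 = 0 := by
  simp [sinFactor]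

lemma continuous_sinFactor (η : EuclideanSpace ℝ ι) :
    Continuous fun θ => sinFactor hbar θ η := by
  unfold sinFactor
  fun_prop

lemma planeWave_zero_sub (θ η y : EuclideanSpace ℝ ι) :
    planeWave θ 0 (y - hbar • η) - planeWave θ 0 y =
      (-2 * Complex.I * Real.sin (hbar * inner ℝ θ η / 2)) * planeWave θ ((hbar / 2) • η) y := by
  simp only [planeWave, sub_zero, inner_sub_right, inner_smul_right]
  set x := inner ℝ θ y
  set z := inner ℝ θ η
  have h1 : Complex.I * ((x - hbar * z : ℝ) : ℂ) =
      Complex.I * ((x - hbar / 2 * z : ℝ) : ℂ) + -((hbar * z / 2 : ℝ) : ℂ) * Complex.I := by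
    push_cast; ring
  have h2 : Complex.I * ((x : ℝ) : ℂ) =
      Complex.I * ((x - hbar / 2 * z : ℝ) : ℂ) + ((hbar * z / 2 : ℝ) : ℂ) * Complex.I := by
    push_cast; ring
  rw [h1, h2, Complex.exp_add, Complex.exp_add, Complex.ofReal_sin, Complex.sin]
  linear_combination (Complex.exp (Complex.I * ((x - hbar / 2 * z : ℝ) : ℂ))) *
    (Complex.exp (-((hbar * z / 2 : ℝ) : ℂ) * Complex.I) -
      Complex.exp (((hbar * z / 2 : ℝ) : ℂ) * Complex.I)) * Complex.I_mul_I

lemma continuous_expect_weylOp (hD : IsDensityOperator D) (η : EuclideanSpace ℝ ι) :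
    Continuous fun ξ => expect D (weylOp hbar ξ η) := by
  refine continuous_tsum (fun l => continuous_inner_weylOp η _ _)
    (hasSum_mixture hD).summable fun l ξ => ?_
  refine (norm_inner_mixture_le _ l).trans ?_
  exact mul_le_of_le_one_left (sq_nonneg _) (norm_weylOp_le _ _)

lemma norm_expect_weylOp_le (hD : IsDensityOperator D) (ξ η : EuclideanSpace ℝ ι) :
    ‖expect D (weylOp hbar ξ η)‖ ≤ 1 :=
  (norm_expect_le hD _).trans (norm_weylOp_le _ _)

/-- The rate of change produced by a superposition of plane waves. -/
lemma weylRate_eq_integral (hb : hbar ≠ 0) (hD : IsDensityOperator D)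
    {X : Type*} [TopologicalSpace X] [MeasurableSpace X] [OpensMeasurableSpace X]
    [SecondCountableTopology X] {μ : Measure X} [SFinite μ] {c : X → ℂ} (hc : Integrable c μ)
    {Θ : X → EuclideanSpace ℝ ι} (hΘ : Continuous Θ) {W : EuclideanSpace ℝ ι → ℝ}
    (hWb : IsBoundedSymbol fun y => (W y : ℂ))
    (hW : ∀ y, (W y : ℂ) = ∫ x, c x * planeWave (Θ x) 0 y ∂μ) (ξ η : EuclideanSpace ℝ ι) :
    weylRate hbar W D ξ η =
      ∫ x, c x * sinFactor hbar (Θ x) η * expect D (weylOp hbar (ξ + Θ x) η) ∂μ := by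
  set s : X → ℂ := fun x => -2 * Complex.I * Real.sin (hbar * inner ℝ (Θ x) η / 2) with hs
  have hsc : Continuous s := by fun_prop
  have hs2 : ∀ x, ‖s x‖ ≤ 2 := fun x => by
    simp only [hs, norm_mul, norm_neg, Complex.norm_I, Complex.norm_real, mul_one,
      Complex.norm_ofNat, Real.norm_eq_abs]
    linarith [Real.abs_sin_le_one (hbar * inner ℝ (Θ x) η / 2)]
  have hcs : Integrable (fun x => c x * s x) μ :=
    hc.mul_bdd (c := 2) hsc.aestronglyMeasurable (ae_of_all _ hs2)
  have hcont : Continuous (Function.uncurry fun x y => planeWave (Θ x) ((hbar / 2) • η) y) := by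
    unfold planeWave Function.uncurry
    fun_prop
  have hint : ∀ y, Integrable (fun x => c x * planeWave (Θ x) 0 y) μ := fun y => by
    refine hc.mul_bdd (c := 1) ?_ (ae_of_all _ fun x => (norm_planeWave _ _ _).le)
    refine Continuous.aestronglyMeasurable ?_
    unfold planeWave
    fun_prop
  have hsym : ∀ y, (W (y - hbar • η) : ℂ) - (W y : ℂ) =
      ∫ x, (c x * s x) * planeWave (Θ x) ((hbar / 2) • η) y ∂μ := fun y => by
    rw [hW, hW, ← integral_sub (hint _) (hint _)]
    refine integral_congr_ae (ae_of_all _ fun x => ?_)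
    simp only
    rw [← mul_sub, planeWave_zero_sub]
    simp only [hs]
    ring
  have hexp := expect_integral hD (μ := μ)
    (B := fun x => (c x * s x) • weylOp hbar (ξ + Θ x) η)
    (A := mulOp (fun y => (W (y - hbar • η) : ℂ) - (W y : ℂ)) ∘L weylOp hbar ξ η)
    hcs.norm (fun x => ?_) (fun u => ?_) (fun u => ?_)
  · rw [weylRate, hexp, ← integral_div]
    refine integral_congr_ae (ae_of_all _ fun x => ?_)
    simp only [expect_smul, hs, sinFactor]
    have hbc : (hbar : ℂ) ≠ 0 := by exact_mod_cast hb
    have hI := Complex.I_ne_zero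
    push_cast
    field_simp
  · rw [norm_smul]
    exact mul_le_of_le_one_right (norm_nonneg _) (norm_weylOp_le _ _)
  · simp only [smul_apply, inner_smul_right]
    exact hcs.1.mul ((continuous_inner_weylOp η u u).comp
      (continuous_const.add hΘ)).aestronglyMeasurable
  · rw [ContinuousLinearMap.comp_apply, inner_mulOp_integral hcs hcont.measurable
      (fun x y => (norm_planeWave _ _ _).le) ((hWb.comp_sub _).sub hWb) hsym]
    refine integral_congr_ae (ae_of_all _ fun x => ?_)
    simp only [smul_apply, inner_smul_right]
    rw [← mulOp_planeWave_comp_weylOp, ContinuousLinearMap.comp_apply]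

lemma weylRate_sum {κ : Type*} (hD : IsDensityOperator D) (S : Finset κ)
    {W : κ → EuclideanSpace ℝ ι → ℝ} (hW : ∀ k, IsBoundedSymbol fun y => (W k y : ℂ)) (r : ℝ)
    (ξ η : EuclideanSpace ℝ ι) :
    weylRate hbar (fun y => r * ∑ k ∈ S, W k y) D ξ η =
      r * ∑ k ∈ S, weylRate hbar (W k) D ξ η := by
  have hsymb : IsBoundedSymbol fun y => ((r * ∑ k ∈ S, W k y : ℝ) : ℂ) := by
    choose K hK using fun k => (hW k).2
    have hm : Measurable fun y => ((r * ∑ k ∈ S, W k y : ℝ) : ℂ) := by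
      push_cast
      exact measurable_const.mul (Finset.measurable_sum _ fun k _ => (hW k).1)
    refine ⟨hm, |r| * ∑ k ∈ S, K k, fun y => ?_⟩
    push_cast
    rw [norm_mul, Complex.norm_real, Real.norm_eq_abs]
    gcongr
    exact (norm_sum_le _ _).trans (Finset.sum_le_sum fun k _ => hK k y)
  have hop : mulOp (fun y => ((r * ∑ k ∈ S, W k (y - hbar • η) : ℝ) : ℂ) -
      ((r * ∑ k ∈ S, W k y : ℝ) : ℂ)) ∘L weylOp hbar ξ η =
      (r : ℂ) • ∑ k ∈ S, mulOp (fun y => (W k (y - hbar • η) : ℂ) - (W k y : ℂ)) ∘L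
        weylOp hbar ξ η := by
    ext1 u
    apply Lp.ext
    set v := weylOp hbar ξ η u
    have hsum : ((∑ k ∈ S, mulOp (fun y => (W k (y - hbar • η) : ℂ) - (W k y : ℂ)) ∘L
        weylOp hbar ξ η) u : L2 ι) =
        ∑ k ∈ S, mulOp (fun y => (W k (y - hbar • η) : ℂ) - (W k y : ℂ)) v := by
      rw [sum_apply]
      rfl
    have hall : ∀ᵐ y, ∀ k ∈ S, mulOp (fun y => (W k (y - hbar • η) : ℂ) - (W k y : ℂ)) v y =
        ((W k (y - hbar • η) : ℂ) - (W k y : ℂ)) * v y := by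
      rw [Filter.eventually_all_finset]
      exact fun k _ => coeFn_mulOp (((hW k).comp_sub _).sub (hW k)) v
    rw [smul_apply, hsum]
    filter_upwards [coeFn_mulOp ((hsymb.comp_sub (hbar • η)).sub hsymb) v,
      Lp.coeFn_smul (r : ℂ) (∑ k ∈ S, mulOp (fun y => (W k (y - hbar • η) : ℂ) - (W k y : ℂ)) v),
      hall, Lp.coeFn_fun_finsetSum S
        (fun k => mulOp (fun y => (W k (y - hbar • η) : ℂ) - (W k y : ℂ)) v)] with y h1 h2 h3 h4
    rw [ContinuousLinearMap.comp_apply, h1, h2, Pi.smul_apply, h4, Finset.sum_congr rfl h3,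
      ← Finset.sum_mul, Finset.sum_sub_distrib, smul_eq_mul]
    push_cast
    ring
  rw [weylRate, hop, expect_smul, expect_sum hD, mul_div_assoc, Finset.sum_div]
  rfl

end Fourier

/-! ### The Hartree and `N`-body equations in Fourier variables -/

section Rates

set_option linter.unusedSectionVars false

variable {N d : ℕ} {hbar : ℝ} {Φ : EuclideanSpace ℝ (Fin d) → ℝ}
  {Φhat : EuclideanSpace ℝ (Fin d) → ℂ}

lemma HasFourierTransform.eq_planeWave (hΦ : HasFourierTransform Φ Φhat)
    (x : EuclideanSpace ℝ (Fin d)) : (Φ x : ℂ) = ∫ h, Φhat h * planeWave h 0 x := by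
  rw [hΦ.2]
  simp only [planeWave, sub_zero]

lemma continuous_integral_planeWave {ι κ : Type} [Fintype ι] [Fintype κ]
    {c : EuclideanSpace ℝ κ → ℂ} (hc : Integrable c)
    {Θ : EuclideanSpace ℝ κ → EuclideanSpace ℝ ι} (hΘ : Continuous Θ) :
    Continuous fun y => ∫ h, c h * planeWave (Θ h) 0 y := by
  refine continuous_of_dominated (fun y => ?_) (fun y => ae_of_all _ fun h => ?_) hc.norm
    (ae_of_all _ fun h => ?_)
  · refine hc.1.mul (Continuous.aestronglyMeasurable ?_)
    unfold planeWave
    fun_prop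
  · rw [norm_mul, norm_planeWave, mul_one]
  · exact continuous_const.mul (continuous_planeWave _ _)

/-- A real function which is a superposition of plane waves is a bounded symbol. -/
lemma isBoundedSymbol_of_integral {ι κ : Type} [Fintype ι] [Fintype κ]
    {c : EuclideanSpace ℝ κ → ℂ} (hc : Integrable c)
    {Θ : EuclideanSpace ℝ κ → EuclideanSpace ℝ ι} (hΘ : Continuous Θ)
    {W : EuclideanSpace ℝ ι → ℝ} (hW : ∀ y, (W y : ℂ) = ∫ h, c h * planeWave (Θ h) 0 y) :
    IsBoundedSymbol (fun y => (W y : ℂ)) ∧ Measurable W ∧ ∀ y, |W y| ≤ ∫ h, ‖c h‖ := by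
  have hcont : Continuous fun y => (W y : ℂ) := by
    simp_rw [hW]
    exact continuous_integral_planeWave hc hΘ
  have hle : ∀ y, ‖(W y : ℂ)‖ ≤ ∫ h, ‖c h‖ := fun y => by
    rw [hW]
    refine norm_integral_le_of_norm_le hc.norm (ae_of_all _ fun h => ?_)
    rw [norm_mul, norm_planeWave, mul_one]
  refine ⟨⟨hcont.measurable, _, hle⟩, ?_, fun y => by simpa using hle y⟩
  have := (Complex.continuous_re.comp hcont).measurable
  simpa [Function.comp_def] using this

/-- The self-consistent potential of the Hartree equation in Fourier variables. -/
lemma convolution_eq_integral (hΦ : HasFourierTransform Φ Φhat)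
    {D : L2 (Fin d) →L[ℂ] L2 (Fin d)} (hD : IsDensityOperator D)
    {ρ : EuclideanSpace ℝ (Fin d) → ℝ} (hρ : IsPositionDensity D ρ)
    (x : EuclideanSpace ℝ (Fin d)) :
    ((∫ y, Φ (x - y) * ρ y : ℝ) : ℂ) =
      ∫ h, Φhat h * expect D (weylOp hbar (-h) 0) * planeWave h 0 x := by
  have hexp : ∀ h : EuclideanSpace ℝ (Fin d), expect D (weylOp hbar (-h) 0) =
      ∫ y, planeWave (-h) 0 y * (ρ y : ℂ) := fun h => by
    rw [← hρ.2 (planeWave (-h) 0) (continuous_planeWave _ _).measurable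
      ⟨1, fun y => (norm_planeWave _ _ _).le⟩, ← trace_comp_eq_expect' hD]
    congr 1
    ext1 u
    have h1 := mulOp_planeWave_comp_weylOp (hbar := hbar) (-h) (0 : EuclideanSpace ℝ (Fin d)) 0
    rw [zero_add, weylOp_zero, ContinuousLinearMap.comp_id, smul_zero] at h1
    rw [← h1, mulOp_apply (isBoundedSymbol_planeWave _ _)]
  have hsplit : ∀ h y : EuclideanSpace ℝ (Fin d),
      planeWave h 0 (x - y) = planeWave (-h) 0 y * planeWave h 0 x := fun h y => by
    simp only [planeWave, sub_zero, ← Complex.exp_add, inner_sub_right, inner_neg_left]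
    congr 1
    push_cast
    ring
  have hint : Integrable (fun q : EuclideanSpace ℝ (Fin d) × EuclideanSpace ℝ (Fin d) =>
      Φhat q.2 * planeWave q.2 0 (x - q.1) * (ρ q.1 : ℂ)) (volume.prod volume) := by
    have h1 : Integrable (fun q : EuclideanSpace ℝ (Fin d) × EuclideanSpace ℝ (Fin d) =>
      (ρ q.1 : ℂ) * Φhat q.2) (volume.prod volume) := hρ.1.ofReal.mul_prod hΦ.1
    have h2 := h1.bdd_mul (c := 1) (f := fun q : EuclideanSpace ℝ (Fin d) ×
      EuclideanSpace ℝ (Fin d) => planeWave q.2 0 (x - q.1)) (Continuous.aestronglyMeasurable (by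
        unfold planeWave; fun_prop)) (ae_of_all _ fun q => (norm_planeWave _ _ _).le)
    refine h2.congr (ae_of_all _ fun q => ?_)
    simp only
    ring
  calc ((∫ y, Φ (x - y) * ρ y : ℝ) : ℂ) = ∫ y, (Φ (x - y) : ℂ) * (ρ y : ℂ) := by
        rw [← integral_complex_ofReal]
        push_cast
        rfl
    _ = ∫ y, ∫ h, Φhat h * planeWave h 0 (x - y) * (ρ y : ℂ) := by
        simp_rw [hΦ.eq_planeWave, integral_mul_const]
    _ = ∫ h, ∫ y, Φhat h * planeWave h 0 (x - y) * (ρ y : ℂ) := integral_integral_swap hint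
    _ = _ := by
        refine integral_congr_ae (ae_of_all _ fun h => ?_)
        simp only
        rw [hexp, ← integral_const_mul, ← integral_mul_const]
        refine integral_congr_ae (ae_of_all _ fun y => ?_)
        simp only
        rw [hsplit]
        ring

/-- The rate of change of the Wigner transform along free trajectories for the Hartree
equation. -/
def hartreeRate (hbar : ℝ) (Φhat : EuclideanSpace ℝ (Fin d) → ℂ)
    (D : L2 (Fin d) →L[ℂ] L2 (Fin d)) (ξ η : EuclideanSpace ℝ (Fin d)) : ℂ :=
  ∫ h, Φhat h * expect D (weylOp hbar (-h) 0) * sinFactor hbar h η *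
    expect D (weylOp hbar (ξ + h) η)

lemma integrable_mul_expect (hΦ : HasFourierTransform Φ Φhat)
    {D : L2 (Fin d) →L[ℂ] L2 (Fin d)} (hD : IsDensityOperator D) :
    Integrable fun h => Φhat h * expect D (weylOp hbar (-h) 0) :=
  hΦ.1.mul_bdd (c := 1) ((continuous_expect_weylOp hD 0).comp continuous_neg).aestronglyMeasurable
    (ae_of_all _ fun _ => norm_expect_weylOp_le hD _ _)

/-- Hartree's equation for the Wigner transform, integrated along free trajectories. -/
theorem hartree_integral (hb : hbar ≠ 0) (hΦ : HasFourierTransform Φ Φhat)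
    {F : ℝ → L2 (Fin d) →L[ℂ] L2 (Fin d)} (hF : IsHartreeSolution hbar Φ F) :
    (∀ t, IsDensityOperator (F t)) ∧ ∃ K, ∀ ξ η : EuclideanSpace ℝ (Fin d),
      (∀ s, ‖hartreeRate hbar Φhat (F s) ξ (η + s • ξ)‖ ≤ K) ∧
      (∀ t, IntervalIntegrable (fun s => hartreeRate hbar Φhat (F s) ξ (η + s • ξ)) volume 0 t) ∧
      ∀ t, expect (F t) (weylOp hbar ξ (η + t • ξ)) = expect (F 0) (weylOp hbar ξ η) +
        ∫ s in (0 : ℝ)..t, hartreeRate hbar Φhat (F s) ξ (η + s • ξ) := by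
  obtain ⟨ρ, hρ, hsol⟩ := hF
  set V : ℝ → EuclideanSpace ℝ (Fin d) → ℝ := fun t x => ∫ y, Φ (x - y) * ρ t y with hV
  have hc := fun s => integrable_mul_expect (hbar := hbar) hΦ (hsol.density s)
  have hVs := fun s => isBoundedSymbol_of_integral (hc s) continuous_id
    (fun x => convolution_eq_integral (hbar := hbar) hΦ (hsol.density s) (hρ s) x)
  have hVb : IsBoundedPotential V (∫ h, ‖Φhat h‖) := by
    refine ⟨integral_nonneg fun _ => norm_nonneg _, fun s => (hVs s).2.1, fun s x => ?_⟩
    refine ((hVs s).2.2 x).trans (integral_mono (hc s).norm hΦ.1.norm fun h => ?_)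
    simp only [norm_mul]
    exact mul_le_of_le_one_right (norm_nonneg _) (norm_expect_weylOp_le (hsol.density s) _ _)
  have hrate : ∀ s ξ η, weylRate hbar (V s) (F s) ξ η = hartreeRate hbar Φhat (F s) ξ η :=
    fun s ξ η => weylRate_eq_integral hb (hsol.density s) (hc s) continuous_id (hVs s).1
      (fun x => convolution_eq_integral hΦ (hsol.density s) (hρ s) x) ξ η
  refine ⟨hsol.density, 2 * (∫ h, ‖Φhat h‖) / |hbar|, fun ξ η => ⟨fun s => ?_, ?_⟩⟩
  · rw [← hrate, weylRate, norm_div, norm_mul, Complex.norm_I, one_mul, Complex.norm_real,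
      Real.norm_eq_abs]
    gcongr
    refine (norm_expect_le (hsol.density s) _).trans
      ((ContinuousLinearMap.opNorm_comp_le _ _).trans ?_)
    have h1 := (((hVb.symbol s).comp_sub (hbar • (η + s • ξ))).sub (hVb.symbol s)).1
    have h2 := norm_mulOp_le h1 (M := 2 * ∫ h, ‖Φhat h‖) (by have := hVb.nonneg; positivity)
      fun y => by
        refine (norm_sub_le _ _).trans ?_
        rw [Complex.norm_real, Complex.norm_real, Real.norm_eq_abs, Real.norm_eq_abs]
        linarith [hVb.bound s y, hVb.bound s (y - hbar • (η + s • ξ))]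
    refine (mul_le_of_le_one_right (norm_nonneg _) (norm_weylOp_le _ _)).trans h2
  · have h1 := expect_weylOp_integral hb hVb hsol ξ η
    simp_rw [hrate] at h1
    exact h1

/-- The contribution of the interaction of the particles `k` and `l` to the rate of change of the
`N`-particle Wigner transform, apart from the coupling constant. -/
def pairRate (hbar : ℝ) (Φhat : EuclideanSpace ℝ (Fin d) → ℂ)
    (g : (Fin N → EuclideanSpace ℝ (Fin d)) → (Fin N → EuclideanSpace ℝ (Fin d)) → ℂ)
    (Ξ H : Fin N → EuclideanSpace ℝ (Fin d)) (k l : Fin N) : ℂ :=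
  ∫ h, Φhat h * sinFactor hbar h (H k - H l) * g (Ξ + Pi.single k h - Pi.single l h) H

lemma inner_join_single (k : Fin N) (h : EuclideanSpace ℝ (Fin d))
    (y : EuclideanSpace ℝ (Fin N × Fin d)) :
    inner ℝ (join (Pi.single k h)) y = inner ℝ h (particle y k) := by
  classical
  rw [inner_eq_sum_particle, Finset.sum_eq_single k]
  · simp
  · intro l _ hl
    simp [Pi.single_eq_of_ne hl]
  · simp

lemma continuous_join : Continuous (join : (Fin N → EuclideanSpace ℝ (Fin d)) → _) := by
  unfold join
  fun_prop

lemma continuous_single' (k : Fin N) : Continuous fun h : EuclideanSpace ℝ (Fin d) =>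
    (Pi.single k h : Fin N → EuclideanSpace ℝ (Fin d)) := by
  refine continuous_pi fun l => ?_
  rcases eq_or_ne l k with rfl | hl
  · simpa using continuous_id'
  · simpa [Pi.single_eq_of_ne hl] using continuous_const

/-- The frequency shift due to the interaction of the particles `k` and `l`. -/
def pairShift (k l : Fin N) (h : EuclideanSpace ℝ (Fin d)) : EuclideanSpace ℝ (Fin N × Fin d) :=
  join (Pi.single k h) - join (Pi.single l h)

lemma continuous_pairShift (k l : Fin N) : Continuous (pairShift (d := d) k l) :=
  (continuous_join.comp (continuous_single' k)).sub (continuous_join.comp (continuous_single' l))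

lemma inner_pairShift (k l : Fin N) (h : EuclideanSpace ℝ (Fin d))
    (y : EuclideanSpace ℝ (Fin N × Fin d)) :
    inner ℝ (pairShift k l h) y = inner ℝ h (particle y k - particle y l) := by
  rw [pairShift, inner_sub_left, inner_join_single, inner_join_single, inner_sub_right]

lemma pairPotential_eq (hΦ : HasFourierTransform Φ Φhat) (k l : Fin N)
    (y : EuclideanSpace ℝ (Fin N × Fin d)) :
    (Φ (particle y k - particle y l) : ℂ) = ∫ h, Φhat h * planeWave (pairShift k l h) 0 y := by
  rw [hΦ.eq_planeWave]
  simp only [planeWave, sub_zero, inner_pairShift]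

lemma weylRate_pair (hb : hbar ≠ 0) (hΦ : HasFourierTransform Φ Φhat)
    {D : L2 (Fin N × Fin d) →L[ℂ] L2 (Fin N × Fin d)} (hD : IsDensityOperator D) (k l : Fin N)
    (Ξ H : Fin N → EuclideanSpace ℝ (Fin d)) :
    weylRate hbar (fun y => Φ (particle y k - particle y l)) D (join Ξ) (join H) =
      pairRate hbar Φhat (manyExpect hbar D) Ξ H k l := by
  rw [weylRate_eq_integral hb hD hΦ.1 (continuous_pairShift k l)
    (isBoundedSymbol_of_integral hΦ.1 (continuous_pairShift k l) (pairPotential_eq hΦ k l)).1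
    (pairPotential_eq hΦ k l)]
  refine integral_congr_ae (ae_of_all _ fun h => ?_)
  simp only [sinFactor, inner_pairShift, particle_join, manyExpect]
  congr 4
  change join Ξ + (join (Pi.single k h) - join (Pi.single l h)) =
    join Ξ + join (Pi.single k h) - join (Pi.single l h)
  abel

/-- The `N`-body von Neumann equation for the Wigner transform, integrated along free
trajectories. -/
theorem nBody_integral (hb : hbar ≠ 0) (hΦ : HasFourierTransform Φ Φhat)
    {D : ℝ → L2 (Fin N × Fin d) →L[ℂ] L2 (Fin N × Fin d)} (hD : IsNBodySolution hbar Φ N D)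
    (Ξ H : Fin N → EuclideanSpace ℝ (Fin d)) :
    (∀ t, IntervalIntegrable (fun s : ℝ => ((1 / (2 * (N : ℝ)) : ℝ) : ℂ) * ∑ p : Fin N × Fin N,
      pairRate hbar Φhat (manyExpect hbar (D s)) Ξ (H + s • Ξ) p.1 p.2) volume 0 t) ∧
    ∀ t : ℝ, manyExpect hbar (D t) Ξ (H + t • Ξ) = manyExpect hbar (D 0) Ξ H +
      ∫ s in (0 : ℝ)..t, ((1 / (2 * (N : ℝ)) : ℝ) : ℂ) * ∑ p : Fin N × Fin N,
        pairRate hbar Φhat (manyExpect hbar (D s)) Ξ (H + s • Ξ) p.1 p.2 := by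
  have hpair := fun p : Fin N × Fin N => isBoundedSymbol_of_integral hΦ.1
    (continuous_pairShift p.1 p.2) (pairPotential_eq hΦ p.1 p.2)
  have hpot : nBodyPotential N Φ = fun y => 1 / (2 * (N : ℝ)) *
      ∑ p : Fin N × Fin N, Φ (particle y p.1 - particle y p.2) := by
    ext y
    rw [nBodyPotential, Fintype.sum_prod_type]
  have hV : IsBoundedPotential (fun _ : ℝ => nBodyPotential N Φ)
      (1 / (2 * (N : ℝ)) * ∑ _p : Fin N × Fin N, ∫ h, ‖Φhat h‖) := by
    have h0 : 0 ≤ ∫ h, ‖Φhat h‖ := integral_nonneg fun _ => norm_nonneg _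
    refine ⟨by positivity, fun _ => ?_, fun _ y => ?_⟩
    · rw [hpot]
      exact measurable_const.mul (Finset.measurable_sum _ fun p _ => (hpair p).2.1)
    · rw [hpot]
      simp only
      rw [abs_mul, abs_of_nonneg (by positivity)]
      gcongr
      exact (Finset.abs_sum_le_sum_abs _ _).trans
        (Finset.sum_le_sum fun p _ => (hpair p).2.2 y)
  have hrate : ∀ (s : ℝ) (Ξ H : Fin N → EuclideanSpace ℝ (Fin d)),
      weylRate hbar (nBodyPotential N Φ) (D s) (join Ξ) (join H) =
      ((1 / (2 * (N : ℝ)) : ℝ) : ℂ) * ∑ p : Fin N × Fin N,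
        pairRate hbar Φhat (manyExpect hbar (D s)) Ξ H p.1 p.2 := fun s Ξ H => by
    rw [hpot, weylRate_sum (hD.density s) _ fun p => (hpair p).1]
    simp_rw [weylRate_pair hb hΦ (hD.density s)]
  have h1 := expect_weylOp_integral hb hV hD (join Ξ) (join H)
  have hjoin : ∀ s : ℝ, join H + s • join Ξ = join (H + s • Ξ) := fun _ => rfl
  simp_rw [hjoin, hrate] at h1
  exact h1

lemma pairRate_symm (hb : hbar ≠ 0) (hΦ : HasFourierTransform Φ Φhat)
    (hΦe : ∀ x, Φ (-x) = Φ x) {D : L2 (Fin N × Fin d) →L[ℂ] L2 (Fin N × Fin d)}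
    (hD : IsDensityOperator D) (Ξ H : Fin N → EuclideanSpace ℝ (Fin d)) (k l : Fin N) :
    pairRate hbar Φhat (manyExpect hbar D) Ξ H k l =
      pairRate hbar Φhat (manyExpect hbar D) Ξ H l k := by
  rw [← weylRate_pair hb hΦ hD, ← weylRate_pair hb hΦ hD]
  congr 1
  ext y
  rw [← hΦe, neg_sub]

/-- The sum over pairs, organized according to a set `J` of particles outside of which the phase
space variables vanish: by the symmetry of the interaction, only pairs inside `J` and pairs with
first member in `J` and second member outside of `J` are left. -/
lemma sum_pairRate (hb : hbar ≠ 0) (hΦ : HasFourierTransform Φ Φhat)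
    (hΦe : ∀ x, Φ (-x) = Φ x) {D : L2 (Fin N × Fin d) →L[ℂ] L2 (Fin N × Fin d)}
    (hD : IsDensityOperator D) {Ξ H : Fin N → EuclideanSpace ℝ (Fin d)} {J : Finset (Fin N)}
    (hH : ∀ k ∉ J, H k = 0) :
    ((1 / (2 * (N : ℝ)) : ℝ) : ℂ) * ∑ p : Fin N × Fin N,
        pairRate hbar Φhat (manyExpect hbar D) Ξ H p.1 p.2 =
      1 / (2 * (N : ℂ)) * ∑ k ∈ J, ∑ l ∈ J, pairRate hbar Φhat (manyExpect hbar D) Ξ H k l +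
      1 / (N : ℂ) * ∑ k ∈ J, ∑ l ∈ Jᶜ, pairRate hbar Φhat (manyExpect hbar D) Ξ H k l := by
  classical
  set G := pairRate hbar Φhat (manyExpect hbar D) Ξ H with hG
  have hsym : ∀ k l, G k l = G l k := pairRate_symm hb hΦ hΦe hD Ξ H
  have hzero : ∀ k ∈ Jᶜ, ∀ l ∈ Jᶜ, G k l = 0 := fun k hk l hl => by
    rw [Finset.mem_compl] at hk hl
    simp [hG, pairRate, hH k hk, hH l hl]
  have h1 : ∑ p : Fin N × Fin N, G p.1 p.2 =
      ∑ k ∈ J, ∑ l ∈ J, G k l + 2 * ∑ k ∈ J, ∑ l ∈ Jᶜ, G k l := by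
    rw [Fintype.sum_prod_type, ← Finset.sum_add_sum_compl J]
    simp_rw [← Finset.sum_add_sum_compl J (fun l => G _ l), Finset.sum_add_distrib]
    rw [Finset.sum_eq_zero (s := Jᶜ) fun k hk => Finset.sum_eq_zero fun l hl => hzero k hk l hl,
      Finset.sum_comm (s := Jᶜ)]
    have : ∑ y ∈ J, ∑ x ∈ Jᶜ, G x y = ∑ k ∈ J, ∑ l ∈ Jᶜ, G k l :=
      Finset.sum_congr rfl fun k _ => Finset.sum_congr rfl fun l _ => hsym l k
    rw [this]
    ring
  rw [h1]
  push_cast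
  rcases eq_or_ne (N : ℂ) 0 with h | h
  · simp [h]
  · field_simp

end Rates

/-! ### Products of functions given by integrals -/

section ProductRule

/-- The product rule for finitely many primitives of bounded integrable functions. -/
lemma prod_eq_add_integral {κ : Type*} [Fintype κ] [DecidableEq κ] {g R : κ → ℝ → ℂ} {K : ℝ}
    (hK : ∀ k s, ‖R k s‖ ≤ K) (hR : ∀ k t, IntervalIntegrable (R k) volume 0 t)
    (hg : ∀ k t, g k t = g k 0 + ∫ s in (0 : ℝ)..t, R k s) :
    (∀ t, IntervalIntegrable (fun s => ∑ k, (∏ l ∈ Finset.univ.erase k, g l s) * R k s)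
      volume 0 t) ∧
    ∀ t, ∏ k, g k t = ∏ k, g k 0 +
      ∫ s in (0 : ℝ)..t, ∑ k, (∏ l ∈ Finset.univ.erase k, g l s) * R k s := by
  have hR' : ∀ k a b, IntervalIntegrable (R k) volume a b := fun k a b =>
    (hR k a).symm.trans (hR k b)
  have hlip : ∀ k, LipschitzWith K.toNNReal (g k) := fun k => by
    refine LipschitzWith.of_dist_le_mul fun a b => ?_
    have h1 : g k a - g k b = ∫ s in b..a, R k s := by
      rw [hg k a, hg k b, add_sub_add_left_eq_sub,
        intervalIntegral.integral_interval_sub_left (hR k a) (hR k b)]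
    rw [dist_eq_norm, h1]
    refine (intervalIntegral.norm_integral_le_of_norm_le_const fun s _ => hK k s).trans ?_
    rw [Real.dist_eq]
    exact mul_le_mul_of_nonneg_right (Real.le_coe_toNNReal K) (abs_nonneg _)
  have hcont : ∀ k, Continuous (g k) := fun k => (hlip k).continuous
  have hint : ∀ a b, IntervalIntegrable
      (fun s => ∑ k, (∏ l ∈ Finset.univ.erase k, g l s) * R k s) volume a b := fun a b => by
    have := IntervalIntegrable.sum (μ := volume) (a := a) (b := b)
      (f := fun k s => (∏ l ∈ Finset.univ.erase k, g l s) * R k s) Finset.univ fun k _ => ?_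
    · simpa only [Finset.sum_fn] using this
    exact (hR' k a b).continuousOn_mul
      (continuous_finsetProd _ fun l _ => hcont l).continuousOn
  refine ⟨hint 0, fun t => ?_⟩
  set S : ℝ → ℂ := fun s => ∑ k, (∏ l ∈ Finset.univ.erase k, g l s) * R k s with hS
  have hSb : ∃ B, ∀ s ∈ Set.uIcc 0 t, ‖S s‖ ≤ B := by
    choose B hB using fun k => isCompact_uIcc.exists_bound_of_continuousOn
      (s := Set.uIcc 0 t) (f := fun s => ∏ l ∈ Finset.univ.erase k, g l s)
      (continuous_finsetProd _ fun l _ => hcont l).continuousOn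
    refine ⟨∑ k, B k * K, fun s hs => (norm_sum_le _ _).trans (Finset.sum_le_sum fun k _ => ?_)⟩
    rw [norm_mul]
    exact mul_le_mul (hB k s hs) (hK k s) (norm_nonneg _) ((norm_nonneg _).trans (hB k s hs))
  obtain ⟨B, hB⟩ := hSb
  have hac1 : AbsolutelyContinuousOnInterval (fun s => ∏ k, g k s) 0 t := by
    have : ∀ T : Finset κ, AbsolutelyContinuousOnInterval (fun s => ∏ k ∈ T, g k s) 0 t := by
      intro T
      induction T using Finset.induction_on with
      | empty =>
        simp only [Finset.prod_empty]
        exact ((LipschitzWith.const (1 : ℂ)).lipschitzOnWith (s := _)).absolutelyContinuousOnInterval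
      | insert k T hk ih =>
        simp_rw [Finset.prod_insert hk]
        exact ((hlip k).lipschitzOnWith (s := _)).absolutelyContinuousOnInterval.fun_smul ih
    exact this _
  have hac2 : AbsolutelyContinuousOnInterval (fun x => ∫ s in (0 : ℝ)..x, S s) 0 t := by
    refine LipschitzOnWith.absolutelyContinuousOnInterval (K := B.toNNReal) ?_
    refine LipschitzOnWith.of_dist_le_mul fun a ha b hb => ?_
    rw [dist_eq_norm, intervalIntegral.integral_interval_sub_left (hint 0 a) (hint 0 b), Real.dist_eq]
    refine (intervalIntegral.norm_integral_le_of_norm_le_const (C := B) fun s hs => ?_).trans ?_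
    · exact hB s (Set.uIcc_subset_uIcc hb ha (Set.uIoc_subset_uIcc hs))
    · exact mul_le_mul_of_nonneg_right (Real.le_coe_toNNReal B) (abs_nonneg _)
  have hder : ∀ᵐ x, x ∈ Set.uIcc 0 t →
      HasDerivAt (fun x => (∏ k, g k x) - ∫ s in (0 : ℝ)..x, S s) 0 x := by
    have hloc : ∀ {f : ℝ → ℂ}, (∀ a b, IntervalIntegrable f volume a b) →
        LocallyIntegrable f volume := fun hf => by
      refine locallyIntegrable_iff.2 fun C hC => ?_
      obtain ⟨r, hr⟩ := hC.isBounded.subset_closedBall 0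
      rw [Real.closedBall_eq_Icc] at hr
      refine IntegrableOn.mono_set ?_ hr
      rcases le_total (0 - r) (0 + r) with h | h
      · exact (intervalIntegrable_iff_integrableOn_Icc_of_le h).1 (hf _ _)
      · rcases h.eq_or_lt with h | h
        · rw [h]; simp
        · rw [Set.Icc_eq_empty (not_le.2 h)]; exact integrableOn_empty
    have h1 : ∀ᵐ x, ∀ k, HasDerivAt (g k) (R k x) x := by
      refine ae_all_iff.2 fun k => ?_
      filter_upwards [LocallyIntegrable.ae_hasDerivAt_integral (hloc (hR' k))] with x hx
      rw [funext (hg k)]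
      exact (hx 0).const_add _
    filter_upwards [h1, LocallyIntegrable.ae_hasDerivAt_integral (hloc hint)] with x hx hx2 _
    have h3 := (HasDerivAt.fun_finsetProd (u := Finset.univ) fun k _ => hx k).sub (hx2 0)
    refine HasDerivAt.congr_deriv h3 ?_
    simp only [smul_eq_mul, sub_self, hS]
  obtain ⟨C, hC⟩ := (hac1.sub hac2).const_of_ae_hasDerivAt_zero hder
  have e1 := hC 0 Set.left_mem_uIcc
  have e2 := hC t Set.right_mem_uIcc
  simp only [Pi.sub_apply, intervalIntegral.integral_same, sub_zero] at e1 e2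
  rw [e1, ← e2]
  ring

end ProductRule

/-! ### Weights and their behaviour along free trajectories -/

section Weights

set_option linter.unusedSectionVars false

variable {N d : ℕ}

/-- The size `∑ₖ |X_k|` of a family of vectors. -/
def size (X : Fin N → EuclideanSpace ℝ (Fin d)) : ℝ := ∑ k, ‖X k‖

lemma size_nonneg (X : Fin N → EuclideanSpace ℝ (Fin d)) : 0 ≤ size X :=
  Finset.sum_nonneg fun _ _ => norm_nonneg _

lemma size_add_le (X Y : Fin N → EuclideanSpace ℝ (Fin d)) : size (X + Y) ≤ size X + size Y := by
  rw [size, size, size, ← Finset.sum_add_distrib]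
  exact Finset.sum_le_sum fun k _ => norm_add_le _ _

lemma size_smul (c : ℝ) (X : Fin N → EuclideanSpace ℝ (Fin d)) : size (c • X) = |c| * size X := by
  rw [size, size, Finset.mul_sum]
  exact Finset.sum_congr rfl fun k _ => by rw [Pi.smul_apply, norm_smul, Real.norm_eq_abs]

lemma size_le_size_add (X Y : Fin N → EuclideanSpace ℝ (Fin d)) :
    size X ≤ size (X + Y) + size Y := by
  have h := size_add_le (X + Y) ((-1 : ℝ) • Y)
  rw [size_smul, abs_neg, abs_one, one_mul] at h
  simpa using h

lemma size_single (k : Fin N) (h : EuclideanSpace ℝ (Fin d)) : size (Pi.single k h) = ‖h‖ := by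
  rw [size, Finset.sum_eq_single k]
  · simp
  · intro l _ hl
    simp [Pi.single_eq_of_ne hl]
  · simp

lemma size_pair_le (k l : Fin N) (h : EuclideanSpace ℝ (Fin d)) :
    size (Pi.single k h + (-1 : ℝ) • (Pi.single l h : Fin N → EuclideanSpace ℝ (Fin d))) ≤ 2 * ‖h‖ := by
  refine (size_add_le _ _).trans ?_
  rw [size_smul, size_single, size_single, abs_neg, abs_one]
  linarith

/-- The weight `exp((β' s - c)|Ξ| + (κ s - c)|H|)`. Only `c = β'`, which gives exponential decay,
and `c = 0`, where the weight is at least `1`, are used. -/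
def weight (β' κ c s : ℝ) (Ξ H : Fin N → EuclideanSpace ℝ (Fin d)) : ℝ :=
  Real.exp ((β' * s - c) * size Ξ + (κ * s - c) * size H)

lemma weight_pos (β' κ c s : ℝ) (Ξ H : Fin N → EuclideanSpace ℝ (Fin d)) :
    0 < weight β' κ c s Ξ H := Real.exp_pos _

lemma one_le_weight {β' κ s : ℝ} (hβ : 0 ≤ β') (hκ : 0 ≤ κ) (hs : 0 ≤ s)
    (Ξ H : Fin N → EuclideanSpace ℝ (Fin d)) : 1 ≤ weight β' κ 0 s Ξ H := by
  refine Real.one_le_exp ?_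
  have := size_nonneg Ξ
  have := size_nonneg H
  simp only [sub_zero]
  positivity

variable {β' κ c r s σ : ℝ}

/-- The exponent of the weight increases along free trajectories, at a rate which controls the
momentum variable. -/
lemma exponent_le (hκ : 0 ≤ κ) (hr : κ * r ≤ β') (hs : 0 ≤ s) (hsr : s ≤ r)
    (hc : c = β' ∨ c = 0) {L A U : ℝ} (hL : 0 ≤ L) (hA : 0 ≤ A) (hU : 0 ≤ U)
    (h1 : U ≤ A + (r - s) * L) (h2 : A ≤ U + (r - s) * L) :
    (β' * s - c) * L + (κ * s - c) * U ≤ (β' * r - c) * L + (κ * r - c) * A -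
      κ / 2 * (A * (r - s) + L * (r - s) ^ 2) := by
  obtain ⟨ρ, rfl⟩ : ∃ ρ, r = s + ρ := ⟨r - s, by ring⟩
  have hρ : 0 ≤ ρ := by linarith
  simp only [add_sub_cancel_left] at h1 h2 ⊢
  have hκρ : 0 ≤ κ * ρ := mul_nonneg hκ hρ
  have hκs : 0 ≤ κ * s := mul_nonneg hκ hs
  have hhalf : 0 ≤ β' - κ * s - κ * ρ / 2 := by nlinarith
  rcases hc with rfl | rfl
  · have e1 : 0 ≤ (c - κ * s - κ * ρ / 2) * (U + ρ * L - A) := mul_nonneg hhalf (by linarith)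
    have e2 : 0 ≤ κ * ρ / 2 * U := by positivity
    have e3 : 0 ≤ ρ * L * (κ * s) := by positivity
    nlinarith
  · have e1 : 0 ≤ κ * s * (A + ρ * L - U) := mul_nonneg hκs (by linarith)
    have e2 : 0 ≤ (β' - κ * s - κ * ρ / 2) * (ρ * L) := mul_nonneg hhalf (by positivity)
    have e3 : 0 ≤ κ * ρ * A := by positivity
    nlinarith

lemma size_flow (hσ : |σ| = 1) (hsr : s ≤ r) (Ξ H : Fin N → EuclideanSpace ℝ (Fin d)) :
    size (H + (σ * s) • Ξ) ≤ size (H + (σ * r) • Ξ) + (r - s) * size Ξ ∧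
      size (H + (σ * r) • Ξ) ≤ size (H + (σ * s) • Ξ) + (r - s) * size Ξ := by
  have e : H + (σ * r) • Ξ = (H + (σ * s) • Ξ) + (σ * (r - s)) • Ξ := by
    rw [add_assoc, ← add_smul]
    ring_nf
  have hn : |σ * (r - s)| = r - s := by rw [abs_mul, hσ, one_mul, abs_of_nonneg (by linarith)]
  rw [e]
  constructor
  · refine (size_le_size_add _ ((σ * (r - s)) • Ξ)).trans_eq ?_
    rw [size_smul, hn]
  · refine (size_add_le _ _).trans_eq ?_
    rw [size_smul, hn]

lemma weight_flow (hκ : 0 ≤ κ) (hr : κ * r ≤ β') (hσ : |σ| = 1) (hs : 0 ≤ s) (hsr : s ≤ r)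
    (hc : c = β' ∨ c = 0) (Ξ H : Fin N → EuclideanSpace ℝ (Fin d)) :
    weight β' κ c s Ξ (H + (σ * s) • Ξ) ≤
      Real.exp (-(κ / 2 * (size (H + (σ * r) • Ξ) * (r - s) + size Ξ * (r - s) ^ 2))) *
        weight β' κ c r Ξ (H + (σ * r) • Ξ) := by
  rw [weight, weight, ← Real.exp_add, Real.exp_le_exp]
  have h := exponent_le hκ hr hs hsr hc (size_nonneg Ξ) (size_nonneg (H + (σ * r) • Ξ))
    (size_nonneg (H + (σ * s) • Ξ)) (size_flow hσ hsr Ξ H).1 (size_flow hσ hsr Ξ H).2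
  linarith

/-- The decaying weight at time `0`, carried along the free flow, stays below the weight at time `r`. -/
lemma weight_initial_le (hκ : 0 ≤ κ) (hr : κ * r ≤ β') (hσ : |σ| = 1) (hr0 : 0 ≤ r)
    (Ξ H : Fin N → EuclideanSpace ℝ (Fin d)) :
    weight β' κ β' 0 Ξ H ≤ weight β' κ β' r Ξ (H + (σ * r) • Ξ) := by
  have h := weight_flow hκ hr hσ le_rfl hr0 (Or.inl rfl) Ξ H
  rw [mul_zero, zero_smul, add_zero] at h
  refine h.trans (mul_le_of_le_one_left (weight_pos _ _ _ _ _ _).le (Real.exp_le_one_iff.2 ?_))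
  have := size_nonneg Ξ
  have := size_nonneg (H + (σ * r) • Ξ)
  rw [neg_nonpos, sub_zero]
  positivity

/-- The loss of one power of the momentum variable in the rate of change is recovered by the time
integration, thanks to the growth of the weight along free trajectories. -/
lemma norm_integral_flow_le (hκ : 0 < κ) (hr : κ * r ≤ β') (hσ : |σ| = 1) (hr0 : 0 ≤ r)
    {B₁ B₂ : ℝ} (hB₁ : 0 ≤ B₁) (hB₂ : 0 ≤ B₂) (Ξ H : Fin N → EuclideanSpace ℝ (Fin d))
    {R : ℝ → ℂ} (hR : ∀ s, 0 ≤ s → s ≤ r → ‖R (σ * s)‖ ≤ size (H + (σ * s) • Ξ) *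
      (B₁ * weight β' κ β' s Ξ (H + (σ * s) • Ξ) + B₂ * weight β' κ 0 s Ξ (H + (σ * s) • Ξ))) :
    ‖∫ s in (0 : ℝ)..(σ * r), R s‖ ≤ 2 / κ *
      (B₁ * weight β' κ β' r Ξ (H + (σ * r) • Ξ) + B₂ * weight β' κ 0 r Ξ (H + (σ * r) • Ξ)) := by
  set Y := B₁ * weight β' κ β' r Ξ (H + (σ * r) • Ξ) + B₂ * weight β' κ 0 r Ξ (H + (σ * r) • Ξ)
    with hY
  have hY0 : 0 ≤ Y := add_nonneg (mul_nonneg hB₁ (weight_pos _ _ _ _ _ _).le)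
    (mul_nonneg hB₂ (weight_pos _ _ _ _ _ _).le)
  set A := size (H + (σ * r) • Ξ) with hA
  set L := size Ξ with hL
  have hA0 : 0 ≤ A := size_nonneg _
  have hL0 : 0 ≤ L := size_nonneg _
  -- `G` satisfies `G' = κ / 2 (A + 2 L (r - s)) G`, and `A + 2 L (r - s)` dominates the size of the
  -- momentum variable at time `s`: the integrand is bounded by the derivative of `2 / κ Y G`.
  set G : ℝ → ℝ := fun s => Real.exp (-(κ / 2 * (A * (r - s) + L * (r - s) ^ 2))) with hG
  have hGd : ∀ s, HasDerivAt (fun s => 2 / κ * Y * G s) ((A + 2 * L * (r - s)) * (G s * Y)) s := by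
    intro s
    have h0 : HasDerivAt (fun s => r - s) (-1) s := by
      simpa using (hasDerivAt_id s).const_sub r
    have h1 := ((((h0.const_mul A).add ((h0.pow 2).const_mul L)).const_mul (κ / 2)).neg.exp).const_mul
      (2 / κ * Y)
    refine h1.congr_deriv ?_
    simp only [hG, Pi.add_apply, Pi.neg_apply, Pi.pow_apply]
    field_simp
    ring
  have hsub : ∫ s in (0 : ℝ)..(σ * r), R s = (σ : ℝ) • ∫ s in (0 : ℝ)..r, R (σ * s) := by
    rw [intervalIntegral.smul_integral_comp_mul_left, mul_zero]
  rw [hsub, norm_smul, Real.norm_eq_abs, hσ, one_mul]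
  have hcont : Continuous fun s => (A + 2 * L * (r - s)) * (G s * Y) := by
    simp only [hG]
    fun_prop
  have hle := intervalIntegral.norm_integral_le_of_norm_le (μ := volume) (f := fun s => R (σ * s)) hr0
    (g := fun s => (A + 2 * L * (r - s)) * (G s * Y)) (ae_of_all _ fun s hs => ?_)
    (hcont.intervalIntegrable 0 r)
  · refine hle.trans ?_
    rw [intervalIntegral.integral_eq_sub_of_hasDerivAt (fun s _ => hGd s)
      (hcont.intervalIntegrable 0 r)]
    have hGr : G r = 1 := by simp [hG]
    have hG0 : 0 ≤ 2 / κ * Y * G 0 := mul_nonneg (by positivity) (Real.exp_pos _).le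
    rw [hGr, mul_one]
    linarith
  · have hs0 : 0 ≤ s := hs.1.le
    have hρ : 0 ≤ r - s := by linarith [hs.2]
    refine (hR s hs0 hs.2).trans ?_
    have h1 := weight_flow hκ.le hr hσ hs0 hs.2 (Or.inl rfl) Ξ H
    have h2 := weight_flow hκ.le hr hσ hs0 hs.2 (Or.inr rfl) Ξ H
    have h3 : B₁ * weight β' κ β' s Ξ (H + (σ * s) • Ξ) +
        B₂ * weight β' κ 0 s Ξ (H + (σ * s) • Ξ) ≤ G s * Y := by
      rw [hY, mul_add]
      have e1 := mul_le_mul_of_nonneg_left h1 hB₁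
      have e2 := mul_le_mul_of_nonneg_left h2 hB₂
      calc _ ≤ _ := add_le_add e1 e2
        _ = _ := by simp only [hG]; ring
    have h4 : size (H + (σ * s) • Ξ) ≤ A + 2 * L * (r - s) := by
      have := (size_flow hσ hs.2 Ξ H).1
      nlinarith [mul_nonneg hL0 hρ]
    exact mul_le_mul h4 h3 (add_nonneg (mul_nonneg hB₁ (weight_pos _ _ _ _ _ _).le)
      (mul_nonneg hB₂ (weight_pos _ _ _ _ _ _).le)) (by positivity)

/-- A shift of the frequencies costs an exponential factor. -/
lemma weight_shift_le (hβ : 0 ≤ β') (hs : 0 ≤ s) (hs1 : s ≤ 1) (hc : c = β' ∨ c = 0)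
    (Ξ X H : Fin N → EuclideanSpace ℝ (Fin d)) :
    weight β' κ c s (Ξ + X) H ≤ Real.exp (β' * size X) * weight β' κ c s Ξ H := by
  rw [weight, weight, ← Real.exp_add, Real.exp_le_exp]
  have h1 := size_add_le Ξ X
  have h2 := size_le_size_add Ξ X
  have h3 := size_nonneg X
  rcases hc with rfl | rfl
  · nlinarith [mul_nonneg hβ (sub_nonneg.2 hs1), mul_nonneg (mul_nonneg hβ hs) h3,
      mul_nonneg (mul_nonneg hβ (sub_nonneg.2 hs1)) (sub_nonneg.2 h2)]
  · nlinarith [mul_nonneg (mul_nonneg hβ hs) (sub_nonneg.2 h1),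
      mul_nonneg (mul_nonneg hβ (sub_nonneg.2 hs1)) h3]

/-- The families of vectors vanishing outside of the set `J`. -/
def SupportedIn (J : Finset (Fin N)) (X : Fin N → EuclideanSpace ℝ (Fin d)) : Prop :=
  ∀ k ∉ J, X k = 0

/-- A linear Gronwall argument on a scale of weighted spaces: a quantity which is bounded
a priori, whose initial value is bounded by the decaying weight, and whose rate of change along
free trajectories is bounded by itself, with loss of one power of the momentum variable, is bounded
by the decaying weight. -/
theorem norm_le_of_rate {M b₀ lam : ℝ} (hM : 1 ≤ M) (hκ : 0 < κ) (hβ : 0 ≤ β')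
    (hlam : κ * lam ≤ β') (hσ : |σ| = 1) (hb₀ : 0 ≤ b₀)
    {Q R : ℝ → (Fin N → EuclideanSpace ℝ (Fin d)) → (Fin N → EuclideanSpace ℝ (Fin d)) → ℂ}
    (hQ : ∀ (t : ℝ) Ξ H, Q t Ξ (H + t • Ξ) = Q 0 Ξ H + ∫ s in (0 : ℝ)..t, R s Ξ (H + s • Ξ))
    {a S G : ℕ → ℝ} (hS : ∀ j, 0 ≤ S j) (hG : ∀ j, 0 ≤ G j)
    (haG : ∀ j, a j + 2 / κ * S j ≤ G j)
    (hinit : ∀ J Ξ H, SupportedIn J Ξ → SupportedIn J H →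
      ‖Q 0 Ξ H‖ ≤ a J.card * weight β' κ β' 0 Ξ H)
    (hbound : ∀ t Ξ H, ‖Q t Ξ H‖ ≤ b₀)
    (hrate : ∀ b, 0 ≤ b → ∀ s, 0 ≤ s → s ≤ lam →
      (∀ J Ξ H, SupportedIn J Ξ → SupportedIn J H → ‖Q (σ * s) Ξ H‖ ≤
        G J.card * weight β' κ β' s Ξ H + b * M ^ J.card * weight β' κ 0 s Ξ H) →
      ∀ J Ξ H, SupportedIn J Ξ → SupportedIn J H → ‖R (σ * s) Ξ H‖ ≤ size H *
        (S J.card * weight β' κ β' s Ξ H + b * M ^ J.card * (κ / 4) * weight β' κ 0 s Ξ H))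
    (ha : ∀ j, 0 ≤ a j) (hlam0 : 0 ≤ lam)
    {J : Finset (Fin N)} {Ξ H : Fin N → EuclideanSpace ℝ (Fin d)} (hΞ : SupportedIn J Ξ)
    (hH : SupportedIn J H) :
    ‖Q (σ * lam) Ξ H‖ ≤ G J.card * weight β' κ β' lam Ξ H := by
  -- The trivial bound `b₀` is covered by the weight with `c = 0`; each use of the integral equation
  -- halves its contribution.
  have key : ∀ n : ℕ, ∀ s, 0 ≤ s → s ≤ lam → ∀ (J : Finset (Fin N)) Ξ H, SupportedIn J Ξ →
      SupportedIn J H → ‖Q (σ * s) Ξ H‖ ≤ G J.card * weight β' κ β' s Ξ H +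
        b₀ * (1 / 2) ^ n * M ^ J.card * weight β' κ 0 s Ξ H := by
    intro n
    induction n with
    | zero =>
      intro s hs _ J Ξ H _ _
      have h1 := one_le_weight hβ hκ.le hs Ξ H
      have h2 : 1 ≤ M ^ J.card := one_le_pow₀ hM
      have h3 : b₀ ≤ b₀ * (1 / 2) ^ 0 * M ^ J.card * weight β' κ 0 s Ξ H := by
        rw [pow_zero, mul_one, mul_assoc]
        exact le_mul_of_one_le_right hb₀ (one_le_mul_of_one_le_of_one_le h2 h1)
      have h4 := mul_nonneg (hG J.card) (weight_pos β' κ β' s Ξ H).le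
      linarith [hbound (σ * s) Ξ H]
    | succ n ih =>
      intro r hr0 hr J Ξ H hΞ hH
      have hrβ : κ * r ≤ β' := (mul_le_mul_of_nonneg_left hr hκ.le).trans hlam
      set H₀ := H - (σ * r) • Ξ with hH₀
      have hH₀r : H₀ + (σ * r) • Ξ = H := sub_add_cancel _ _
      have hsupp : ∀ s : ℝ, SupportedIn J (H₀ + s • Ξ) := fun s k hk => by
        simp [hH₀, hΞ k hk, hH k hk]
      have hM0 : 0 ≤ M := by linarith
      have h1 := norm_integral_flow_le hκ hrβ hσ hr0 (hS J.card)
        (B₂ := b₀ * (1 / 2) ^ n * M ^ J.card * (κ / 4)) (by positivity) Ξ H₀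
        (R := fun s => R s Ξ (H₀ + s • Ξ)) fun s hs hsr =>
          hrate _ (by positivity) s hs (hsr.trans hr) (ih s hs (hsr.trans hr)) J Ξ _ hΞ (hsupp _)
      have h2 := hQ (σ * r) Ξ H₀
      have h3 := hinit J Ξ H₀ hΞ (by simpa using hsupp 0)
      have h4 := mul_le_mul_of_nonneg_left (weight_initial_le hκ.le hrβ hσ hr0 Ξ H₀) (ha J.card)
      rw [hH₀r] at h1 h2 h4
      rw [h2]
      refine (norm_add_le _ _).trans ?_
      have h5 := mul_le_mul_of_nonneg_right (haG J.card) (weight_pos β' κ β' r Ξ H).le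
      have h6 : 2 / κ * (b₀ * (1 / 2) ^ n * M ^ J.card * (κ / 4) * weight β' κ 0 r Ξ H) =
          b₀ * (1 / 2) ^ (n + 1) * M ^ J.card * weight β' κ 0 r Ξ H := by
        rw [pow_succ]
        field_simp
        ring
      rw [mul_add, h6] at h1
      linarith
  have hlim : Tendsto (fun n : ℕ => G J.card * weight β' κ β' lam Ξ H +
      b₀ * (1 / 2) ^ n * M ^ J.card * weight β' κ 0 lam Ξ H) atTop
      (𝓝 (G J.card * weight β' κ β' lam Ξ H + b₀ * 0 * M ^ J.card * weight β' κ 0 lam Ξ H)) := by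
    have h0 := tendsto_pow_atTop_nhds_zero_of_lt_one (r := (1 / 2 : ℝ)) (by norm_num) (by norm_num)
    exact (((h0.const_mul b₀).mul_const _).mul_const _).const_add _
  have := ge_of_tendsto' hlim fun n => key n lam hlam0 le_rfl J Ξ H hΞ hH
  simpa using this

end Weights

/-! ### Bounds for the rates of change -/

section RateBounds

set_option linter.unusedSectionVars false

variable {N d : ℕ} {hbar β' κ C s : ℝ} {Φ : EuclideanSpace ℝ (Fin d) → ℝ}
  {Φhat : EuclideanSpace ℝ (Fin d) → ℂ}

/-- The exponential moment `∫ |h| |Φhat(h)| e^{2β'|h|} dh` is at most `C`. -/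
structure MomentBound (Φhat : EuclideanSpace ℝ (Fin d) → ℂ) (β' C : ℝ) : Prop where
  nonneg : 0 ≤ C
  integrable : Integrable fun h => ‖h‖ * ‖Φhat h‖ * Real.exp (2 * β' * ‖h‖)
  bound : ∫ h, ‖h‖ * ‖Φhat h‖ * Real.exp (2 * β' * ‖h‖) ≤ C

lemma MomentBound.norm_integral_le (hm : MomentBound Φhat β' C) (hb : 0 < hbar)
    {c q : EuclideanSpace ℝ (Fin d) → ℂ} (hc : ∀ h, ‖c h‖ ≤ ‖Φhat h‖)
    (η : EuclideanSpace ℝ (Fin d)) {Y : ℝ} (hY : 0 ≤ Y)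
    (hq : ∀ h, ‖q h‖ ≤ Real.exp (2 * β' * ‖h‖) * Y) :
    ‖∫ h, c h * sinFactor hbar h η * q h‖ ≤ C * ‖η‖ * Y := by
  refine (norm_integral_le_of_norm_le (hm.integrable.mul_const (‖η‖ * Y))
    (ae_of_all _ fun h => ?_)).trans ?_
  · rw [norm_mul, norm_mul, Complex.norm_real, Real.norm_eq_abs]
    calc ‖c h‖ * |sinFactor hbar h η| * ‖q h‖
        ≤ ‖Φhat h‖ * (‖h‖ * ‖η‖) * (Real.exp (2 * β' * ‖h‖) * Y) := by
          gcongr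
          · exact hc h
          · exact abs_sinFactor_le hb h η
          · exact hq h
      _ = _ := by ring
  · rw [integral_mul_const, mul_assoc]
    exact mul_le_mul_of_nonneg_right hm.bound (by positivity)

/-- The bounding function `B₁ w_{β'} + B₂ w_0`. -/
def envelope (β' κ B₁ B₂ s : ℝ) (Ξ H : Fin N → EuclideanSpace ℝ (Fin d)) : ℝ :=
  B₁ * weight β' κ β' s Ξ H + B₂ * weight β' κ 0 s Ξ H

variable {B₁ B₂ : ℝ}

lemma envelope_nonneg (hB₁ : 0 ≤ B₁) (hB₂ : 0 ≤ B₂) (Ξ H : Fin N → EuclideanSpace ℝ (Fin d)) :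
    0 ≤ envelope β' κ B₁ B₂ s Ξ H :=
  add_nonneg (mul_nonneg hB₁ (weight_pos _ _ _ _ _ _).le)
    (mul_nonneg hB₂ (weight_pos _ _ _ _ _ _).le)

lemma envelope_mono {B₁' B₂' : ℝ} (h1 : B₁ ≤ B₁') (h2 : B₂ ≤ B₂')
    (Ξ H : Fin N → EuclideanSpace ℝ (Fin d)) :
    envelope β' κ B₁ B₂ s Ξ H ≤ envelope β' κ B₁' B₂' s Ξ H :=
  add_le_add (mul_le_mul_of_nonneg_right h1 (weight_pos _ _ _ _ _ _).le)
    (mul_le_mul_of_nonneg_right h2 (weight_pos _ _ _ _ _ _).le)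

lemma mul_envelope (c : ℝ) (Ξ H : Fin N → EuclideanSpace ℝ (Fin d)) :
    c * envelope β' κ B₁ B₂ s Ξ H = envelope β' κ (c * B₁) (c * B₂) s Ξ H := by
  simp only [envelope]
  ring

lemma envelope_shift_le (hβ : 0 ≤ β') (hs : 0 ≤ s) (hs1 : s ≤ 1) (hB₁ : 0 ≤ B₁) (hB₂ : 0 ≤ B₂)
    (Ξ X H : Fin N → EuclideanSpace ℝ (Fin d)) {x : ℝ} (hX : size X ≤ 2 * x) :
    envelope β' κ B₁ B₂ s (Ξ + X) H ≤ Real.exp (2 * β' * x) * envelope β' κ B₁ B₂ s Ξ H := by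
  have h0 : Real.exp (β' * size X) ≤ Real.exp (2 * β' * x) := by
    rw [Real.exp_le_exp]
    nlinarith [mul_le_mul_of_nonneg_left hX hβ]
  refine le_trans ?_ (mul_le_mul_of_nonneg_right h0 (envelope_nonneg hB₁ hB₂ Ξ H))
  have h1 := mul_le_mul_of_nonneg_left
    (weight_shift_le (κ := κ) hβ hs hs1 (Or.inl rfl) Ξ X H) hB₁
  have h2 := mul_le_mul_of_nonneg_left
    (weight_shift_le (κ := κ) hβ hs hs1 (Or.inr rfl) Ξ X H) hB₂
  calc envelope β' κ B₁ B₂ s (Ξ + X) H ≤ _ := add_le_add h1 h2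
    _ = _ := by simp only [envelope]; ring

lemma add_single_sub_single (Ξ : Fin N → EuclideanSpace ℝ (Fin d)) (k l : Fin N)
    (h : EuclideanSpace ℝ (Fin d)) : Ξ + Pi.single k h - Pi.single l h =
      Ξ + (Pi.single k h + (-1 : ℝ) • (Pi.single l h : Fin N → EuclideanSpace ℝ (Fin d))) := by
  rw [neg_one_smul]
  abel

lemma norm_pairRate_le (hm : MomentBound Φhat β' C) (hb : 0 < hbar) (hβ : 0 ≤ β')
    (hs : 0 ≤ s) (hs1 : s ≤ 1) (hB₁ : 0 ≤ B₁) (hB₂ : 0 ≤ B₂)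
    {g : (Fin N → EuclideanSpace ℝ (Fin d)) → (Fin N → EuclideanSpace ℝ (Fin d)) → ℂ}
    {Ξ H : Fin N → EuclideanSpace ℝ (Fin d)} {k l : Fin N}
    (hg : ∀ h, ‖g (Ξ + Pi.single k h - Pi.single l h) H‖ ≤
      envelope β' κ B₁ B₂ s (Ξ + Pi.single k h - Pi.single l h) H) :
    ‖pairRate hbar Φhat g Ξ H k l‖ ≤ (‖H k‖ + ‖H l‖) * (C * envelope β' κ B₁ B₂ s Ξ H) := by
  have hY := envelope_nonneg (β' := β') (κ := κ) (s := s) hB₁ hB₂ Ξ H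
  refine (hm.norm_integral_le hb (fun h => le_rfl) (H k - H l) hY fun h => (hg h).trans ?_).trans ?_
  · rw [add_single_sub_single]
    exact envelope_shift_le hβ hs hs1 hB₁ hB₂ _ _ _ (size_pair_le k l h)
  · calc C * ‖H k - H l‖ * envelope β' κ B₁ B₂ s Ξ H
        ≤ C * (‖H k‖ + ‖H l‖) * envelope β' κ B₁ B₂ s Ξ H := by
          have := hm.nonneg
          gcongr
          exact norm_sub_le _ _
      _ = _ := by ring

/-- The Wigner transform of a factorized state. -/
def prodExpect (hbar : ℝ) (D : L2 (Fin d) →L[ℂ] L2 (Fin d))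
    (Ξ H : Fin N → EuclideanSpace ℝ (Fin d)) : ℂ :=
  ∏ k, expect D (weylOp hbar (Ξ k) (H k))

/-- The contribution of particle `k` to the rate of change of a factorized solution. -/
def meanRate (hbar : ℝ) (Φhat : EuclideanSpace ℝ (Fin d) → ℂ) (D : L2 (Fin d) →L[ℂ] L2 (Fin d))
    (Ξ H : Fin N → EuclideanSpace ℝ (Fin d)) (k : Fin N) : ℂ :=
  ∫ h, Φhat h * expect D (weylOp hbar (-h) 0) * sinFactor hbar h (H k) *
    prodExpect hbar D (Ξ + Pi.single k h) H

variable {D : L2 (Fin d) →L[ℂ] L2 (Fin d)}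

lemma meanRate_eq_zero {Ξ H : Fin N → EuclideanSpace ℝ (Fin d)} {k : Fin N} (hk : H k = 0) :
    meanRate hbar Φhat D Ξ H k = 0 := by
  simp [meanRate, hk]

lemma norm_meanRate_le (hD : IsDensityOperator D) (hm : MomentBound Φhat β' C) (hb : 0 < hbar)
    (hβ : 0 ≤ β') (hs : 0 ≤ s) (hs1 : s ≤ 1) (hB₁ : 0 ≤ B₁) (hB₂ : 0 ≤ B₂)
    {Ξ H : Fin N → EuclideanSpace ℝ (Fin d)} {k : Fin N}
    (hg : ∀ h, ‖prodExpect hbar D (Ξ + Pi.single k h) H‖ ≤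
      envelope β' κ B₁ B₂ s (Ξ + Pi.single k h) H) :
    ‖meanRate hbar Φhat D Ξ H k‖ ≤ ‖H k‖ * (C * envelope β' κ B₁ B₂ s Ξ H) := by
  have hY := envelope_nonneg (β' := β') (κ := κ) (s := s) hB₁ hB₂ Ξ H
  refine (hm.norm_integral_le hb (fun h => ?_) (H k) hY fun h => (hg h).trans ?_).trans_eq ?_
  · rw [norm_mul]
    exact mul_le_of_le_one_right (norm_nonneg _) (norm_expect_weylOp_le hD _ _)
  · refine envelope_shift_le hβ hs hs1 hB₁ hB₂ _ _ _ ?_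
    rw [size_single]
    linarith [norm_nonneg h]
  · ring

lemma prodExpect_eq_mul_erase (Ξ H : Fin N → EuclideanSpace ℝ (Fin d)) (k : Fin N) :
    prodExpect hbar D Ξ H = expect D (weylOp hbar (Ξ k) (H k)) *
      ∏ l ∈ Finset.univ.erase k, expect D (weylOp hbar (Ξ l) (H l)) :=
  (Finset.mul_prod_erase _ _ (Finset.mem_univ k)).symm

lemma prodExpect_add_single (Ξ H : Fin N → EuclideanSpace ℝ (Fin d)) (k : Fin N)
    (h : EuclideanSpace ℝ (Fin d)) :
    prodExpect hbar D (Ξ + Pi.single k h) H = expect D (weylOp hbar (Ξ k + h) (H k)) *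
      ∏ l ∈ Finset.univ.erase k, expect D (weylOp hbar (Ξ l) (H l)) := by
  rw [prodExpect_eq_mul_erase _ _ k]
  congr 1
  · simp
  · refine Finset.prod_congr rfl fun l hl => ?_
    simp [Pi.single_eq_of_ne (Finset.ne_of_mem_erase hl)]

/-- For a factorized state, the interaction with a particle whose phase space variables vanish is the
mean field. -/
lemma prodExpect_pair (hD : IsDensityOperator D) {Ξ H : Fin N → EuclideanSpace ℝ (Fin d)}
    {k l : Fin N} (hkl : l ≠ k) (hΞ : Ξ l = 0) (hH : H l = 0) (h : EuclideanSpace ℝ (Fin d)) :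
    prodExpect hbar D (Ξ + Pi.single k h - Pi.single l h) H =
      expect D (weylOp hbar (-h) 0) * prodExpect hbar D (Ξ + Pi.single k h) H := by
  set X : Fin N → EuclideanSpace ℝ (Fin d) := Ξ + Pi.single k h with hX
  set Z : Fin N → EuclideanSpace ℝ (Fin d) := Pi.single l h with hZ
  have h1 : X l = 0 := by simp [hX, Pi.single_eq_of_ne hkl, hΞ]
  have h2 : (X - Z) l = -h := by rw [Pi.sub_apply, h1, hZ, Pi.single_eq_same, zero_sub]
  rw [prodExpect_eq_mul_erase (X - Z) H l, prodExpect_eq_mul_erase X H l]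
  rw [h1, h2, hH, weylOp_zero, expect_id hD, one_mul]
  congr 1
  refine Finset.prod_congr rfl fun m hm => ?_
  rw [Pi.sub_apply, hZ, Pi.single_eq_of_ne (Finset.ne_of_mem_erase hm), sub_zero]

lemma pairRate_prodExpect (hD : IsDensityOperator D) {Ξ H : Fin N → EuclideanSpace ℝ (Fin d)}
    {k l : Fin N} (hkl : l ≠ k) (hΞ : Ξ l = 0) (hH : H l = 0) :
    pairRate hbar Φhat (prodExpect hbar D) Ξ H k l = meanRate hbar Φhat D Ξ H k := by
  refine integral_congr_ae (ae_of_all _ fun h => ?_)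
  simp only [prodExpect_pair hD hkl hΞ hH, hH, sub_zero]
  ring

lemma norm_prodExpect_le (hD : IsDensityOperator D) (Ξ H : Fin N → EuclideanSpace ℝ (Fin d)) :
    ‖prodExpect hbar D Ξ H‖ ≤ 1 := by
  rw [prodExpect, norm_prod]
  exact Finset.prod_le_one (fun _ _ => norm_nonneg _) fun k _ => norm_expect_weylOp_le hD _ _

lemma continuous_prodExpect (hD : IsDensityOperator D) (H : Fin N → EuclideanSpace ℝ (Fin d)) :
    Continuous fun Ξ : Fin N → EuclideanSpace ℝ (Fin d) => prodExpect hbar D Ξ H :=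
  continuous_finsetProd _ fun k _ => (continuous_expect_weylOp hD (H k)).comp (continuous_apply k)

lemma continuous_manyExpect {D : L2 (Fin N × Fin d) →L[ℂ] L2 (Fin N × Fin d)}
    (hD : IsDensityOperator D) (H : Fin N → EuclideanSpace ℝ (Fin d)) :
    Continuous fun Ξ : Fin N → EuclideanSpace ℝ (Fin d) => manyExpect hbar D Ξ H :=
  (continuous_expect_weylOp hD (join H)).comp continuous_join

lemma integrable_pairRate (hΦ : HasFourierTransform Φ Φhat) (hb : 0 < hbar)
    {g : (Fin N → EuclideanSpace ℝ (Fin d)) → (Fin N → EuclideanSpace ℝ (Fin d)) → ℂ}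
    {Ξ H : Fin N → EuclideanSpace ℝ (Fin d)} (hg : Continuous fun Ξ => g Ξ H)
    (hg1 : ∀ Ξ, ‖g Ξ H‖ ≤ 1) (k l : Fin N) :
    Integrable fun h => Φhat h * sinFactor hbar h (H k - H l) *
      g (Ξ + Pi.single k h - Pi.single l h) H := by
  have h1 : Integrable fun h => Φhat h * ((sinFactor hbar h (H k - H l) : ℝ) : ℂ) :=
    hΦ.1.mul_bdd (c := 2 / hbar)
      (Complex.continuous_ofReal.comp (continuous_sinFactor _)).aestronglyMeasurable
      (ae_of_all _ fun h => by
        rw [Complex.norm_real, Real.norm_eq_abs, sinFactor, abs_mul, abs_neg,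
          abs_of_pos (by positivity : 0 < 2 / hbar)]
        exact mul_le_of_le_one_right (by positivity) (Real.abs_sin_le_one _))
  refine h1.mul_bdd (c := 1) (Continuous.aestronglyMeasurable ?_) (ae_of_all _ fun h => hg1 _)
  exact hg.comp ((continuous_const.add (continuous_single' k)).sub (continuous_single' l))

lemma pairRate_sub (hΦ : HasFourierTransform Φ Φhat) (hb : 0 < hbar)
    {g g' : (Fin N → EuclideanSpace ℝ (Fin d)) → (Fin N → EuclideanSpace ℝ (Fin d)) → ℂ}
    {Ξ H : Fin N → EuclideanSpace ℝ (Fin d)} (hg : Continuous fun Ξ => g Ξ H)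
    (hg1 : ∀ Ξ, ‖g Ξ H‖ ≤ 1) (hg' : Continuous fun Ξ => g' Ξ H)
    (hg1' : ∀ Ξ, ‖g' Ξ H‖ ≤ 1) (k l : Fin N) :
    pairRate hbar Φhat (fun Ξ H => g Ξ H - g' Ξ H) Ξ H k l =
      pairRate hbar Φhat g Ξ H k l - pairRate hbar Φhat g' Ξ H k l := by
  rw [pairRate, pairRate, pairRate, ← integral_sub (integrable_pairRate hΦ hb hg hg1 k l)
    (integrable_pairRate hΦ hb hg' hg1' k l)]
  refine integral_congr_ae (ae_of_all _ fun h => ?_)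
  simp only
  ring

/-- The equation for the Wigner transform of the factorized solution. -/
theorem prodExpect_integral (hb : hbar ≠ 0) (hΦ : HasFourierTransform Φ Φhat)
    {F : ℝ → L2 (Fin d) →L[ℂ] L2 (Fin d)} (hF : IsHartreeSolution hbar Φ F)
    (Ξ H : Fin N → EuclideanSpace ℝ (Fin d)) :
    (∀ t, IntervalIntegrable (fun s : ℝ => ∑ k, meanRate hbar Φhat (F s) Ξ (H + s • Ξ) k)
      volume 0 t) ∧
    ∀ t : ℝ, prodExpect hbar (F t) Ξ (H + t • Ξ) = prodExpect hbar (F 0) Ξ H +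
      ∫ s in (0 : ℝ)..t, ∑ k, meanRate hbar Φhat (F s) Ξ (H + s • Ξ) k := by
  obtain ⟨-, K, hK⟩ := hartree_integral hb hΦ hF
  have h1 := prod_eq_add_integral (κ := Fin N)
    (g := fun k t => expect (F t) (weylOp hbar (Ξ k) (H k + t • Ξ k)))
    (R := fun k s => hartreeRate hbar Φhat (F s) (Ξ k) (H k + s • Ξ k)) (K := K)
    (fun k s => (hK _ _).1 s) (fun k t => (hK _ _).2.1 t) fun k t => by
      have := (hK (Ξ k) (H k)).2.2 t
      simpa using this
  have h2 : ∀ (s : ℝ) k, (∏ l ∈ Finset.univ.erase k,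
      expect (F s) (weylOp hbar (Ξ l) (H l + s • Ξ l))) *
        hartreeRate hbar Φhat (F s) (Ξ k) (H k + s • Ξ k) =
      meanRate hbar Φhat (F s) Ξ (H + s • Ξ) k := fun s k => by
    rw [hartreeRate, ← integral_const_mul]
    refine integral_congr_ae (ae_of_all _ fun h => ?_)
    simp only [prodExpect_add_single, Pi.add_apply, Pi.smul_apply]
    ring
  simp_rw [h2] at h1
  refine ⟨h1.1, fun t => ?_⟩
  have h3 := h1.2 t
  simp only [zero_smul, add_zero] at h3
  exact h3

lemma SupportedIn.size_eq {J : Finset (Fin N)} {X : Fin N → EuclideanSpace ℝ (Fin d)}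
    (h : SupportedIn J X) : size X = ∑ k ∈ J, ‖X k‖ :=
  (Finset.sum_subset (Finset.subset_univ J) fun k _ hk => by rw [h k hk, norm_zero]).symm

lemma SupportedIn.add_pair {J : Finset (Fin N)} {X : Fin N → EuclideanSpace ℝ (Fin d)}
    (hX : SupportedIn J X) {k l : Fin N} (hk : k ∈ J) (hl : l ∈ J)
    (h : EuclideanSpace ℝ (Fin d)) : SupportedIn J (X + Pi.single k h - Pi.single l h) := by
  intro m hm
  have h1 : m ≠ k := fun e => hm (e ▸ hk)
  have h2 : m ≠ l := fun e => hm (e ▸ hl)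
  simp [hX m hm, Pi.single_eq_of_ne h1, Pi.single_eq_of_ne h2]

lemma SupportedIn.add_single {J : Finset (Fin N)} {X : Fin N → EuclideanSpace ℝ (Fin d)}
    (hX : SupportedIn J X) {k : Fin N} (hk : k ∈ J)
    (h : EuclideanSpace ℝ (Fin d)) : SupportedIn J (X + Pi.single k h) := by
  intro m hm
  have h1 : m ≠ k := fun e => hm (e ▸ hk)
  simp [hX m hm, Pi.single_eq_of_ne h1]

lemma SupportedIn.mono {J J' : Finset (Fin N)} {X : Fin N → EuclideanSpace ℝ (Fin d)}
    (hX : SupportedIn J X) (h : J ⊆ J') : SupportedIn J' X := fun k hk => hX k fun hk' => hk (h hk')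

/-- Sum of the pair contributions inside of a set of particles. -/
lemma norm_sum_pairs_le {J : Finset (Fin N)} {H : Fin N → EuclideanSpace ℝ (Fin d)}
    (hH : SupportedIn J H) {G : Fin N → Fin N → ℂ} {Y : ℝ}
    (hG : ∀ k ∈ J, ∀ l ∈ J, ‖G k l‖ ≤ (‖H k‖ + ‖H l‖) * Y) :
    ‖1 / (2 * (N : ℂ)) * ∑ k ∈ J, ∑ l ∈ J, G k l‖ ≤ size H * ((J.card / N : ℝ) * Y) := by
  have h1 : ‖∑ k ∈ J, ∑ l ∈ J, G k l‖ ≤ 2 * (J.card * size H * Y) := by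
    refine (norm_sum_le_of_le _ fun k hk => norm_sum_le_of_le _ fun l hl => hG k hk l hl).trans_eq ?_
    rw [hH.size_eq]
    simp_rw [← Finset.sum_mul, Finset.sum_add_distrib, Finset.sum_const, nsmul_eq_mul,
      ← Finset.mul_sum]
    ring
  rw [norm_mul, norm_div, norm_mul, norm_one, Complex.norm_ofNat, Complex.norm_natCast]
  calc 1 / (2 * (N : ℝ)) * ‖∑ k ∈ J, ∑ l ∈ J, G k l‖
      ≤ 1 / (2 * (N : ℝ)) * (2 * (J.card * size H * Y)) := by gcongr
    _ = size H * ((J.card / N : ℝ) * Y) := by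
      rcases eq_or_ne (N : ℝ) 0 with h | h
      · simp [h]
      · field_simp

/-- Sum of the contributions of pairs of particles inside and outside of a set. -/
lemma norm_sum_cross_le {J : Finset (Fin N)} {H : Fin N → EuclideanSpace ℝ (Fin d)}
    (hH : SupportedIn J H) {G : Fin N → Fin N → ℂ} {Y : ℝ}
    (hG : ∀ k ∈ J, ∀ l ∈ Jᶜ, ‖G k l‖ ≤ (‖H k‖ + ‖H l‖) * Y) :
    ‖1 / (N : ℂ) * ∑ k ∈ J, ∑ l ∈ Jᶜ, G k l‖ ≤ size H * ((Jᶜ.card / N : ℝ) * Y) := by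
  have h1 : ‖∑ k ∈ J, ∑ l ∈ Jᶜ, G k l‖ ≤ Jᶜ.card * size H * Y := by
    refine (norm_sum_le_of_le _ fun k hk => norm_sum_le_of_le (f := fun l => G k l)
      (n := fun _ => ‖H k‖ * Y) _ fun l hl => ?_).trans_eq ?_
    · have := hG k hk l hl
      rwa [hH l (Finset.mem_compl.1 hl), norm_zero, add_zero] at this
    · rw [hH.size_eq]
      simp_rw [Finset.sum_const, nsmul_eq_mul, ← Finset.mul_sum, ← Finset.sum_mul]
      ring
  rw [norm_mul, norm_div, norm_one, Complex.norm_natCast]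
  calc 1 / (N : ℝ) * ‖∑ k ∈ J, ∑ l ∈ Jᶜ, G k l‖
      ≤ 1 / (N : ℝ) * (Jᶜ.card * size H * Y) := by gcongr
    _ = size H * ((Jᶜ.card / N : ℝ) * Y) := by ring

end RateBounds

/-! ### Propagation of chaos for the Wigner transforms -/

section Chaos

set_option linter.unusedSectionVars false

variable {N d : ℕ} {hbar β' κ C M τ lam σ : ℝ} {Φ : EuclideanSpace ℝ (Fin d) → ℝ}
  {Φhat : EuclideanSpace ℝ (Fin d) → ℂ}

/-- The data of the problem on the time interval `σ [0, lam]`, with `σ = ±1`: the potential, the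
Hartree solution `F`, the `N`-body solution `D`, and the constants of the estimates. -/
structure ChaosData (hbar β' κ C M τ lam σ : ℝ) (Φ : EuclideanSpace ℝ (Fin d) → ℝ)
    (Φhat : EuclideanSpace ℝ (Fin d) → ℂ) (F : ℝ → L2 (Fin d) →L[ℂ] L2 (Fin d))
    (D : ℝ → L2 (Fin N × Fin d) →L[ℂ] L2 (Fin N × Fin d)) : Prop where
  hbar_pos : 0 < hbar
  fourier : HasFourierTransform Φ Φhat
  even : ∀ x, Φ (-x) = Φ x
  hartree : IsHartreeSolution hbar Φ F
  nBody : IsNBodySolution hbar Φ N D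
  initial : ∀ Ξ H, manyExpect hbar (D 0) Ξ H = prodExpect hbar (F 0) Ξ H
  initial_le : ∀ ξ η : EuclideanSpace ℝ (Fin d),
    ‖expect (F 0) (weylOp hbar ξ η)‖ ≤ M * Real.exp (-β' * (‖ξ‖ + ‖η‖))
  moment : MomentBound Φhat β' C
  beta_nonneg : 0 ≤ β'
  kappa_pos : 0 < κ
  one_le_M : 1 ≤ M
  tau_nonneg : 0 ≤ τ
  tau_le : τ ≤ 1
  coupling : 4 * C * M ≤ κ * τ
  lam_nonneg : 0 ≤ lam
  lam_le : lam ≤ 1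
  kappa_lam : κ * lam ≤ β'
  abs_sigma : |σ| = 1

variable {F : ℝ → L2 (Fin d) →L[ℂ] L2 (Fin d)}
  {D : ℝ → L2 (Fin N × Fin d) →L[ℂ] L2 (Fin N × Fin d)}

lemma ChaosData.mono (h : ChaosData hbar β' κ C M τ lam σ Φ Φhat F D) {s : ℝ} (hs : 0 ≤ s)
    (hsl : s ≤ lam) : ChaosData hbar β' κ C M τ s σ Φ Φhat F D :=
  { h with
    lam_nonneg := hs
    lam_le := hsl.trans h.lam_le
    kappa_lam := (mul_le_mul_of_nonneg_left hsl h.kappa_pos.le).trans h.kappa_lam }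

lemma ChaosData.density (h : ChaosData hbar β' κ C M τ lam σ Φ Φhat F D) (t : ℝ) :
    IsDensityOperator (F t) :=
  (hartree_integral h.hbar_pos.ne' h.fourier h.hartree).1 t

/-- At time `0` the factorized Wigner transform is bounded by one factor `M` for each particle of `J`:
for the others the Weyl operator is the identity and the expectation is the trace, which is `1`. -/
lemma ChaosData.prodExpect_zero_le (h : ChaosData hbar β' κ C M τ lam σ Φ Φhat F D)
    {J : Finset (Fin N)} {Ξ H : Fin N → EuclideanSpace ℝ (Fin d)} (hΞ : SupportedIn J Ξ)
    (hH : SupportedIn J H) :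
    ‖prodExpect hbar (F 0) Ξ H‖ ≤ M ^ J.card * weight β' κ β' 0 Ξ H := by
  have h1 : prodExpect hbar (F 0) Ξ H = ∏ k ∈ J, expect (F 0) (weylOp hbar (Ξ k) (H k)) := by
    refine (Finset.prod_subset (Finset.subset_univ J) fun k _ hk => ?_).symm
    rw [hΞ k hk, hH k hk, weylOp_zero, expect_id (h.density 0)]
  rw [h1, norm_prod]
  refine (Finset.prod_le_prod (fun _ _ => norm_nonneg _)
    fun k _ => h.initial_le (Ξ k) (H k)).trans_eq ?_
  rw [Finset.prod_mul_distrib, Finset.prod_const, ← Real.exp_sum, weight, hΞ.size_eq, hH.size_eq,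
    ← Finset.mul_sum, Finset.sum_add_distrib]
  congr 2
  ring

/-- The coupling condition in the form used in the iteration: one more particle costs a factor `M`,
which `C` compensates up to `κ / 4`. -/
lemma ChaosData.mul_envelope_le (h : ChaosData hbar β' κ C M τ lam σ Φ Φhat F D) {x y : ℝ}
    (hx : 0 ≤ x) (hy : 0 ≤ y) (s : ℝ) (Ξ H : Fin N → EuclideanSpace ℝ (Fin d)) :
    C * envelope β' κ (x * M) (y * M) s Ξ H ≤ envelope β' κ (κ / 4 * x) (y * (κ / 4)) s Ξ H := by
  have h1 : C * M ≤ κ / 4 := by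
    have h2 := h.coupling
    have h3 : κ * τ ≤ κ := mul_le_of_le_one_right h.kappa_pos.le h.tau_le
    linarith
  rw [mul_envelope]
  exact envelope_mono (by nlinarith) (by nlinarith) Ξ H

/-- The rate of change of the `N`-particle Wigner transform. -/
def manyRate (hbar : ℝ) (Φhat : EuclideanSpace ℝ (Fin d) → ℂ)
    (D : L2 (Fin N × Fin d) →L[ℂ] L2 (Fin N × Fin d)) (Ξ H : Fin N → EuclideanSpace ℝ (Fin d)) : ℂ :=
  ((1 / (2 * (N : ℝ)) : ℝ) : ℂ) * ∑ p : Fin N × Fin N,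
    pairRate hbar Φhat (manyExpect hbar D) Ξ H p.1 p.2

lemma card_add_card_compl_div_le (J : Finset (Fin N)) :
    (J.card / N : ℝ) + (Jᶜ.card / N : ℝ) ≤ 1 := by
  rw [← add_div, ← Nat.cast_add, Finset.card_add_card_compl, Fintype.card_fin]
  exact div_self_le_one _

lemma card_insert_of_mem_compl {J : Finset (Fin N)} {l : Fin N} (hl : l ∈ Jᶜ) :
    (insert l J).card = J.card + 1 :=
  Finset.card_insert_of_notMem (Finset.mem_compl.1 hl)

/-- The `N`-particle Wigner transform inherits the exponential decay of the initial datum. -/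
theorem ChaosData.norm_manyExpect_le (h : ChaosData hbar β' κ C M τ lam σ Φ Φhat F D)
    {J : Finset (Fin N)} {Ξ H : Fin N → EuclideanSpace ℝ (Fin d)} (hΞ : SupportedIn J Ξ)
    (hH : SupportedIn J H) :
    ‖manyExpect hbar (D (σ * lam)) Ξ H‖ ≤ 2 * M ^ J.card * weight β' κ β' lam Ξ H := by
  have hM := h.one_le_M
  have hM0 : 0 ≤ M := by linarith
  have hκ := h.kappa_pos
  -- Going from `J` to `J ∪ {l}` raises the bound by a factor `M`, and `C M ≤ κ / 4` by the coupling
  -- condition, so that the constant `2 = 1 + (2 / κ) (κ / 4) 2` reproduces itself.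
  refine norm_le_of_rate (Q := fun t => manyExpect hbar (D t))
    (R := fun s => manyRate hbar Φhat (D s)) (b₀ := 1)
    (a := fun j => M ^ j) (S := fun j => κ / 4 * (2 * M ^ j)) (G := fun j => 2 * M ^ j)
    hM hκ h.beta_nonneg h.kappa_lam h.abs_sigma zero_le_one
    (fun t Ξ H => (nBody_integral h.hbar_pos.ne' h.fourier h.nBody Ξ H).2 t)
    (fun j => by positivity) (fun j => by positivity) (fun j => ?_) (fun J Ξ H hΞ hH => ?_)
    (fun t Ξ H => norm_expect_weylOp_le (h.nBody.density t) _ _)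
    (fun b hb s hs hsl hyp J Ξ H hΞ hH => ?_) (fun j => by positivity) h.lam_nonneg hΞ hH
  · refine le_of_eq ?_
    field_simp
    ring
  · rw [h.initial]
    exact h.prodExpect_zero_le hΞ hH
  · have hs1 := hsl.trans h.lam_le
    simp only [manyRate]
    rw [sum_pairRate h.hbar_pos.ne' h.fourier h.even (h.nBody.density _) hH]
    have hC := h.moment.nonneg
    set Y := C * envelope β' κ (2 * M ^ J.card * M) (b * M ^ J.card * M) s Ξ H with hY
    have hY0 : 0 ≤ Y := mul_nonneg hC (envelope_nonneg (by positivity) (by positivity) _ _)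
    have hle1 : 2 * M ^ J.card ≤ 2 * M ^ J.card * M := le_mul_of_one_le_right (by positivity) hM
    have hle2 : b * M ^ J.card ≤ b * M ^ J.card * M := le_mul_of_one_le_right (by positivity) hM
    have h1 := norm_sum_pairs_le hH (Y := Y)
      (G := pairRate hbar Φhat (manyExpect hbar (D (σ * s))) Ξ H) fun k hk l hl => by
        refine norm_pairRate_le h.moment h.hbar_pos h.beta_nonneg hs hs1 (by positivity)
          (by positivity) fun x => ?_
        exact (hyp J _ H (hΞ.add_pair hk hl x) hH).trans (envelope_mono hle1 hle2 _ _)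
    have h2 := norm_sum_cross_le hH (Y := Y)
      (G := pairRate hbar Φhat (manyExpect hbar (D (σ * s))) Ξ H) fun k hk l hl => by
        refine norm_pairRate_le h.moment h.hbar_pos h.beta_nonneg hs hs1 (by positivity)
          (by positivity) fun x => ?_
        have h3 := hyp (insert l J) _ H ((hΞ.mono (Finset.subset_insert l J)).add_pair
          (Finset.mem_insert_of_mem hk) (Finset.mem_insert_self l J) x)
          (hH.mono (Finset.subset_insert l J))
        rw [card_insert_of_mem_compl hl, pow_succ, ← mul_assoc, ← mul_assoc] at h3
        exact h3
    calc _ ≤ size H * ((J.card / N : ℝ) * Y) + size H * ((Jᶜ.card / N : ℝ) * Y) :=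
          (norm_add_le _ _).trans (add_le_add h1 h2)
      _ = size H * (((J.card / N : ℝ) + (Jᶜ.card / N : ℝ)) * Y) := by ring
      _ ≤ size H * (1 * Y) := by
          have := size_nonneg H
          gcongr
          exact card_add_card_compl_div_le J
      _ ≤ _ := by
          rw [one_mul]
          exact mul_le_mul_of_nonneg_left
            (h.mul_envelope_le (by positivity) (by positivity) s Ξ H) (size_nonneg H)

lemma sum_meanRate {D : L2 (Fin d) →L[ℂ] L2 (Fin d)} {J : Finset (Fin N)}
    {Ξ H : Fin N → EuclideanSpace ℝ (Fin d)} (hH : SupportedIn J H) :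
    ∑ k, meanRate hbar Φhat D Ξ H k = ∑ k ∈ J, meanRate hbar Φhat D Ξ H k :=
  (Finset.sum_subset (Finset.subset_univ J) fun k _ hk => meanRate_eq_zero (hH k hk)).symm

/-- The factorized Wigner transform inherits the exponential decay of the initial datum. -/
theorem ChaosData.norm_prodExpect_le (h : ChaosData hbar β' κ C M τ lam σ Φ Φhat F D)
    {J : Finset (Fin N)} {Ξ H : Fin N → EuclideanSpace ℝ (Fin d)} (hΞ : SupportedIn J Ξ)
    (hH : SupportedIn J H) :
    ‖prodExpect hbar (F (σ * lam)) Ξ H‖ ≤ 2 * M ^ J.card * weight β' κ β' lam Ξ H := by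
  have hM := h.one_le_M
  have hM0 : 0 ≤ M := by linarith
  have hκ := h.kappa_pos
  refine norm_le_of_rate (Q := fun t => prodExpect hbar (F t))
    (R := fun s Ξ H => ∑ k, meanRate hbar Φhat (F s) Ξ H k) (b₀ := 1)
    (a := fun j => M ^ j) (S := fun j => κ / 4 * (2 * M ^ j)) (G := fun j => 2 * M ^ j)
    hM hκ h.beta_nonneg h.kappa_lam h.abs_sigma zero_le_one
    (fun t Ξ H => (prodExpect_integral h.hbar_pos.ne' h.fourier h.hartree Ξ H).2 t)
    (fun j => by positivity) (fun j => by positivity) (fun j => ?_)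
    (fun J Ξ H hΞ hH => h.prodExpect_zero_le hΞ hH)
    (fun t Ξ H => MeanField.norm_prodExpect_le (h.density t) _ _)
    (fun b hb s hs hsl hyp J Ξ H hΞ hH => ?_) (fun j => by positivity) h.lam_nonneg hΞ hH
  · refine le_of_eq ?_
    field_simp
    ring
  · have hs1 := hsl.trans h.lam_le
    rw [sum_meanRate hH]
    have hC := h.moment.nonneg
    set Y := C * envelope β' κ (2 * M ^ J.card * M) (b * M ^ J.card * M) s Ξ H with hY
    have hle1 : 2 * M ^ J.card ≤ 2 * M ^ J.card * M := le_mul_of_one_le_right (by positivity) hM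
    have hle2 : b * M ^ J.card ≤ b * M ^ J.card * M := le_mul_of_one_le_right (by positivity) hM
    have h1 : ‖∑ k ∈ J, meanRate hbar Φhat (F (σ * s)) Ξ H k‖ ≤ ∑ k ∈ J, ‖H k‖ * Y := by
      refine norm_sum_le_of_le _ fun k hk => ?_
      refine norm_meanRate_le (h.density _) h.moment h.hbar_pos h.beta_nonneg hs hs1 (by positivity)
        (by positivity) fun x => ?_
      exact (hyp J _ H (hΞ.add_single hk x) hH).trans (envelope_mono hle1 hle2 _ _)
    rw [← Finset.sum_mul, ← hH.size_eq] at h1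
    exact h1.trans (mul_le_mul_of_nonneg_left
      (h.mul_envelope_le (by positivity) (by positivity) s Ξ H) (size_nonneg H))

/-- The rate of change of the difference between the `N`-particle Wigner transform and the
factorized one: the pairs with a member outside of `J` act on the difference, and the remaining
terms are of relative size `|J| / N`. -/
lemma ChaosData.rate_difference (h : ChaosData hbar β' κ C M τ lam σ Φ Φhat F D) (t : ℝ)
    {J : Finset (Fin N)} {Ξ H : Fin N → EuclideanSpace ℝ (Fin d)} (hΞ : SupportedIn J Ξ)
    (hH : SupportedIn J H) (hN : N ≠ 0) :
    manyRate hbar Φhat (D t) Ξ H - ∑ k, meanRate hbar Φhat (F t) Ξ H k =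
      1 / (2 * (N : ℂ)) * ∑ k ∈ J, ∑ l ∈ J, pairRate hbar Φhat (manyExpect hbar (D t)) Ξ H k l +
      1 / (N : ℂ) * ∑ k ∈ J, ∑ l ∈ Jᶜ, pairRate hbar Φhat
        (fun Ξ H => manyExpect hbar (D t) Ξ H - prodExpect hbar (F t) Ξ H) Ξ H k l -
      (J.card / N : ℂ) * ∑ k ∈ J, meanRate hbar Φhat (F t) Ξ H k := by
  have h1 : ∀ k ∈ J, ∀ l ∈ Jᶜ, pairRate hbar Φhat
      (fun Ξ H => manyExpect hbar (D t) Ξ H - prodExpect hbar (F t) Ξ H) Ξ H k l =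
      pairRate hbar Φhat (manyExpect hbar (D t)) Ξ H k l - meanRate hbar Φhat (F t) Ξ H k := by
    intro k hk l hl
    have hl' := Finset.mem_compl.1 hl
    rw [pairRate_sub h.fourier h.hbar_pos (continuous_manyExpect (h.nBody.density t) H)
      (fun Ξ => norm_expect_weylOp_le (h.nBody.density t) _ _)
      (continuous_prodExpect (h.density t) H)
      (fun Ξ => MeanField.norm_prodExpect_le (h.density t) _ _),
      pairRate_prodExpect (h.density t) (fun e : l = k => hl' (e ▸ hk)) (hΞ l hl') (hH l hl')]
  have h2 : ∑ k ∈ J, ∑ l ∈ Jᶜ, pairRate hbar Φhat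
      (fun Ξ H => manyExpect hbar (D t) Ξ H - prodExpect hbar (F t) Ξ H) Ξ H k l =
      ∑ k ∈ J, ∑ l ∈ Jᶜ, pairRate hbar Φhat (manyExpect hbar (D t)) Ξ H k l -
      Jᶜ.card * ∑ k ∈ J, meanRate hbar Φhat (F t) Ξ H k := by
    rw [Finset.sum_congr rfl fun k hk => Finset.sum_congr rfl (h1 k hk)]
    simp_rw [Finset.sum_sub_distrib, Finset.sum_const, nsmul_eq_mul, ← Finset.mul_sum]
  have h3 : (Jᶜ.card : ℂ) = N - J.card := by
    rw [eq_sub_iff_add_eq, ← Nat.cast_add, add_comm, Finset.card_add_card_compl, Fintype.card_fin]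
  have hN' : (N : ℂ) ≠ 0 := by exact_mod_cast hN
  rw [manyRate, sum_pairRate h.hbar_pos.ne' h.fourier h.even (h.nBody.density _) hH, h2, h3,
    sum_meanRate hH]
  field_simp
  ring

lemma cast_le_three_halves_pow (j : ℕ) : (j : ℝ) ≤ (3 / 2 : ℝ) ^ j := by
  have h : ∀ j : ℕ, ((j + 2 : ℕ) : ℝ) ≤ (3 / 2 : ℝ) ^ (j + 2) := by
    intro j
    induction j with
    | zero => norm_num
    | succ j ih =>
      rw [show j + 1 + 2 = (j + 2) + 1 from rfl, pow_succ, Nat.cast_succ]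
      have : (2 : ℝ) ≤ ((j + 2 : ℕ) : ℝ) := by exact_mod_cast Nat.le_add_left 2 j
      linarith
  match j with
  | 0 => norm_num
  | 1 => norm_num
  | j + 2 => exact h j

/-- Propagation of chaos: the `N`-particle Wigner transform at a point where the phase space
variables of all but `j` particles vanish differs from the factorized one by `O(1 / N)`. -/
theorem ChaosData.norm_difference_le (h : ChaosData hbar β' κ C M τ lam σ Φ Φhat F D)
    (hN : N ≠ 0) {J : Finset (Fin N)} {Ξ H : Fin N → EuclideanSpace ℝ (Fin d)}
    (hΞ : SupportedIn J Ξ) (hH : SupportedIn J H) :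
    ‖manyExpect hbar (D (σ * lam)) Ξ H - prodExpect hbar (F (σ * lam)) Ξ H‖ ≤
      8 * (τ / N) * (3 / 2 * M) ^ J.card * weight β' κ β' lam Ξ H := by
  have hM := h.one_le_M
  have hM0 : 0 ≤ M := by linarith
  have hκ := h.kappa_pos
  have hτ := h.tau_nonneg
  have hC := h.moment.nonneg
  have hNpos : 0 < (N : ℝ) := by exact_mod_cast Nat.pos_of_ne_zero hN
  have hCM : 4 * (C * M) ≤ κ * τ := by linarith [h.coupling]
  refine norm_le_of_rate
    (Q := fun t Ξ H => manyExpect hbar (D t) Ξ H - prodExpect hbar (F t) Ξ H)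
    (R := fun s Ξ H => manyRate hbar Φhat (D s) Ξ H - ∑ k, meanRate hbar Φhat (F s) Ξ H k) (b₀ := 2)
    (a := fun j => 0)
    (S := fun j => C * (4 * (j / N) * M ^ j + 8 * (τ / N) * (3 / 2 * M) ^ (j + 1)))
    (G := fun j => 8 * (τ / N) * (3 / 2 * M) ^ j)
    hM hκ h.beta_nonneg h.kappa_lam h.abs_sigma zero_le_two
    (fun t Ξ H => ?_)
    (fun j => by positivity) (fun j => by positivity) (fun j => ?_) (fun J Ξ H hΞ hH => ?_)
    (fun t Ξ H => ?_)
    (fun b hb s hs hsl hyp J Ξ H hΞ hH => ?_) (fun j => le_rfl) h.lam_nonneg hΞ hH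
  · have h1 := nBody_integral h.hbar_pos.ne' h.fourier h.nBody Ξ H
    have h2 := prodExpect_integral h.hbar_pos.ne' h.fourier h.hartree Ξ H
    have h3 := intervalIntegral.integral_sub (h1.1 t) (h2.1 t)
    simp only [manyRate]
    rw [h3, h1.2 t, h2.2 t]
    ring
  · -- the constants close because `j ≤ (3/2)^j` and `4 C M ≤ κ τ`
    have h1 : C ≤ κ * τ / 4 / M := by
      rw [le_div_iff₀ (by linarith)]
      linarith
    have h2 : 2 / κ * (C * (4 * (j / N) * M ^ j + 8 * (τ / N) * (3 / 2 * M) ^ (j + 1))) ≤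
        2 / κ * (κ * τ / 4 / M * (4 * (j / N) * M ^ j + 8 * (τ / N) * (3 / 2 * M) ^ (j + 1))) := by
      gcongr
    have h3 : 2 / κ * (κ * τ / 4 / M * (4 * (j / N) * M ^ j + 8 * (τ / N) * (3 / 2 * M) ^ (j + 1))) =
        2 * (τ / N) * (j * M ^ j / M) + 6 * (τ / N) * (3 / 2 * M) ^ j * τ := by
      have : M ≠ 0 := by positivity
      rw [pow_succ]
      field_simp
      ring
    have h4 : j * M ^ j / M ≤ (3 / 2 * M) ^ j := by
      rw [mul_pow]
      refine (div_le_self (by positivity) hM).trans ?_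
      exact mul_le_mul_of_nonneg_right (cast_le_three_halves_pow j) (by positivity)
    have h5 : 6 * (τ / N) * (3 / 2 * M) ^ j * τ ≤ 6 * (τ / N) * (3 / 2 * M) ^ j :=
      mul_le_of_le_one_right (by positivity) h.tau_le
    have h6 := mul_le_mul_of_nonneg_left h4 (by positivity : 0 ≤ 2 * (τ / N))
    linarith
  · rw [h.initial, sub_self, norm_zero, zero_mul]
  · have h1 := norm_expect_weylOp_le (hbar := hbar) (h.nBody.density t) (join Ξ) (join H)
    have h2 := MeanField.norm_prodExpect_le (hbar := hbar) (h.density t) Ξ H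
    exact (norm_sub_le _ _).trans (by rw [manyExpect]; linarith)
  · have hs1 := hsl.trans h.lam_le
    have hdat := h.mono hs hsl
    rw [h.rate_difference (σ * s) hΞ hH hN]
    set Y := C * envelope β' κ (2 * M ^ J.card) 0 s Ξ H with hY
    set Z := C * envelope β' κ (8 * (τ / N) * (3 / 2 * M) ^ (J.card + 1))
      (b * M ^ (J.card + 1)) s Ξ H with hZ
    have hZ0 : 0 ≤ Z := mul_nonneg hC (envelope_nonneg (by positivity) (by positivity) _ _)
    have h1 := norm_sum_pairs_le hH (Y := Y)
      (G := pairRate hbar Φhat (manyExpect hbar (D (σ * s))) Ξ H) fun k hk l hl => by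
        refine norm_pairRate_le h.moment h.hbar_pos h.beta_nonneg hs hs1 (by positivity)
          le_rfl fun x => ?_
        rw [envelope, zero_mul, add_zero]
        exact hdat.norm_manyExpect_le (hΞ.add_pair hk hl x) hH
    have h2 := norm_sum_cross_le hH (Y := Z)
      (G := pairRate hbar Φhat (fun Ξ H => manyExpect hbar (D (σ * s)) Ξ H -
        prodExpect hbar (F (σ * s)) Ξ H) Ξ H) fun k hk l hl => by
        refine norm_pairRate_le h.moment h.hbar_pos h.beta_nonneg hs hs1 (by positivity)
          (by positivity) fun x => ?_
        have h3 := hyp (insert l J) _ H ((hΞ.mono (Finset.subset_insert l J)).add_pair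
          (Finset.mem_insert_of_mem hk) (Finset.mem_insert_self l J) x)
          (hH.mono (Finset.subset_insert l J))
        rw [card_insert_of_mem_compl hl] at h3
        exact h3
    have h3 : ‖(J.card / N : ℂ) * ∑ k ∈ J, meanRate hbar Φhat (F (σ * s)) Ξ H k‖ ≤
        size H * ((J.card / N : ℝ) * Y) := by
      have h4 : ‖∑ k ∈ J, meanRate hbar Φhat (F (σ * s)) Ξ H k‖ ≤ ∑ k ∈ J, ‖H k‖ * Y := by
        refine norm_sum_le_of_le _ fun k hk => ?_
        refine norm_meanRate_le (h.density _) h.moment h.hbar_pos h.beta_nonneg hs hs1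
          (by positivity) le_rfl fun x => ?_
        rw [envelope, zero_mul, add_zero]
        exact hdat.norm_prodExpect_le (hΞ.add_single hk x) hH
      rw [← Finset.sum_mul, ← hH.size_eq] at h4
      rw [norm_mul, norm_div, Complex.norm_natCast, Complex.norm_natCast]
      calc (J.card / N : ℝ) * _ ≤ (J.card / N : ℝ) * (size H * Y) := by gcongr
        _ = _ := by ring
    have h5 : (Jᶜ.card / N : ℝ) * Z ≤ Z := mul_le_of_le_one_left hZ0 (by
      have := card_add_card_compl_div_le J
      have : 0 ≤ (J.card / N : ℝ) := by positivity
      linarith)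
    have h6 : (J.card / N : ℝ) * Y + Z + (J.card / N : ℝ) * Y ≤
        C * (4 * (J.card / N) * M ^ J.card + 8 * (τ / N) * (3 / 2 * M) ^ (J.card + 1)) *
          weight β' κ β' s Ξ H + b * M ^ J.card * (κ / 4) * weight β' κ 0 s Ξ H := by
      have h7 : C * M ≤ κ / 4 := by
        have : κ * τ ≤ κ := mul_le_of_le_one_right hκ.le h.tau_le
        linarith
      have h8 : C * (b * M ^ (J.card + 1)) ≤ b * M ^ J.card * (κ / 4) := by
        calc C * (b * M ^ (J.card + 1)) = b * M ^ J.card * (C * M) := by ring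
          _ ≤ _ := by gcongr
      have h9 := mul_le_mul_of_nonneg_right h8 (weight_pos β' κ 0 s Ξ H).le
      simp only [hY, hZ, envelope]
      linarith
    calc _ ≤ size H * ((J.card / N : ℝ) * Y) + size H * ((Jᶜ.card / N : ℝ) * Z) +
          size H * ((J.card / N : ℝ) * Y) :=
        (norm_sub_le _ _).trans (add_le_add ((norm_add_le _ _).trans (add_le_add h1 h2)) h3)
      _ = size H * ((J.card / N : ℝ) * Y + (Jᶜ.card / N : ℝ) * Z + (J.card / N : ℝ) * Y) := by ring
      _ ≤ _ := mul_le_mul_of_nonneg_left (by linarith) (size_nonneg H)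

end Chaos

/-! ### From Wigner transforms to the analytic norms -/

section Norms

set_option linter.unusedSectionVars false

variable {N j d : ℕ} {hbar β β' : ℝ} {Φhat : EuclideanSpace ℝ (Fin d) → ℂ}

/-- The first `j` of `N` particles. -/
def firstParticles (hjN : j ≤ N) : Finset (Fin N) := Finset.univ.map (Fin.castLEEmb hjN)

lemma card_firstParticles (hjN : j ≤ N) : (firstParticles hjN).card = j := by
  simp [firstParticles]

lemma supportedIn_extendZero (hjN : j ≤ N) (X : Fin j → EuclideanSpace ℝ (Fin d)) :
    SupportedIn (firstParticles hjN) (extendZero N X) := by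
  intro k hk
  refine dif_neg fun h => hk ?_
  exact Finset.mem_map.2 ⟨⟨k, h⟩, Finset.mem_univ _, by ext; rfl⟩

lemma extendZero_castLE (hjN : j ≤ N) (X : Fin j → EuclideanSpace ℝ (Fin d)) (k : Fin j) :
    extendZero N X (Fin.castLEEmb hjN k) = X k := by
  have h : ((Fin.castLEEmb hjN k : Fin N) : ℕ) < j := k.2
  rw [extendZero, dif_pos h]
  rfl

lemma size_extendZero (hjN : j ≤ N) (X : Fin j → EuclideanSpace ℝ (Fin d)) :
    size (extendZero N X) = size X := by
  rw [(supportedIn_extendZero hjN X).size_eq, firstParticles, Finset.sum_map, size]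
  simp_rw [extendZero_castLE]

lemma prodExpect_extendZero {D : L2 (Fin d) →L[ℂ] L2 (Fin d)} (hD : IsDensityOperator D)
    (hjN : j ≤ N) (Ξ H : Fin j → EuclideanSpace ℝ (Fin d)) :
    prodExpect hbar D (extendZero N Ξ) (extendZero N H) = prodExpect hbar D Ξ H := by
  have h1 : prodExpect hbar D (extendZero N Ξ) (extendZero N H) =
      ∏ k ∈ firstParticles hjN, expect D (weylOp hbar (extendZero N Ξ k) (extendZero N H k)) := by
    refine (Finset.prod_subset (Finset.subset_univ _) fun k _ hk => ?_).symm
    rw [supportedIn_extendZero hjN Ξ k hk, supportedIn_extendZero hjN H k hk, weylOp_zero,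
      expect_id hD]
  rw [h1, firstParticles, Finset.prod_map, prodExpect]
  simp_rw [extendZero_castLE]

lemma wignerNorm_le {ι : Type} [Fintype ι] {size : EuclideanSpace ℝ ι → ℝ} {A : L2 ι → L2 ι} {B : ℝ}
    (h : ∀ ξ η, ‖wignerFourier hbar A ξ η‖ * Real.exp (β * (size ξ + size η)) ≤ B) :
    wignerNorm hbar β size A ≤ ENNReal.ofReal B := by
  refine iSup_le fun ξ => iSup_le fun η => ?_
  rw [← ofReal_norm, ← ENNReal.ofReal_mul (norm_nonneg _)]
  exact ENNReal.ofReal_le_ofReal (h ξ η)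

lemma norm_wignerFourier_le {ι : Type} [Fintype ι] {size : EuclideanSpace ℝ ι → ℝ}
    {A : L2 ι → L2 ι} (h : wignerNorm hbar β size A < ∞) (ξ η : EuclideanSpace ℝ ι) :
    ‖wignerFourier hbar A ξ η‖ * Real.exp (β * (size ξ + size η)) ≤
      (wignerNorm hbar β size A).toReal := by
  rw [← ENNReal.ofReal_le_iff_le_toReal h.ne, ENNReal.ofReal_mul (norm_nonneg _), ofReal_norm]
  exact le_iSup₂_of_le (f := fun ξ η => ‖wignerFourier hbar A ξ η‖ₑ *
    ENNReal.ofReal (Real.exp (β * (size ξ + size η)))) ξ η le_rfl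

lemma norm_expect_le_of_oneNorm {D : L2 (Fin d) →L[ℂ] L2 (Fin d)} (hD : IsDensityOperator D)
    (h : oneNorm hbar β D < ∞) (ξ η : EuclideanSpace ℝ (Fin d)) :
    ‖expect D (weylOp hbar ξ η)‖ ≤ (oneNorm hbar β D).toReal * Real.exp (-β * (‖ξ‖ + ‖η‖)) := by
  have h1 := norm_wignerFourier_le h ξ η
  rw [wignerFourier_eq_expect hD, ← le_div_iff₀ (Real.exp_pos _)] at h1
  refine h1.trans_eq ?_
  rw [neg_mul, Real.exp_neg]
  rfl

/-- The norm of a density operator is at least its trace, the value of the transform at the origin. -/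
lemma one_le_oneNorm {D : L2 (Fin d) →L[ℂ] L2 (Fin d)} (hD : IsDensityOperator D)
    (h : oneNorm hbar β D < ∞) : 1 ≤ (oneNorm hbar β D).toReal := by
  have h1 := norm_expect_le_of_oneNorm hD h 0 0
  simpa [weylOp_zero, expect_id hD] using h1

/-- Finiteness of `C_Φ(s)` at a single `s` gives the exponential moment at `s = 0`, with the constant
`C_Φ(s)`. -/
lemma momentBound_of_CPhi {Φ : EuclideanSpace ℝ (Fin d) → ℝ} (hΦ : HasFourierTransform Φ Φhat)
    (hβ : 0 ≤ β') {s : ℝ} (h : CPhi Φhat β' s < ∞) :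
    MomentBound Φhat β' (CPhi Φhat β' s).toReal := by
  have hm : AEStronglyMeasurable (fun h => ‖h‖ * ‖Φhat h‖ * Real.exp (2 * β' * ‖h‖)) volume := by
    refine (continuous_norm.aestronglyMeasurable.mul hΦ.1.1.norm).mul
      (Continuous.aestronglyMeasurable ?_)
    fun_prop
  have hle : ∫⁻ h, ‖‖h‖ * ‖Φhat h‖ * Real.exp (2 * β' * ‖h‖)‖ₑ ≤ CPhi Φhat β' s := by
    refine lintegral_mono fun h => ?_
    rw [enorm_mul, enorm_mul, enorm_norm, enorm_norm, Real.enorm_of_nonneg (Real.exp_pos _).le]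
    refine mul_le_mul' le_rfl (ENNReal.ofReal_le_ofReal (Real.exp_le_exp.2 ?_))
    nlinarith [mul_nonneg (mul_nonneg hβ (abs_nonneg s)) (norm_nonneg h)]
  have hint : Integrable fun h => ‖h‖ * ‖Φhat h‖ * Real.exp (2 * β' * ‖h‖) :=
    ⟨hm, hle.trans_lt h⟩
  refine ⟨ENNReal.toReal_nonneg, hint, ?_⟩
  rw [integral_eq_lintegral_of_nonneg_ae (ae_of_all _ fun h => by positivity) hm]
  refine ENNReal.toReal_mono h.ne ((lintegral_mono fun h => ?_).trans hle)
  rw [Real.enorm_of_nonneg (by positivity)]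

/-- Decay of the weight at the final time, on the scale of the norm of index `β`. -/
lemma weight_mul_exp_le {κ lam : ℝ} {β₀ : ℝ} (hβ : 0 < β) (h0 : β < β₀) (h1 : β₀ < β')
    (hκ : κ * lam = β' - β₀) (hlam : lam ≤ timeT β β₀) (Ξ H : Fin N → EuclideanSpace ℝ (Fin d)) :
    weight β' κ β' lam Ξ H * Real.exp (β * (size Ξ + size H)) ≤ 1 := by
  rw [weight, ← Real.exp_add, Real.exp_le_one_iff]
  have h2 : β ≤ β' * (1 - lam) := by
    have hb : 0 < β₀ := hβ.trans h0
    have h3 : β / β₀ ≤ 1 - lam := by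
      have : timeT β β₀ = 1 - β / β₀ := by rw [timeT, sub_div, div_self hb.ne']
      linarith
    calc β = β₀ * (β / β₀) := by field_simp
      _ ≤ β' * (1 - lam) := mul_le_mul h1.le h3 (by positivity) (by linarith)
  rw [hκ]
  nlinarith [mul_nonneg (by linarith : 0 ≤ β' * (1 - lam) - β) (size_nonneg Ξ),
    mul_nonneg (by linarith : 0 ≤ β₀ - β) (size_nonneg H)]

/-- The equation for `β₀` among real numbers. -/
lemma IsBetaZero.real_eq {α β₀ : ℝ} (hβ : 0 < β) (h : IsBetaZero α β β' Φhat β₀) :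
    0 < timeT β β₀ ∧ timeT β β₀ < 1 ∧ CPhi Φhat β' (timeT β β₀) < ∞ ∧
    2 * (1 + timeT β β₀) * timeT β β₀ * (CPhi Φhat β' (timeT β β₀)).toReal * Real.exp α =
      β' - β₀ := by
  obtain ⟨h0, h1, h2⟩ := h
  have hb : 0 < β₀ := hβ.trans h0
  have hT : 0 < timeT β β₀ := div_pos (by linarith) hb
  have hT1 : timeT β β₀ < 1 := by
    rw [timeT, div_lt_one hb]
    linarith
  set T := timeT β β₀
  have hx : 0 < 2 * (1 + T) * T := by positivity
  have hfin : CPhi Φhat β' T < ∞ := by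
    rw [lt_top_iff_ne_top]
    intro htop
    rw [htop, ENNReal.mul_top (ENNReal.ofReal_pos.2 hx).ne',
      ENNReal.top_mul (ENNReal.ofReal_pos.2 (Real.exp_pos _)).ne'] at h2
    exact ENNReal.ofReal_ne_top h2.symm
  refine ⟨hT, hT1, hfin, ?_⟩
  have h3 := congrArg ENNReal.toReal h2
  rwa [ENNReal.toReal_mul, ENNReal.toReal_mul, ENNReal.toReal_ofReal hx.le,
    ENNReal.toReal_ofReal (Real.exp_pos _).le, ENNReal.toReal_ofReal (by linarith)] at h3

/-- The convergence estimate, with a constant which is smaller than `C(j, τ)`. -/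
theorem manyNorm_difference_le {hbar : ℝ} (hb : 0 < hbar) {Φ : EuclideanSpace ℝ (Fin d) → ℝ}
    (hΦe : ∀ x, Φ (-x) = Φ x) (hΦ : HasFourierTransform Φ Φhat) {β β' : ℝ} (hβ : 0 < β)
    {Fin₀ : L2 (Fin d) →L[ℂ] L2 (Fin d)} (hFin : IsDensityOperator Fin₀)
    (hfin : oneNorm hbar β' Fin₀ < ∞) {M α : ℝ} (hM : M = (oneNorm hbar β' Fin₀).toReal)
    (hα : α = Real.log M + Real.log 2) {F : ℝ → L2 (Fin d) →L[ℂ] L2 (Fin d)}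
    (hF : IsHartreeSolution hbar Φ F) (hF0 : F 0 = Fin₀)
    {D : ℝ → L2 (Fin N × Fin d) →L[ℂ] L2 (Fin N × Fin d)} (hD : IsNBodySolution hbar Φ N D)
    (hD0 : ∀ Ψ, D 0 Ψ = tensorPow N Fin₀ Ψ) {β₀ t : ℝ} (hβ₀ : IsBetaZero α β β' Φhat β₀)
    (ht : |t| < timeT β β₀) (hj : 1 ≤ j) (hjN : j ≤ N)
    {Dj : L2 (Fin j × Fin d) →L[ℂ] L2 (Fin j × Fin d)} (hDj : IsMarginal (D t) Dj) :
    manyNorm hbar β (fun Ψ => Dj Ψ - tensorPow j (F t) Ψ) ≤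
      ENNReal.ofReal (8 * (|t| / timeT β β₀ / N) * (3 / 2 * M) ^ j) := by
  obtain ⟨hT, hT1, hCfin, heq⟩ := hβ₀.real_eq hβ
  obtain ⟨h0, h1, -⟩ := hβ₀
  set T := timeT β β₀ with hTdef
  set C := (CPhi Φhat β' T).toReal
  have hM1 : 1 ≤ M := hM ▸ one_le_oneNorm hFin hfin
  have hN : N ≠ 0 := by omega
  have hβ' : 0 < β' := by linarith
  have hFd := (hartree_integral hb.ne' hΦ hF).1
  obtain ⟨Tj, hTj, hTjeq, hTjW⟩ := exists_tensorPow j (hFd t)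
  obtain ⟨TN, hTN, hTNeq, hTNW⟩ := exists_tensorPow N hFin
  have hDTN : D 0 = TN := ContinuousLinearMap.ext fun Ψ => (hD0 Ψ).trans (hTNeq Ψ)
  have hinit : ∀ Ξ H, manyExpect hbar (D 0) Ξ H = prodExpect hbar (F 0) Ξ H := fun Ξ H => by
    rw [manyExpect, hDTN, hTNW, hF0, prodExpect]
  have hfun : (fun Ψ => Dj Ψ - tensorPow j (F t) Ψ) = fun Ψ => Dj Ψ - Tj Ψ :=
    funext fun Ψ => by rw [hTjeq]
  have hmain : ∀ Ξ H : Fin N → EuclideanSpace ℝ (Fin d),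
      SupportedIn (firstParticles hjN) Ξ → SupportedIn (firstParticles hjN) H →
      ‖manyExpect hbar (D t) Ξ H - prodExpect hbar (F t) Ξ H‖ *
        Real.exp (β * (size Ξ + size H)) ≤ 8 * (|t| / T / N) * (3 / 2 * M) ^ j := by
    intro Ξ H hΞ hH
    rcases eq_or_ne t 0 with rfl | ht0
    · rw [hinit, sub_self, norm_zero, zero_mul]
      positivity
    · have hlam : 0 < |t| := abs_pos.2 ht0
      have hσ : |t / (|t|)| = 1 := by rw [abs_div, abs_abs, div_self hlam.ne']
      have hσt : t / |t| * |t| = t := div_mul_cancel₀ _ hlam.ne'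
      have hκ : (β' - β₀) / |t| * |t| = β' - β₀ := div_mul_cancel₀ _ hlam.ne'
      have hexp : Real.exp α = 2 * M := by
        rw [hα, Real.exp_add, Real.exp_log (by linarith), Real.exp_log two_pos, mul_comm]
      have hdat : ChaosData hbar β' ((β' - β₀) / |t|) C M (|t| / T) |t| (t / |t|) Φ Φhat F D :=
        { hbar_pos := hb
          fourier := hΦ
          even := hΦe
          hartree := hF
          nBody := hD
          initial := hinit
          initial_le := fun ξ η => by
            rw [hF0, hM]
            exact norm_expect_le_of_oneNorm hFin hfin ξ η
          moment := momentBound_of_CPhi hΦ hβ'.le hCfin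
          beta_nonneg := hβ'.le
          kappa_pos := div_pos (by linarith) hlam
          one_le_M := hM1
          tau_nonneg := by positivity
          tau_le := (div_le_one hT).2 ht.le
          -- the equation for `β₀` gives this with the factor `1 + T` to spare
          coupling := by
            have hC0 : 0 ≤ C := ENNReal.toReal_nonneg
            rw [← heq, hexp]
            have e : 2 * (1 + T) * T * C * (2 * M) / |t| * (|t| / T) = 4 * C * M * (1 + T) := by
              field_simp
              ring
            rw [e]
            exact le_mul_of_one_le_right (by positivity) (by linarith)
          lam_nonneg := hlam.le
          lam_le := by linarith
          kappa_lam := by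
            rw [hκ]
            linarith
          abs_sigma := hσ }
      have h2 := hdat.norm_difference_le hN hΞ hH
      rw [hσt, card_firstParticles] at h2
      have h3 := weight_mul_exp_le hβ h0 h1 hκ ht.le Ξ H
      calc _ ≤ _ := mul_le_mul_of_nonneg_right h2 (Real.exp_pos _).le
        _ = 8 * (|t| / T / N) * (3 / 2 * M) ^ j *
            (weight β' ((β' - β₀) / |t|) β' |t| Ξ H * Real.exp (β * (size Ξ + size H))) := by ring
        _ ≤ _ := mul_le_of_le_one_right (by positivity) h3
  rw [hfun]
  refine wignerNorm_le fun ξ η => ?_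
  have h2 := hmain _ _ (supportedIn_extendZero hjN (particle ξ))
    (supportedIn_extendZero hjN (particle η))
  rw [← hDj.manyExpect_eq (hD.density t), prodExpect_extendZero (hFd t) hjN, size_extendZero hjN,
    size_extendZero hjN, prodExpect, ← hTjW] at h2
  rw [wignerFourier_sub hDj.1 hTj]
  exact h2

end Norms

/-! ### The equation for `β₀` -/

section BetaZero

variable {d : ℕ} {Φ : EuclideanSpace ℝ (Fin d) → ℝ} {Φhat : EuclideanSpace ℝ (Fin d) → ℂ}
  {β β' : ℝ}

lemma CPhi_mono (hβ : 0 ≤ β') {s s' : ℝ} (hs : |s| ≤ |s'|) :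
    CPhi Φhat β' s ≤ CPhi Φhat β' s' := by
  refine lintegral_mono fun h => ?_
  gcongr

/-- If the integral vanishes, then so do `Φhat` almost everywhere and `Φ`; in dimension `0` the factor
`|h|` would vanish identically. -/
lemma CPhi_pos (hd : 0 < d) (hΦ : HasFourierTransform Φ Φhat) (hΦ0 : Φ ≠ 0) (s : ℝ) :
    0 < CPhi Φhat β' s := by
  have : Nonempty (Fin d) := ⟨⟨0, hd⟩⟩
  rw [pos_iff_ne_zero]
  intro h
  have hm : AEMeasurable (fun h => ‖h‖ₑ * ‖Φhat h‖ₑ *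
      ENNReal.ofReal (Real.exp (2 * β' * (1 + |s|) * ‖h‖))) volume := by
    refine (continuous_enorm.aemeasurable.mul hΦ.1.1.enorm).mul ?_
    exact (Measurable.ennreal_ofReal (by fun_prop)).aemeasurable
  have h1 := (lintegral_eq_zero_iff' hm).1 h
  have h2 : Φhat =ᵐ[volume] 0 := by
    have h3 : ∀ᵐ x : EuclideanSpace ℝ (Fin d), x ≠ 0 := by
      simp [ae_iff]
    filter_upwards [h1, h3] with x hx hx0
    have hexp : ENNReal.ofReal (Real.exp (2 * β' * (1 + |s|) * ‖x‖)) ≠ 0 :=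
      (ENNReal.ofReal_pos.2 (Real.exp_pos _)).ne'
    simpa [hexp, hx0] using hx
  refine hΦ0 (funext fun x => ?_)
  have h4 : (Φ x : ℂ) = 0 := by
    rw [hΦ.2]
    refine integral_eq_zero_of_ae ?_
    filter_upwards [h2] with y hy
    simp [hy]
  simpa using h4

/-- Dominated convergence, with the integrand at the endpoint `s₁` as dominating function. -/
lemma continuousOn_CPhi (hΦ : HasFourierTransform Φ Φhat) (hβ : 0 ≤ β') {s₁ : ℝ} (hs₁ : 0 ≤ s₁)
    (h : CPhi Φhat β' s₁ < ∞) :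
    ContinuousOn (fun s => (CPhi Φhat β' s).toReal) (Set.Icc 0 s₁) := by
  have hm : ∀ s : ℝ, AEStronglyMeasurable
      (fun h => ‖h‖ * ‖Φhat h‖ * Real.exp (2 * β' * (1 + |s|) * ‖h‖)) volume := fun s => by
    refine (continuous_norm.aestronglyMeasurable.mul hΦ.1.1.norm).mul
      (Continuous.aestronglyMeasurable ?_)
    fun_prop
  have henorm : ∀ s : ℝ, ∫⁻ h, ‖‖h‖ * ‖Φhat h‖ * Real.exp (2 * β' * (1 + |s|) * ‖h‖)‖ₑ =
      CPhi Φhat β' s := fun s => by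
    refine lintegral_congr fun h => ?_
    rw [enorm_mul, enorm_mul, enorm_norm, enorm_norm, Real.enorm_of_nonneg (Real.exp_pos _).le]
  have heq : ∀ s, (CPhi Φhat β' s).toReal =
      ∫ h, ‖h‖ * ‖Φhat h‖ * Real.exp (2 * β' * (1 + |s|) * ‖h‖) := fun s => by
    rw [integral_eq_lintegral_of_nonneg_ae (ae_of_all _ fun h => by positivity) (hm s), ← henorm]
    congr 1
    refine lintegral_congr fun h => ?_
    rw [Real.enorm_of_nonneg (by positivity)]
  simp_rw [heq]
  refine continuousOn_of_dominated
    (bound := fun h => ‖h‖ * ‖Φhat h‖ * Real.exp (2 * β' * (1 + |s₁|) * ‖h‖))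
    (fun s _ => hm s) (fun s hs => ae_of_all _ fun h => ?_) ⟨hm s₁, by
      rw [HasFiniteIntegral, henorm]; exact h⟩ (ae_of_all _ fun h => ?_)
  · rw [Real.norm_of_nonneg (by positivity), abs_of_nonneg hs.1, abs_of_nonneg hs₁]
    have := hs.2
    gcongr
  · exact Continuous.continuousOn (by fun_prop)

/-- Existence and uniqueness of `β₀`: the two sides of the equation are monotone and continuous
functions of `β₀`. -/
theorem existsUnique_betaZero (hd : 0 < d) (hΦ : HasFourierTransform Φ Φhat) (hβ : 0 < β)
    (hβ' : β < β') (α : ℝ) (hΦ0 : Φ ≠ 0) (hfin : CPhi Φhat β' ((β' - β) / β') < ∞) :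
    ∃! β₀, IsBetaZero α β β' Φhat β₀ := by
  have hβ'0 : 0 < β' := hβ.trans hβ'
  set s₁ := (β' - β) / β' with hs₁
  have hs₁0 : 0 < s₁ := div_pos (by linarith) hβ'0
  set c : ℝ → ℝ := fun s => (CPhi Φhat β' s).toReal with hc
  have hT : ∀ b ∈ Set.Icc β β', 0 ≤ timeT β b ∧ timeT β b ≤ s₁ := fun b hb => by
    have hb0 : 0 < b := hβ.trans_le hb.1
    refine ⟨div_nonneg (by linarith [hb.1]) hb0.le, ?_⟩
    rw [timeT, hs₁, div_le_div_iff₀ hb0 hβ'0]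
    nlinarith [hb.2]
  have hTmono : ∀ a ∈ Set.Icc β β', ∀ b ∈ Set.Icc β β', a ≤ b → timeT β a ≤ timeT β b :=
    fun a ha b hb hab => by
      have ha0 : 0 < a := hβ.trans_le ha.1
      rw [timeT, timeT, div_le_div_iff₀ ha0 (ha0.trans_le hab)]
      nlinarith
  have hcfin : ∀ s, 0 ≤ s → s ≤ s₁ → CPhi Φhat β' s < ∞ := fun s h0 h1 =>
    (CPhi_mono hβ'0.le (by rwa [abs_of_nonneg h0, abs_of_nonneg hs₁0.le])).trans_lt hfin
  have hcmono : ∀ s s', 0 ≤ s → s ≤ s' → s' ≤ s₁ → c s ≤ c s' := fun s s' h0 h1 h2 =>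
    ENNReal.toReal_mono (hcfin s' (h0.trans h1) h2).ne
      (CPhi_mono hβ'0.le (by rwa [abs_of_nonneg h0, abs_of_nonneg (h0.trans h1)]))
  -- The difference of the two sides is negative at `β` and positive at `β'`.
  set g : ℝ → ℝ := fun b => 2 * (1 + timeT β b) * timeT β b * c (timeT β b) * Real.exp α -
    (β' - b) with hg
  have hgmono : StrictMonoOn g (Set.Icc β β') := by
    intro a ha b hb hab
    have h1 := hTmono a ha b hb hab.le
    have h2 := hcmono _ _ (hT a ha).1 h1 (hT b hb).2
    have h3 := (hT a ha).1
    have h4 : 0 ≤ c (timeT β a) := ENNReal.toReal_nonneg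
    have h5 : 2 * (1 + timeT β a) * timeT β a * c (timeT β a) * Real.exp α ≤
        2 * (1 + timeT β b) * timeT β b * c (timeT β b) * Real.exp α := by
      have := h3.trans h1
      gcongr
    simp only [hg]
    linarith
  have hgcont : ContinuousOn g (Set.Icc β β') := by
    have hTc : ContinuousOn (timeT β) (Set.Icc β β') := by
      refine ContinuousOn.div (by fun_prop) continuousOn_id fun b hb => ?_
      exact (hβ.trans_le hb.1).ne'
    have hcc : ContinuousOn (fun b => c (timeT β b)) (Set.Icc β β') :=
      (continuousOn_CPhi hΦ hβ'0.le hs₁0.le hfin).comp hTc fun b hb => hT b hb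
    exact ((((continuousOn_const.mul (continuousOn_const.add hTc)).mul hTc).mul hcc).mul
      continuousOn_const).sub (by fun_prop)
  have hiff : ∀ b, IsBetaZero α β β' Φhat b ↔ b ∈ Set.Ioo β β' ∧ g b = 0 := by
    intro b
    rw [IsBetaZero, ← and_assoc, Set.mem_Ioo]
    refine and_congr_right fun hb => ?_
    have hb' : b ∈ Set.Icc β β' := ⟨hb.1.le, hb.2.le⟩
    obtain ⟨h0, h1⟩ := hT b hb'
    rw [← ENNReal.ofReal_toReal (hcfin _ h0 h1).ne, ← ENNReal.ofReal_mul (by positivity),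
      ← ENNReal.ofReal_mul (mul_nonneg (by positivity) ENNReal.toReal_nonneg),
      ENNReal.ofReal_eq_ofReal_iff
        (mul_nonneg (mul_nonneg (by positivity) ENNReal.toReal_nonneg) (Real.exp_pos _).le)
        (by linarith [hb.2])]
    exact sub_eq_zero.symm
  have hgβ : g β < 0 := by
    simp only [hg, timeT, sub_self, zero_div, mul_zero, zero_mul]
    linarith
  have hgβ' : 0 < g β' := by
    have hcpos : 0 < c s₁ := ENNReal.toReal_pos (CPhi_pos hd hΦ hΦ0 s₁).ne' hfin.ne
    have : timeT β β' = s₁ := rfl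
    simp only [hg, this, sub_self, sub_zero]
    positivity
  obtain ⟨b, hb, hb0⟩ := intermediate_value_Ioo hβ'.le hgcont ⟨hgβ, hgβ'⟩
  refine ⟨b, (hiff b).2 ⟨hb, hb0⟩, fun b' hb' => ?_⟩
  obtain ⟨h1, h2⟩ := (hiff b').1 hb'
  exact hgmono.injOn (Set.Ioo_subset_Icc_self h1) (Set.Ioo_subset_Icc_self hb) (h2.trans hb0.symm)

end BetaZero

/-! ### The constant `C(j, τ)` -/

section Constant

variable {τ : ℝ}

lemma one_le_xMax (a : ℝ) : 1 ≤ xMax a := by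
  have h : a ≤ Real.sqrt (a ^ 2 + 4) := Real.le_sqrt_of_sq_le (by linarith)
  rw [xMax]
  linarith

/-- No exception is needed at `τ = 0`: there the quotient in the exponent is `0`, since `Real.log 0` and
division by `0` are `0`, and `γ(j, 0) = 1`. -/
lemma one_le_gammaConst (hτ : 0 ≤ τ) (hτ1 : τ < 1) (j : ℕ) : 1 ≤ gammaConst j τ := by
  refine Real.one_le_exp ?_
  have hlog : 0 ≤ Real.log (1 / τ) := by
    rw [one_div, Real.log_inv, neg_nonneg]
    exact Real.log_nonpos hτ hτ1.le
  have := one_le_xMax (((j : ℝ) + 1) * Real.log (1 / τ))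
  positivity

/-- The comparison with `C(j, τ)`: since `γ ≥ 1`, the terms at `j = 1`, `τ = 0` already give
`2 * 2 + 4 = 8`. -/
lemma eight_mul_le_constC (hτ : 0 ≤ τ) (hτ1 : τ < 1) {j : ℕ} (hj : 1 ≤ j) :
    8 * 2 ^ j ≤ constC j τ := by
  have h1 : 0 < 1 - τ := by linarith
  have hg := one_le_gammaConst hτ hτ1 j
  have hj' : (1 : ℝ) ≤ j := by exact_mod_cast hj
  have h2 : 2 ≤ ((j : ℝ) + 1) / (1 - τ) ^ 2 := by
    rw [le_div_iff₀ (by positivity)]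
    nlinarith
  have h3 : 4 ≤ 4 / (1 - τ) := by
    rw [le_div_iff₀ h1]
    linarith
  have h4 : 0 ≤ 2 * τ / (1 - τ) ^ 3 := by positivity
  have h5 : 8 ≤ (1 + gammaConst j τ) * (((j : ℝ) + 1) / (1 - τ) ^ 2 + 2 * τ / (1 - τ) ^ 3) +
      4 / (1 - τ) := by nlinarith
  rw [constC, mul_comm]
  gcongr

lemma constC_pos (hτ : 0 ≤ τ) (hτ1 : τ < 1) (j : ℕ) : 0 < constC j τ := by
  have h1 : 0 < 1 - τ := by linarith
  have hg := one_le_gammaConst hτ hτ1 j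
  rw [constC]
  positivity

/-- The exponent in `γ(j, τ)` is asymptotic, up to `o(1)`, to its value at `x = 1`. -/
lemma tendsto_xMax_exponent : Tendsto (fun a : ℝ =>
    (a * xMax a + xMax a ^ 2) / Real.exp (xMax a) - (a + 1) / Real.exp 1) atTop (𝓝 0) := by
  -- `x(a) = 1 + δ(a)` with `0 ≤ δ(a) ≤ 1 / a`
  set δ : ℝ → ℝ := fun a => (Real.sqrt (a ^ 2 + 4) - a) / 2 with hδ
  have hδ0 : ∀ a, 0 ≤ δ a := fun a => by
    have := one_le_xMax a
    simp only [xMax] at this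
    simp only [hδ]
    linarith
  have hδ1 : ∀ a, 0 < a → a * δ a ≤ 1 := fun a ha => by
    have h1 : Real.sqrt (a ^ 2 + 4) ≤ a + 2 / a := by
      rw [Real.sqrt_le_left (by positivity)]
      have : (a + 2 / a) ^ 2 = a ^ 2 + 4 + (2 / a) ^ 2 := by
        field_simp
        ring
      rw [this]
      linarith [sq_nonneg (2 / a)]
    simp only [hδ]
    have h2 : a * (2 / a) = 2 := by field_simp
    nlinarith
  have hδlim : Tendsto δ atTop (𝓝 0) := by
    refine squeeze_zero' (Eventually.of_forall hδ0) ?_ tendsto_inv_atTop_zero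
    filter_upwards [eventually_gt_atTop 0] with a ha
    rw [← one_div, le_div_iff₀ ha, mul_comm]
    exact hδ1 a ha
  -- `1 - δ² ≤ (1 + δ) e^{-δ} ≤ 1`, and `a δ ≤ 1`
  have hmain : Tendsto (fun a => a * (1 - (1 + δ a) * Real.exp (-δ a))) atTop (𝓝 0) := by
    refine squeeze_zero' ?_ ?_ hδlim
    · filter_upwards [eventually_ge_atTop 0] with a ha
      refine mul_nonneg ha ?_
      have h1 := Real.add_one_le_exp (δ a)
      have h2 : (1 + δ a) * Real.exp (-δ a) ≤ Real.exp (δ a) * Real.exp (-δ a) := by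
        gcongr
        linarith
      rw [← Real.exp_add, add_neg_cancel, Real.exp_zero] at h2
      linarith
    · filter_upwards [eventually_gt_atTop 0] with a ha
      have h1 := Real.add_one_le_exp (-δ a)
      have h2 := hδ0 a
      have h3 := hδ1 a ha
      have h4 : (1 + δ a) * (-δ a + 1) ≤ (1 + δ a) * Real.exp (-δ a) := by gcongr
      calc a * (1 - (1 + δ a) * Real.exp (-δ a)) ≤ a * (δ a ^ 2) := by
            gcongr
            nlinarith
        _ = (a * δ a) * δ a := by ring
        _ ≤ 1 * δ a := by gcongr
        _ = δ a := one_mul _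
  have hrest : Tendsto (fun a => (1 + δ a) ^ 2 * Real.exp (-δ a) - 1) atTop (𝓝 0) := by
    have : Continuous fun x : ℝ => (1 + x) ^ 2 * Real.exp (-x) - 1 := by fun_prop
    have h1 := (this.tendsto 0).comp hδlim
    simpa [Function.comp_def] using h1
  have hsum := ((hrest.sub hmain).mul_const (Real.exp (-1)))
  rw [sub_zero, zero_mul] at hsum
  refine hsum.congr fun a => ?_
  have hx : xMax a = 1 + δ a := rfl
  rw [hx, div_eq_mul_inv, div_eq_mul_inv, ← Real.exp_neg, ← Real.exp_neg, neg_add, Real.exp_add]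
  ring

/-- The main term of the asymptotics of `γ(j, τ)`. -/
def gammaMain (j : ℕ) (τ : ℝ) : ℝ :=
  Real.exp ((((j : ℝ) + 1) * Real.log (1 / τ) + 1) / (Real.exp 1 * Real.log τ ^ 2))

/-- An error `o(1)` in the exponent is a factor tending to `1`, also after adding `1` to both
quantities. -/
lemma tendsto_gammaConst_ratio (hτ : 0 ≤ τ) (hτ1 : τ < 1) :
    Tendsto (fun j => (1 + gammaConst j τ) / (1 + gammaMain j τ)) atTop (𝓝 1) := by
  rcases hτ.eq_or_lt with rfl | hτ0
  · refine tendsto_const_nhds.congr fun j => ?_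
    simp [gammaConst, gammaMain]
  set ℓ := Real.log (1 / τ) with hℓ
  have hℓ0 : 0 < ℓ := Real.log_pos (by rw [lt_div_iff₀ hτ0]; linarith)
  have hlog : Real.log τ ^ 2 = ℓ ^ 2 := by rw [hℓ, one_div, Real.log_inv, neg_sq]
  set a : ℕ → ℝ := fun j => ((j : ℝ) + 1) * ℓ with ha
  have hat : Tendsto a atTop atTop :=
    (tendsto_atTop_add_const_right _ _ tendsto_natCast_atTop_atTop).atTop_mul_const hℓ0
  set e : ℕ → ℝ := fun j => ((a j * xMax (a j) + xMax (a j) ^ 2) / Real.exp (xMax (a j)) -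
    (a j + 1) / Real.exp 1) / ℓ ^ 2 with he
  have het : Tendsto e atTop (𝓝 0) := by
    have := (tendsto_xMax_exponent.comp hat).div_const (ℓ ^ 2)
    rwa [zero_div] at this
  have hge : ∀ j, gammaConst j τ = gammaMain j τ * Real.exp (e j) := fun j => by
    rw [gammaConst, gammaMain, ← Real.exp_add, hlog]
    congr 1
    simp only [he, ha, hℓ]
    have := Real.exp_pos 1
    have := Real.exp_pos (xMax (((j : ℝ) + 1) * Real.log (1 / τ)))
    rw [← hℓ]
    field_simp
    ring
  have hlim : Tendsto (fun j => |Real.exp (e j) - 1|) atTop (𝓝 0) := by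
    have h1 := (Real.continuous_exp.tendsto 0).comp het
    rw [Real.exp_zero] at h1
    have := (h1.sub_const 1).abs
    simpa using this
  rw [tendsto_iff_norm_sub_tendsto_zero]
  refine squeeze_zero (fun _ => norm_nonneg _) (fun j => ?_) hlim
  have hpos : 0 < gammaMain j τ := Real.exp_pos _
  have h2 : (1 + gammaConst j τ) / (1 + gammaMain j τ) - 1 =
      (gammaMain j τ / (1 + gammaMain j τ)) * (Real.exp (e j) - 1) := by
    rw [hge]
    field_simp
    ring
  rw [h2, norm_mul, Real.norm_of_nonneg (by positivity), Real.norm_eq_abs]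
  refine mul_le_of_le_one_left (abs_nonneg _) ?_
  rw [div_le_one (by positivity)]
  linarith

/-- The term `(j + 1) / (1 - τ)²` dominates in the bracket, so that only `γ(j, τ)` has to be
replaced by its main term. -/
theorem isEquivalent_constC (hτ : 0 ≤ τ) (hτ1 : τ < 1) :
    IsEquivalent atTop (fun j : ℕ => constC j τ)
      (fun j : ℕ => (j : ℝ) * 2 ^ j / (1 - τ) ^ 2 * (1 + gammaMain j τ)) := by
  have h1 : 0 < 1 - τ := by linarith
  have hgpos : ∀ j, 0 < gammaMain j τ := fun j => Real.exp_pos _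
  have hne : ∀ᶠ j : ℕ in atTop, (j : ℝ) * 2 ^ j / (1 - τ) ^ 2 * (1 + gammaMain j τ) ≠ 0 := by
    filter_upwards [eventually_gt_atTop 0] with j hj
    have hj' : (0 : ℝ) < j := by exact_mod_cast hj
    have := hgpos j
    positivity
  rw [isEquivalent_iff_tendsto_one hne]
  have hinv : Tendsto (fun j : ℕ => ((j : ℝ))⁻¹) atTop (𝓝 0) :=
    tendsto_inv_atTop_zero.comp tendsto_natCast_atTop_atTop
  have hA : Tendsto (fun j : ℕ => 1 + (1 + 2 * τ / (1 - τ)) * ((j : ℝ))⁻¹) atTop (𝓝 1) := by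
    have := (hinv.const_mul (1 + 2 * τ / (1 - τ))).const_add 1
    simpa using this
  have hB : Tendsto (fun j : ℕ => 4 * (1 - τ) / (1 + gammaMain j τ) * ((j : ℝ))⁻¹) atTop (𝓝 0) := by
    have h2 := hinv.const_mul (4 * (1 - τ))
    rw [mul_zero] at h2
    refine squeeze_zero (fun j => ?_) (fun j => ?_) h2
    · have := hgpos j
      positivity
    · have := hgpos j
      gcongr
      exact div_le_self (by positivity) (by linarith)
  have hlim := ((tendsto_gammaConst_ratio hτ hτ1).mul hA).add hB
  rw [one_mul, add_zero] at hlim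
  refine hlim.congr' ?_
  filter_upwards [eventually_gt_atTop 0] with j hj
  have hj' : (0 : ℝ) < j := by exact_mod_cast hj
  have := hgpos j
  simp only [Pi.div_apply, constC]
  field_simp
  ring

end Constant

end MeanField

end

theorem mainTheorem1 {d : ℕ} (hd : 0 < d)
    -- the Planck constant and the even, real-valued interaction potential
    (hbar : ℝ) (hhbar : 0 < hbar)
    (Φ : EuclideanSpace ℝ (Fin d) → ℝ) (hΦ_even : ∀ x, Φ (-x) = Φ x)
    (Φhat : EuclideanSpace ℝ (Fin d) → ℂ) (hΦhat : MeanField.HasFourierTransform Φ Φhat)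
    (β β' : ℝ) (hβ : 0 < β) (hβ' : β < β')
    (hΦ_analytic : MeanField.expMoment Φhat β' < ∞)
    -- the initial datum
    (Fin₀ : MeanField.L2 (Fin d) →L[ℂ] MeanField.L2 (Fin d))
    (hFin_density : MeanField.IsDensityOperator Fin₀)
    (hFin_analytic : MeanField.oneNorm hbar β' Fin₀ < ∞)
    (M α : ℝ) (hM : M = (MeanField.oneNorm hbar β' Fin₀).toReal)
    (hα : α = Real.log M + Real.log 2)
    -- the Hartree solution and the `N`-body solutions
    (F : ℝ → (MeanField.L2 (Fin d) →L[ℂ] MeanField.L2 (Fin d)))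
    (hF : MeanField.IsHartreeSolution hbar Φ F) (hF0 : F 0 = Fin₀)
    (FN : (N : ℕ) → ℝ → (MeanField.L2 (Fin N × Fin d) →L[ℂ] MeanField.L2 (Fin N × Fin d)))
    (hFN : ∀ N, 1 ≤ N → MeanField.IsNBodySolution hbar Φ N (FN N))
    (hFN0 : ∀ N, 1 ≤ N → ∀ Ψ, FN N 0 Ψ = MeanField.tensorPow N Fin₀ Ψ) :
    -- well-posedness of the definition of `β₀`, hence of `T = (β₀ - β) / β₀`
    (Φ ≠ 0 → MeanField.CPhi Φhat β' ((β' - β) / β') < ∞ →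
      ∃! β₀, MeanField.IsBetaZero α β β' Φhat β₀) ∧
    -- the convergence estimates
    (∀ β₀ T : ℝ, MeanField.IsBetaZero α β β' Φhat β₀ → T = MeanField.timeT β β₀ →
      (∀ t : ℝ, |t| < T → ∀ N j : ℕ, 1 ≤ j → j ≤ N →
        ∀ FNj : MeanField.L2 (Fin j × Fin d) →L[ℂ] MeanField.L2 (Fin j × Fin d),
          MeanField.IsMarginal (FN N t) FNj →
          MeanField.manyNorm hbar β (fun Ψ => FNj Ψ - MeanField.tensorPow j (F t) Ψ) ≤
            ENNReal.ofReal (MeanField.constC j (|t| / T) / N * (|t| / T) * M ^ j)) ∧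
      (∀ K : Set ℝ, IsCompact K → K ⊆ Set.Ioo (-1) 1 → ∀ ε : ℝ, 0 < ε →
        ∃ N₀ : ℕ, ∀ N : ℕ, N₀ ≤ N → ∀ t : ℝ, t / T ∈ K → ∀ j : ℕ, 1 ≤ j → j ≤ N →
          (t = 0 ∨ (j : ℝ) ≤ (Real.log N + Real.log (T / |t|)) /
            (Real.log M + 2 * Real.log 2 + 1 / (Real.exp 1 * Real.log (T / |t|)))) →
          ∀ FNj : MeanField.L2 (Fin j × Fin d) →L[ℂ] MeanField.L2 (Fin j × Fin d),
            MeanField.IsMarginal (FN N t) FNj →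
            MeanField.manyNorm hbar β (fun Ψ => FNj Ψ - MeanField.tensorPow j (F t) Ψ) ≤
              ENNReal.ofReal ε)) ∧
    -- the constant `C(j, τ)`
    (∀ τ : ℝ, 0 ≤ τ → τ < 1 →
      (∀ j, 0 < MeanField.constC j τ) ∧
      Asymptotics.IsEquivalent Filter.atTop (fun j : ℕ => MeanField.constC j τ)
        (fun j : ℕ => (j : ℝ) * 2 ^ j / (1 - τ) ^ 2 *
          (1 + Real.exp ((((j : ℝ) + 1) * Real.log (1 / τ) + 1) /
            (Real.exp 1 * Real.log τ ^ 2))))) := by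
  have hM1 : 1 ≤ M := hM ▸ MeanField.one_le_oneNorm hFin_density hFin_analytic
  refine ⟨fun hΦ0 hfin => MeanField.existsUnique_betaZero hd hΦhat hβ hβ' α hΦ0 hfin,
    fun β₀ T hβ₀ hT => ?_,
    fun τ hτ hτ1 => ⟨fun j => MeanField.constC_pos hτ hτ1 j, MeanField.isEquivalent_constC hτ hτ1⟩⟩
  subst hT
  have hT0 := (hβ₀.real_eq hβ).1
  have hmain : ∀ t : ℝ, |t| < MeanField.timeT β β₀ → ∀ N j : ℕ, 1 ≤ j → j ≤ N →
      ∀ FNj : MeanField.L2 (Fin j × Fin d) →L[ℂ] MeanField.L2 (Fin j × Fin d),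
        MeanField.IsMarginal (FN N t) FNj →
        MeanField.manyNorm hbar β (fun Ψ => FNj Ψ - MeanField.tensorPow j (F t) Ψ) ≤
          ENNReal.ofReal (8 * (|t| / MeanField.timeT β β₀ / N) * (3 / 2 * M) ^ j) :=
    fun t ht N j hj hjN FNj hFNj => MeanField.manyNorm_difference_le hhbar hΦ_even hΦhat hβ
      hFin_density hFin_analytic hM hα hF hF0 (hFN N (hj.trans hjN)) (hFN0 N (hj.trans hjN))
      hβ₀ ht hj hjN hFNj
  set T := MeanField.timeT β β₀
  refine ⟨fun t ht N j hj hjN FNj hFNj => (hmain t ht N j hj hjN FNj hFNj).trans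
    (ENNReal.ofReal_le_ofReal ?_), fun K _ hK ε hε => ?_⟩
  · have hτ : 0 ≤ |t| / T := by positivity
    have h1 := MeanField.eight_mul_le_constC hτ ((div_lt_one hT0).2 ht) hj
    have h2 : (3 / 2 * M) ^ j ≤ 2 ^ j * M ^ j := by
      rw [← mul_pow]
      gcongr
      norm_num
    calc 8 * (|t| / T / N) * (3 / 2 * M) ^ j ≤ 8 * (|t| / T / N) * (2 ^ j * M ^ j) := by gcongr
      _ = 8 * 2 ^ j * (|t| / T / N * M ^ j) := by ring
      _ ≤ MeanField.constC j (|t| / T) * (|t| / T / N * M ^ j) := by gcongr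
      _ = _ := by ring
  · -- large `j` are covered by `(4 M)^j ≤ N / τ`, the finitely many others by letting `N → ∞`
    obtain ⟨J, hJ⟩ := exists_pow_lt_of_lt_one (by positivity : 0 < ε / 8)
      (by norm_num : (3 / 8 : ℝ) < 1)
    obtain ⟨N₀, hN₀⟩ := exists_nat_ge (8 * (3 / 2 * M) ^ J / ε)
    refine ⟨N₀, fun N hN t htK j hj hjN hcond FNj hFNj => ?_⟩
    have hK' := hK htK
    have ht : |t| < T := by
      have h1 := abs_lt.2 ⟨hK'.1, hK'.2⟩
      rwa [abs_div, abs_of_pos hT0, div_lt_one hT0] at h1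
    refine (hmain t ht N j hj hjN FNj hFNj).trans (ENNReal.ofReal_le_ofReal ?_)
    have hNpos : (0 : ℝ) < N := by exact_mod_cast (lt_of_lt_of_le hj hjN)
    rcases eq_or_ne t 0 with rfl | ht0
    · simpa using hε.le
    have htpos : 0 < |t| := abs_pos.2 ht0
    set τ := |t| / T with hτ
    have hτ0 : 0 < τ := by positivity
    have hτ1 : τ < 1 := (div_lt_one hT0).2 ht
    rcases le_or_gt J j with hJj | hJj
    · have hinv : T / |t| = τ⁻¹ := by rw [hτ, inv_div]
      have hlog : 0 < Real.log (T / |t|) := Real.log_pos (by rwa [one_lt_div htpos])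
      have hMlog : 0 ≤ Real.log M := Real.log_nonneg hM1
      have hlog2 : 0 < Real.log 2 := Real.log_pos one_lt_two
      have h1 := hcond.resolve_left ht0
      rw [le_div_iff₀ (by positivity)] at h1
      have h2 : (j : ℝ) * Real.log (4 * M) ≤ Real.log (N * τ⁻¹) := by
        rw [Real.log_mul hNpos.ne' (by positivity), ← hinv, Real.log_mul (by norm_num) (by linarith),
          show (4 : ℝ) = 2 ^ 2 by norm_num, Real.log_pow]
        push_cast
        have h3 : 0 ≤ (j : ℝ) * (1 / (Real.exp 1 * Real.log (T / |t|))) := by positivity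
        linarith
      rw [← Real.log_pow, Real.log_le_log_iff (by positivity) (by positivity)] at h2
      have h3 : τ / N * (4 * M) ^ j ≤ 1 := by
        calc τ / N * (4 * M) ^ j ≤ τ / N * (N * τ⁻¹) := by gcongr
          _ = 1 := by field_simp
      calc 8 * (τ / N) * (3 / 2 * M) ^ j = 8 * (3 / 8) ^ j * (τ / N * (4 * M) ^ j) := by
            rw [show 3 / 2 * M = 3 / 8 * (4 * M) by ring, mul_pow]
            ring
        _ ≤ 8 * (3 / 8) ^ j * 1 := by gcongr
        _ ≤ ε := by
            have h4 := pow_le_pow_of_le_one (by norm_num : (0 : ℝ) ≤ 3 / 8) (by norm_num) hJj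
            linarith
    · have h1 : 8 * (3 / 2 * M) ^ J ≤ ε * N := by
        have h2 := hN₀.trans (by exact_mod_cast hN : (N₀ : ℝ) ≤ N)
        rwa [div_le_iff₀ hε, mul_comm (N : ℝ)] at h2
      calc 8 * (τ / N) * (3 / 2 * M) ^ j ≤ 8 * (1 / N) * (3 / 2 * M) ^ J := by
            gcongr
            linarith
        _ = 8 * (3 / 2 * M) ^ J / N := by ring
        _ ≤ ε := (div_le_iff₀ hNpos).2 h1
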